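/- **Setting.** Let $G=(V,E)$ be a finite simple graph, $n=|V|$, $N_v$ the neighbourhood of $v$, $\Delta$ the maximum degree, and $[q]$ a finite set of $q$ values. A Metropolis chain on $G$ is given by proposal distributions $\nu_v$ on $[q]$ and filters $f^v_{c,c'}:[q]^{N_v}\to[0,1]$ ($v\in V$, $c,c'\in[q]$). Its continuous-time version $(Y_t)_{t\ge 0}$ starts from a given $Y_0\in[q]^V$; every node has an independent rate-1 Poisson clock, and when the clock of $v$ rings, a proposal $c'$ is drawn from $\nu_v$ and, with probability $f^v_{c,c'}(Y(N_v))$, where $c$ is the current value of $v$, the value of $v$ is changed to $c'$ (otherwise it is unchanged). *Condition 1 (with constant $C>0$):* for all $(u,v)\in E$ and $a,b,c\in[q]$, $\mathbb{E}_{c'\sim\nu_v}[\delta_{u,a,b}f^v_{c,c'}]\le C/\Delta$, where $\delta_{u,a,b}f=\max|f(\sigma)-f(\tau)|$ over all $\sigma,\tau\in[q]^{N_v}$ with $\sigma_u=a$, $\tau_u=b$ and $\sigma=\tau$ elsewhere. *Model:* $G$ is a fully asynchronous message-passing network with reliable FIFO channels. Local computation is instantaneous and event-driven. A scheduler, which may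 depend on the entire input ($G$, $q$, $\nu$, $f$, $T$, $Y_0$) but not on the random choices of the nodes, imposes on the $k$-th message of every channel a delay in $(0,1]$ (possibly depending on the time of sending); a message is delivered after its delay, or together with its predecessor on the channel if this is later. Simultaneous deliveries take place in an arbitrary order. One time unit is the maximum delay. *Main algorithm, for a threshold $T\ge0$.* **Phase I:** node $v$ generates the times $t_v^1<\dots<t_v^{m_v}$ of the rings of its clock before time $T$ and independent proposals $c_v^i\sim\nu_v$, and sends $Y_0(v)$ and, one message per update, the proposals and the update times, truncated to $b=\lceil\log_2(n^4(\lceil T\rceil+1))\rceil$ binary digits after the point, to all neighbours. As long as a truncated time of $u$ equals one of $v$ for adjacent $u,v$, these two nodes send each other the next $b$ digits of all their update times, one message per update. Once $v$ has from all its neighbours $u$ all this information, with no such coincidence left, it enters **Phase II**, where it resolves its updates $i=1,\dots,m_v$ in order; decisions received earlier are queued and are then processed in order of receipt. Let $\widehat Y_v^{(i)}$ be the value of $v$ after its $i$-th update, $\widehat Y_v^{(0)}=Y_0(v)$. If the outcomes of exactly the first $j_u-1$ updates of a neighbour $u$ are known to $v$ at present, then the set $\mathcal S_t(u)$ of possible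 states of $u$ at time $t=t_v^i$ is $\{\widehat Y_u^{(k-1)}\}$ with $t_u^{k-1}\le t<t_u^k$ if $t<t_u^{j_u}$, and $\{\widehat Y_u^{(j_u-1)}\}\cup\{c_u^k: t_u^{j_u}\le t_u^k\le t\}$ otherwise (with $t_u^0=0$, $t_u^{m_u+1}=\infty$; times are compared as truncated). For its $i$-th update node $v$ draws one coin $\beta$ uniform in $[0,1)$ and, with $\mathcal C=\prod_{u\in N_v}\mathcal S_t(u)$, $c=\widehat Y_v^{(i-1)}$, $c'=c_v^i$, accepts as soon as $\beta<\min_{\tau\in\mathcal C}f^v_{c,c'}(\tau)$ and rejects as soon as $\beta\ge\max_{\tau\in\mathcal C}f^v_{c,c'}(\tau)$; it sends the decision to all neighbours, and these sets are updated upon every decision received from a neighbour. Node $v$ terminates and outputs $\widehat Y_T(v)=\widehat Y_v^{(m_v)}$ when all its updates are resolved. **Theorem.** For all $G$, $q$, $(\nu_v)$, $(f^v_{c,c'})$, $T\ge0$, $Y_0$ and every scheduler, the main algorithm has the following properties. 1. (Correctness) With probability 1 every execution terminates, and the output $\widehat Y_T\in[q]^V$ is distributed exactly as $Y_T$. 2.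 (Time complexity) For every $a\in\mathbb N$ there is a constant $K=K(a)$, depending on nothing else, such that with probability at least $1-n^{-a}$ every execution terminates within $K(\Delta T+\log n)$ time units. For every $a\in\mathbb N$ there is a constant $K=K(a)$, depending on nothing else, such that, if Condition 1 holds with constant $C$, then with probability at least $1-n^{-a}$ every execution terminates within $K((1+C)T+\log n)$ time units. 3. (Message complexity) There is an absolute constant $K$ such that, with probability 1, every message sent has at most $K(\log n+\log\lceil T\rceil+\log q)$ bits (where $\log\lceil T\rceil$ is read as $0$ for $T=0$). -/

import Mathlib

open MeasureTheory ProbabilityTheory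

universe u

namespace AsyncMetropolis

noncomputable section

open scoped Classical

/-! ### Fully asynchronous message passing on a network -/

/-- An event-driven program of one processor, with local states `S`, messages `M` and return
values `O`.  `start` is run at time `0`; `receive` is run, atomically, whenever a message is
delivered, and is told the neighbour that the message comes from.  Both yield the new local state
and, for each neighbour, the list of messages that are sent to it now, in this order.  The
processor has terminated once `output` is defined. -/
structure Program (V S M O : Type*) where
  start : S × (V → List M)
  receive : S → V → M → S × (V → List M)
  output : S → Option O

/-- The scheduler.  `delay u v k s` is the delay that it imposes on the `k`-th message from `u`
to `v` if that message is sent at time `s`.  Delays are normalized: the longest possible delay is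
one time unit. -/
structure Scheduler (V : Type*) where
  delay : V → V → ℕ → ℝ → ℝ
  delay_pos : ∀ u v k s, 0 < delay u v k s
  delay_le_one : ∀ u v k s, delay u v k s ≤ 1

/-- A global configuration: the current time, the local states, the messages in transit from `u`
to `v` (in the order of sending, each with its moment of delivery), and the number of messages sent
so far from `u` to `v`. -/
structure Config (V S M : Type*) where
  now : ℝ
  state : V → S
  channel : V → V → List (ℝ × M)
  sent : V → V → ℕ

/-- Put messages that are sent at time `now` on a channel, the first of them being the `k`-th
message of the channel.  Channels are FIFO: no message overtakes an earlier one. -/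
def transmit {M : Type*} (delay : ℕ → ℝ → ℝ) (now : ℝ) :
    ℕ → List (ℝ × M) → List M → List (ℝ × M)
  | _, ch, [] => ch
  | k, ch, m :: ms =>
      transmit delay now (k + 1)
        (ch ++ [(max ((ch.getLast?.map Prod.fst).getD now) (now + delay k now), m)]) ms

section Execution

variable {V S M O : Type*} (G : SimpleGraph V) (D : Scheduler V) (A : V → Program V S M O)

/-- The configuration at time `0`, after all processors have started. -/
def initialConfig : Config V S M where
  now := 0
  state v := (A v).start.1
  channel u v := if G.Adj u v then transmit (D.delay u v) 0 0 [] ((A u).start.2 v) else []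
  sent u v := if G.Adj u v then ((A u).start.2 v).length else 0

/-- The configuration after the first message in transit from `u` to `v`, namely `m`, has been
delivered at time `t`, the messages `rest` remaining on that channel. -/
def deliver (c : Config V S M) (u v : V) (t : ℝ) (m : M) (rest : List (ℝ × M)) :
    Config V S M :=
  let r := (A v).receive (c.state v) u m
  let ch : V → V → List (ℝ × M) := fun x y => if x = u ∧ y = v then rest else c.channel x y
  { now := t
    state := Function.update c.state v r.1
    channel := fun x y =>
      if x = v ∧ G.Adj x y then transmit (D.delay x y) t (c.sent x y) (ch x y) (r.2 y)
      else ch x y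
    sent := fun x y => if x = v ∧ G.Adj x y then c.sent x y + (r.2 y).length else c.sent x y }

/-- One step of an execution: delivery of a message whose moment of delivery is the earliest one.
Deliveries that are due at the same moment may happen in any order. -/
inductive Step : Config V S M → Config V S M → Prop
  | mk (c : Config V S M) (u v : V) (t : ℝ) (m : M) (rest : List (ℝ × M))
      (head : c.channel u v = (t, m) :: rest)
      (earliest : ∀ x y, ∀ p ∈ c.channel x y, t ≤ p.1) :
      Step c (deliver G D A c u v t m rest)

/-- An execution: it goes on as long as there are messages in transit, and then stands still. -/
def IsExecution (e : ℕ → Config V S M) : Prop :=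
  e 0 = initialConfig G D A ∧
    ∀ k, Step G D A (e k) (e (k + 1)) ∨
      ((∀ u v, (e k).channel u v = []) ∧ e (k + 1) = e k)

/-- All processors have terminated, and `y v` is the value returned by `v`. -/
def Returns (c : Config V S M) (y : V → O) : Prop :=
  ∀ v, (A v).output (c.state v) = some (y v)

/-- Every execution terminates. -/
def AlwaysTerminates : Prop :=
  ∀ e, IsExecution G D A e → ∃ k y, Returns A (e k) y

/-- Every execution terminates within `L` time units. -/
def TerminatesWithin (L : ℝ) : Prop :=
  ∀ e, IsExecution G D A e → ∃ k y, (e k).now ≤ L ∧ Returns A (e k) y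

/-- Some execution terminates with the output `y`. -/
def HasOutput (y : V → O) : Prop :=
  ∃ e, IsExecution G D A e ∧ ∃ k, Returns A (e k) y

/-- The message `m` is sent in some execution. -/
def IsSent (m : M) : Prop :=
  ∃ e, IsExecution G D A e ∧ ∃ k u v t, (t, m) ∈ (e k).channel u v

end Execution

/-! ### The Metropolis chain in continuous time -/

/-- Proposal distributions `ν_v` on `[q]` and Metropolis filters `f^v_{c,c'} : [q]^{N_v} → [0,1]`
on a graph. -/
structure MetropolisChain {V : Type*} (G : SimpleGraph V) (q : ℕ) where
  proposal : V → PMF (Fin q)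
  filter : (v : V) → Fin q → Fin q → (G.neighborSet v → Fin q) → unitInterval

/-- The randomness that belongs to one ring of a clock: the waiting time since the preceding ring,
the proposal, and the coin `β`. -/
abbrev Coins (q : ℕ) := ℝ × Fin q × ℝ

/-- The moment of the `i`-th ring (`i = 0, 1, …`) of the clock with the given waiting times. -/
def ringTime {q : ℕ} (r : ℕ → Coins q) (i : ℕ) : ℝ := ∑ k ∈ Finset.range (i + 1), (r k).1

/-- The uniform distribution on `[0,1)`. -/
def uniformCoin : Measure ℝ := volume.restrict (Set.Ico 0 1)

instance : IsProbabilityMeasure uniformCoin := ⟨by simp [uniformCoin]⟩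

instance : IsProbabilityMeasure (expMeasure 1) := isProbabilityMeasure_expMeasure one_pos

instance {q : ℕ} (ν : PMF (Fin q)) :
    IsProbabilityMeasure ((expMeasure 1).prod (ν.toMeasure.prod uniformCoin)) := inferInstance

section Chain

variable {V : Type*} {G : SimpleGraph V} {q : ℕ} (X : MetropolisChain G q)

/-- The law of all random choices: independent rate-`1` Poisson clocks at the nodes (independent
waiting times, exponential with parameter `1`), and independent proposals from `ν_v` and
independent uniform coins in `[0,1)` for the rings. -/
def law : Measure (V × ℕ → Coins q) :=
  Measure.infinitePi fun p : V × ℕ =>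
    (expMeasure 1).prod ((X.proposal p.1).toMeasure.prod uniformCoin)

/-- The random choices of the node `v`. -/
def coinsAt (ω : V × ℕ → Coins q) (v : V) : ℕ → Coins q := fun i => ω (v, i)

/-- All rings up to and including time `t`, in the order of time; `(v, i)` is the `i`-th ring
at `v`. -/
def ringsUpTo [Fintype V] (ω : V × ℕ → Coins q) (t : ℝ) : List (V × ℕ) :=
  ((Finset.univ : Finset V).toList.flatMap fun v =>
      (List.range {i | ringTime (coinsAt ω v) i ≤ t}.ncard).map fun i => (v, i)).insertionSort
    fun a b => ringTime (coinsAt ω a.1) a.2 ≤ ringTime (coinsAt ω b.1) b.2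

/-- The update of the configuration `y` at the ring `(v, i)`: the proposal `c'` replaces the state
`c` of `v` if the coin is less than `f^v_{c,c'}(y(N_v))`. -/
def metropolisUpdate (ω : V × ℕ → Coins q) (y : V → Fin q) (p : V × ℕ) : V → Fin q :=
  Function.update y p.1
    (if (ω p).2.2 < (X.filter p.1 (y p.1) (ω p).2.1 (fun u => y u) : ℝ) then (ω p).2.1
      else y p.1)

/-- The continuous-time chain `Y_t` started from `y₀`. -/
def chain [Fintype V] (y₀ : V → Fin q) (t : ℝ) (ω : V × ℕ → Coins q) : V → Fin q :=
  (ringsUpTo ω t).foldl (metropolisUpdate X ω) y₀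

/-- The maximum degree of the graph. -/
def maxDeg [Fintype V] (G : SimpleGraph V) : ℕ := G.maxDegree

/-- `δ_{u,a,b} f = max |f σ - f τ|` over all `σ`, `τ` with `σ_u = a`, `τ_u = b` that agree
elsewhere. -/
def influence {N : Type*} (f : (N → Fin q) → unitInterval) (u : N) (a b : Fin q) : ℝ :=
  ⨆ p : {p : (N → Fin q) × (N → Fin q) //
      p.1 u = a ∧ p.2 u = b ∧ ∀ w, w ≠ u → p.1 w = p.2 w},
    |(f p.1.1 : ℝ) - (f p.1.2 : ℝ)|

/-- The Lipschitz condition with constant `C`: for every edge `uv` and all `a`, `b`, `c`, the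
expectation of `δ_{u,a,b} f^v_{c,c'}` over a proposal `c'` from `ν_v` is at most `C / Δ`. -/
def LipschitzCondition [Fintype V] (C : ℝ) : Prop :=
  ∀ (v : V) (u : G.neighborSet v) (a b c : Fin q),
    ∑ c' : Fin q, (X.proposal v c').toReal * influence (X.filter v c c') u a b
      ≤ C / maxDeg G

end Chain

/-! ### The messages of the main algorithm -/

/-- Messages.  Phase I: the initial value; an update (truncated time and proposal), one message
for each update; the end of the list of updates; a further block of binary digits of an update
time.  Phase II: the decision on an update. -/
inductive Msg (q : ℕ) where
  | initial (c : Fin q)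
  | update (t : ℕ) (c : Fin q)
  | endOfUpdates
  | digits (d : ℕ)
  | decision (accepted : Bool)

/-- A self-delimiting binary code of a natural number. -/
def encodeNat (k : ℕ) : List Bool := k.bits.flatMap (fun b => [true, b]) ++ [false]

/-- Messages as bit strings. -/
def Msg.encode {q : ℕ} : Msg q → List Bool
  | .initial c => [true, false, false] ++ encodeNat c
  | .update t c => [true, false, true] ++ encodeNat t ++ encodeNat c
  | .endOfUpdates => [true, true, false]
  | .digits d => [true, true, true] ++ encodeNat d
  | .decision b => [false, b]

/-- The size of a message in bits. -/
def Msg.bitLength {q : ℕ} (m : Msg q) : ℕ := m.encode.length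

theorem encodeNat_append_inj {a b : ℕ} {x y : List Bool}
    (h : encodeNat a ++ x = encodeNat b ++ y) : a = b ∧ x = y := by
  have key : ∀ (l l' : List Bool) (x y : List Bool),
      (l.flatMap (fun b => [true, b]) ++ [false]) ++ x =
        (l'.flatMap (fun b => [true, b]) ++ [false]) ++ y → l = l' ∧ x = y := by
    intro l
    induction l with
    | nil =>
      intro l' x y h
      cases l' <;> simp_all
    | cons c l ih =>
      intro l' x y h
      cases l' with
      | nil => simp at h
      | cons c' l' =>
        simp only [List.flatMap_cons, List.cons_append, List.nil_append, List.cons.injEq,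
          true_and] at h
        obtain ⟨h1, h2⟩ := h
        obtain ⟨h3, h4⟩ := ih l' x y h2
        exact ⟨by rw [h1, h3], h4⟩
  obtain ⟨h1, h2⟩ := key _ _ _ _ h
  refine ⟨?_, h2⟩
  have := congrArg (List.foldr Nat.bit 0) h1
  have hb : ∀ n : ℕ, List.foldr Nat.bit 0 n.bits = n := by
    intro n
    induction n using Nat.binaryRec' with
    | zero => simp
    | bit b n hn ih => rw [Nat.bits_append_bit n b hn]; simp [ih]
  rwa [hb, hb] at this

/-- Different messages are different bit strings. -/
theorem Msg.encode_injective {q : ℕ} : Function.Injective (Msg.encode (q := q)) := by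
  have h0 : ∀ {a b : ℕ}, encodeNat a = encodeNat b → a = b := fun {a b} h =>
    (encodeNat_append_inj (a := a) (b := b) (x := []) (y := []) (by simpa using h)).1
  intro m m' h
  cases m <;> cases m' <;> simp [Msg.encode] at h ⊢
  · exact Fin.ext (h0 h)
  · obtain ⟨h1, h2⟩ := encodeNat_append_inj h
    exact ⟨h1, Fin.ext (h0 h2)⟩
  · exact h0 h
  · exact h

/-! ### The main algorithm -/

/-- What a node knows in the beginning: its neighbourhood, the number of nodes, the threshold `T`,
its initial value, its filters, and its own random choices. -/
structure NodeInput (V : Type*) (q : ℕ) where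
  nbrs : Set V
  card : ℕ
  T : ℝ
  init : Fin q
  filter : Fin q → Fin q → (nbrs → Fin q) → unitInterval
  coins : ℕ → Coins q

/-- What a node has been told by a neighbour `u`.
* `history` is `Ŷ_u^(0), …, Ŷ_u^(j_u - 1)`, so that `j_u` is its length;
* `updates` lists the truncated times of the updates of `u`, together with the proposals;
* `closed` says that this list is complete;
* `level` is the number of further blocks of digits by which the times have been refined;
* `blocks` collects the blocks of digits of the next refinement, until there is one for each
  update. -/
structure NbrView (q : ℕ) where
  history : List (Fin q)
  updates : List (ℕ × Fin q)
  closed : Bool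
  level : ℕ
  blocks : List ℕ

/-- The local state: the views of the neighbours, whether the node is in Phase II, the decisions
that were received in Phase I and wait to be processed, the number of updates resolved so far, and
the current value. -/
structure NodeState (V : Type*) (q : ℕ) where
  view : V → NbrView q
  phaseTwo : Bool
  queue : List (V × Bool)
  resolved : ℕ
  value : Fin q

namespace NodeInput

variable {V : Type*} {q : ℕ} (I : NodeInput V q)

/-- The number of rings of the clock of the node before time `T`. -/
def numUpdates : ℕ := {i | ringTime I.coins i < I.T}.ncard

/-- The number of binary digits in a block. -/
def blockLength : ℕ := Nat.clog 2 (I.card ^ 4 * (⌈I.T⌉₊ + 1))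

/-- The time of the `i`-th update of the node, truncated to `ℓ + 1` blocks of digits after the
binary point, as a multiple of the precision. -/
def truncTime (ℓ i : ℕ) : ℕ := ⌊ringTime I.coins i * 2 ^ (I.blockLength * (ℓ + 1))⌋₊

/-- The last block of digits of this truncation. -/
def digitBlock (ℓ i : ℕ) : ℕ := I.truncTime ℓ i % 2 ^ I.blockLength

/-- At the precision reached so far on the channel between the node and the neighbour, the
truncated time of some update of the node coincides with that of an update of the neighbour.  Both
ends of the channel evaluate this from the same data. -/
def Ambiguous (w : NbrView q) : Prop :=
  ∃ i < I.numUpdates, ∃ r ∈ w.updates, r.1 = I.truncTime w.level i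

/-- The next block of digits of all update times, sent to a neighbour if the precision does not
suffice. -/
def refinement (w : NbrView q) : List (Msg q) :=
  if I.Ambiguous w then
    (List.range I.numUpdates).map fun i => Msg.digits (I.digitBlock (w.level + 1) i)
  else []

/-- The node knows the initial value, the proposals and, precisely enough, the update times of the
neighbour. -/
def Ready (w : NbrView q) : Prop := w.closed = true ∧ ¬ I.Ambiguous w

/-- The set of possible states of a neighbour at the time of the `i`-th update of the node. -/
def possible (w : NbrView q) (i : ℕ) : Set (Fin q) :=
  let t := I.truncTime w.level i
  let j := w.history.length
  if ∀ r, w.updates[j - 1]? = some r → t < r.1 then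
    {y | w.history[w.updates.countP fun r => r.1 ≤ t]? = some y}
  else
    {y | w.history.getLast? = some y} ∪
      {y | ∃ k, j ≤ k + 1 ∧ ∃ r, w.updates[k]? = some r ∧ r.1 ≤ t ∧ r.2 = y}

/-- The product of the sets of possible states of the neighbours. -/
def candidates (s : NodeState V q) (i : ℕ) : Set (I.nbrs → Fin q) :=
  {τ | ∀ u : I.nbrs, τ u ∈ I.possible (s.view u) i}

/-- The acceptance probability of the next update if the neighbours are in the states `τ`. -/
def bias (s : NodeState V q) (τ : I.nbrs → Fin q) : ℝ :=
  I.filter s.value (I.coins s.resolved).2.1 τ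

/-- The minimum acceptance probability `P_AC`. -/
def pAccept (s : NodeState V q) : ℝ := ⨅ τ : I.candidates s s.resolved, I.bias s τ

/-- The minimum rejection probability `P_RE`. -/
def pReject (s : NodeState V q) : ℝ := ⨅ τ : I.candidates s s.resolved, (1 - I.bias s τ)

/-- Resolve updates, one after the other, for as long as they can be resolved with the present
information (at most `fuel` of them).  The list of the decisions is returned as well. -/
def resolveLoop : ℕ → NodeState V q → NodeState V q × List Bool
  | 0, s => (s, [])
  | fuel + 1, s =>
      let β : ℝ := (I.coins s.resolved).2.2
      if β < I.pAccept s then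
        let r := resolveLoop fuel
          { s with resolved := s.resolved + 1, value := (I.coins s.resolved).2.1 }
        (r.1, true :: r.2)
      else if 1 - I.pReject s ≤ β then
        let r := resolveLoop fuel { s with resolved := s.resolved + 1 }
        (r.1, false :: r.2)
      else (s, [])

/-- Resolve as many of the remaining updates as possible. -/
def resolve (s : NodeState V q) : NodeState V q × List Bool :=
  I.resolveLoop (I.numUpdates - s.resolved) s

end NodeInput

/-- Replace the view of the neighbour `u`. -/
def NodeState.setView {V : Type*} {q : ℕ} (s : NodeState V q) (u : V) (w : NbrView q) :
    NodeState V q := { s with view := Function.update s.view u w }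

/-- Record the decision on the `j_u`-th update of a neighbour: after an acceptance the next state
is the proposal, after a rejection it is the preceding state. -/
def NbrView.learn {q : ℕ} (w : NbrView q) (accepted : Bool) : NbrView q :=
  { w with
    history := w.history ++
      (if accepted then (w.updates[w.history.length - 1]?).map Prod.snd
        else w.history.getLast?).toList }

/-- Record a block of digits; if the blocks are complete then refine the update times. -/
def NbrView.addDigits {q : ℕ} (w : NbrView q) (blockLength d : ℕ) : NbrView q :=
  let b := w.blocks ++ [d]
  if b.length = w.updates.length then
    { w with
      updates := List.zipWith (fun r d => (r.1 * 2 ^ blockLength + d, r.2)) w.updates b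
      level := w.level + 1
      blocks := [] }
  else { w with blocks := b }

namespace NodeInput

variable {V : Type*} {q : ℕ} (I : NodeInput V q)

/-- Phase II: process one decision of the neighbour `u`, then resolve what can be resolved. -/
def process (s : NodeState V q) (u : V) (accepted : Bool) : NodeState V q × List Bool :=
  I.resolve (s.setView u ((s.view u).learn accepted))

/-- Process the waiting decisions in the order in which they were received. -/
def processAll : List (V × Bool) → NodeState V q → NodeState V q × List Bool
  | [], s => (s, [])
  | p :: l, s =>
      let r := I.process s p.1 p.2
      let r' := processAll l r.1
      (r'.1, r.2 ++ r'.2)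

/-- Enter Phase II as soon as all neighbours are ready. -/
def tryEnter (s : NodeState V q) : NodeState V q × List Bool :=
  if s.phaseTwo = false ∧ ∀ u ∈ I.nbrs, I.Ready (s.view u) then
    let r := I.resolve { s with phaseTwo := true }
    let r' := I.processAll r.1.queue { r.1 with queue := [] }
    (r'.1, r.2 ++ r'.2)
  else (s, [])

/-- A Phase I message from `u` has turned the view of `u` into `w`: send `reply` to `u`, enter
Phase II if possible, and then send the decisions made to all neighbours. -/
def phaseOneEvent (s : NodeState V q) (u : V) (w : NbrView q) (reply : List (Msg q)) :
    NodeState V q × (V → List (Msg q)) :=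
  let r := I.tryEnter (s.setView u w)
  (r.1, fun x => (if x = u then reply else []) ++ r.2.map Msg.decision)

/-- The reaction to a message `m` from the neighbour `u`. -/
def onReceive (s : NodeState V q) (u : V) (m : Msg q) : NodeState V q × (V → List (Msg q)) :=
  let w := s.view u
  match m with
  | .initial c => I.phaseOneEvent s u { w with history := [c] } []
  | .update t c => I.phaseOneEvent s u { w with updates := w.updates ++ [(t, c)] } []
  | .endOfUpdates =>
      let w' : NbrView q := { w with closed := true }
      I.phaseOneEvent s u w' (I.refinement w')
  | .digits d =>
      let w' := w.addDigits I.blockLength d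
      I.phaseOneEvent s u w' (if w'.blocks = [] then I.refinement w' else [])
  | .decision accepted =>
      if s.phaseTwo then
        let r := I.process s u accepted
        (r.1, fun _ => r.2.map Msg.decision)
      else ({ s with queue := s.queue ++ [(u, accepted)] }, fun _ => [])

/-- The local state in the beginning. -/
def initialState : NodeState V q where
  view _ := { history := [], updates := [], closed := false, level := 0, blocks := [] }
  phaseTwo := false
  queue := []
  resolved := 0
  value := I.init

/-- The messages that are sent to all neighbours in the beginning of Phase I. -/
def announcement : List (Msg q) :=
  Msg.initial I.init ::
    ((List.range I.numUpdates).map fun i => Msg.update (I.truncTime 0 i) (I.coins i).2.1) ++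
      [Msg.endOfUpdates]

/-- The main algorithm at a node. -/
def program : Program V (NodeState V q) (Msg q) (Fin q) where
  start :=
    let r := I.tryEnter I.initialState
    (r.1, fun _ => I.announcement ++ r.2.map Msg.decision)
  receive := I.onReceive
  output s := if s.phaseTwo = true ∧ s.resolved = I.numUpdates then some s.value else none

end NodeInput

/-- The main algorithm on the network `G`, for the chain `X`, the threshold `T`, the initial
configuration `y₀` and the random choices `ω`. -/
def mainAlgorithm {V : Type*} [Fintype V] {G : SimpleGraph V} {q : ℕ} (X : MetropolisChain G q)
    (T : ℝ) (y₀ : V → Fin q) (ω : V × ℕ → Coins q) (v : V) :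
    Program V (NodeState V q) (Msg q) (Fin q) :=
  NodeInput.program
    { nbrs := G.neighborSet v
      card := Fintype.card V
      T := T
      init := y₀ v
      filter := X.filter v
      coins := coinsAt ω v }

end

end AsyncMetropolis

open AsyncMetropolis

namespace AsyncMetropolis

noncomputable section

open scoped Classical

/-! ### The timed behaviour of the main algorithm as a recursion along the order of the rings -/

/-! The algorithm and the chain are run on the same clocks, proposals and coins, so correctness is
an almost sure equality, and the time bound is a statement about one random object.

Almost surely the clocks are in general position (`ae_regularClocks`): waiting times are positive,
every clock passes `T`, and the truncated times of two different nodes stop coinciding at some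
precision. On this event the whole execution is predictable. A `Timetable` extracts what matters
from the random choices, and `Timetable.run` computes from it, along the order of the rings, the
decision on each update and the moment at which it is resolved: the first relevant moment at which
all configurations of the neighbours that are still possible lead to the same comparison with the
coin. The recursion refers only to earlier rings, so after as many rounds as there are updates it
has reached a fixed point (`Timetable.run_eq_step`). The number, contents and times of all messages
follow. `Invariant.step` shows that every reachable configuration is given by this prediction
together with the numbers of delivered messages. The order of simultaneous deliveries is harmless:
updates are resolved neither early (`Consistent.resolveTime_le`) nor late (`Invariant.lt_resolved`).
Since the number of messages is bounded, executions terminate.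

For correctness, the true configuration is always among the possible ones, so a settled coin gives
the decision that the chain takes at that ring. Applying the rings in order of time reproduces the
recursion (`foldl_ringsUpTo`, `chain_eq`).

For the time bound, a decision travels for at most one time unit. Hence an update resolved more than
`n` units after the bound for entering Phase II is the end of a chain of `n + 1` updates, each
delayed either by an earlier update of its own node or by a decision of a neighbour whose arrival
settles it (`Timetable.exists_chain`). One decision removes at most one possible value of one
neighbour. Therefore it settles the update only if the coin falls into two intervals whose length is
an influence, and by the Lipschitz condition this has probability at most `2C/Δ`, given everything
that happened before (`lintegral_trigger_le`). Resampling the coins from the latest update downwards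
multiplies these bounds (`lintegral_delayChain_le`).

It remains to sum over all increasing chains of rings before `T`. Weighting a chain by `exp (-c t)`,
with `t` its last ring, each further ring costs a factor `1/c` per node
(`tsum_lintegral_discount_le`), and the weights of the possible nodes add up to at most `1 + 2C`.
With `c = e(1 + 2C)` every link contributes `1/e`, while undoing the weight costs `exp (cT)`. The
result, at most `|V| exp (cT - n)`, is `law_exists_delayChain_le`. The length of Phase I is
controlled by `law_coincide_le`: a coincidence at level `ℓ` has probability of order `T
2^(-b(ℓ+1))`, where `b` is the block length. The general bound is the case `C = Δ`. Message sizes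
are counted in `bitLength_message_le`. -/

/-- The combinatorial data that determine the behaviour of the main algorithm: the numbers of
updates, the numbers of refinements needed on the channels, the number `before u v i` of updates of
`u` that precede the `i`-th update of `v`, the proposals, and the comparisons of the coin of the
`i`-th update of `v` with the filter. -/
structure Timetable (V : Type*) (q : ℕ) where
  count : V → ℕ
  depth : V → V → ℕ
  before : V → V → ℕ → ℕ
  proposal : V → ℕ → Fin q
  accepts : V → ℕ → Fin q → (V → Fin q) → Bool

/-- For each update, whether it is accepted, and the moment at which it is resolved. -/
abbrev Outcome (V : Type*) := V → ℕ → Bool × ℝ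

/-- The moment of delivery of the last of `n` messages sent at time `s`, the first of them being the
`k`-th message of the channel, if the preceding message is delivered at time `d`. -/
def burst (delay : ℕ → ℝ → ℝ) (d : ℝ) (k : ℕ) (s : ℝ) : ℕ → ℝ
  | 0 => d
  | n + 1 => max (burst delay d k s n) (s + delay (k + n) s)

namespace Timetable

variable {V : Type*} {q : ℕ} (G : SimpleGraph V) (D : Scheduler V) (y₀ : V → Fin q)
  (S : Timetable V q)

/-- The moment at which `v` has received from `u` the update times with `ℓ + 1` blocks of digits. -/
def levelDone : ℕ → V → V → ℝ
  | 0, u, v => burst (D.delay u v) 0 0 0 (S.count u + 2)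
  | ℓ + 1, u, v => burst (D.delay u v) (levelDone ℓ u v) (S.count u + 2 + ℓ * S.count u)
      (levelDone ℓ v u) (S.count u)

/-- The number of messages of Phase I from `u` to `v`. -/
def phaseOneCount (u v : V) : ℕ := S.count u + 2 + S.depth u v * S.count u

/-- The moment at which `v` enters Phase II. -/
def enterTime (v : V) : ℝ := ⨆ u : V, if G.Adj u v then S.levelDone D (S.depth u v) u v else 0

/-- The value of `v` after its first `i` updates. -/
def value (g : Outcome V) (v : V) : ℕ → Fin q
  | 0 => y₀ v
  | i + 1 => if (g v i).1 then S.proposal v i else value g v i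

/-- The moment at which the decision on the `k`-th update of `u` arrives at `v`. -/
def arrival (g : Outcome V) (u v : V) : ℕ → ℝ
  | 0 => max (S.levelDone D (S.depth u v) u v)
      ((g u 0).2 + D.delay u v (S.phaseOneCount u v) (g u 0).2)
  | k + 1 => max (arrival g u v k)
      ((g u (k + 1)).2 + D.delay u v (S.phaseOneCount u v + (k + 1)) (g u (k + 1)).2)

/-- The number of relevant decisions of `u` that are known to `v` at time `s`. -/
def known (g : Outcome V) (v : V) (i : ℕ) (s : ℝ) (u : V) : ℕ :=
  ((Finset.range (S.before u v i)).filter fun k => S.arrival D g u v k ≤ s).card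

/-- The possible values of `u` after `b` updates if the decisions on the first `j` are known. -/
def possible (g : Outcome V) (u : V) (b j : ℕ) : Set (Fin q) :=
  {c | c = S.value y₀ g u (min j b) ∨ ∃ k, j ≤ k ∧ k < b ∧ S.proposal u k = c}

/-- The possible configurations of the neighbours at the `i`-th update of `v`. -/
def candidates (g : Outcome V) (v : V) (i : ℕ) (j : V → ℕ) : Set (V → Fin q) :=
  {τ | ∀ u, G.Adj v u → τ u ∈ S.possible y₀ g u (S.before u v i) (j u)}

/-- The coin decides the `i`-th update of `v` if `j u` decisions of each neighbour `u` are known. -/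
def Settled (g : Outcome V) (v : V) (i : ℕ) (j : V → ℕ) : Prop :=
  ∀ τ ∈ S.candidates G y₀ g v i j, ∀ τ' ∈ S.candidates G y₀ g v i j,
    S.accepts v i (S.value y₀ g v i) τ = S.accepts v i (S.value y₀ g v i) τ'

/-- The moment from which on `v` attempts to resolve its `i`-th update. -/
def readyTime (g : Outcome V) (v : V) : ℕ → ℝ
  | 0 => S.enterTime G D v
  | i + 1 => max (S.enterTime G D v) (g v i).2

/-- The moments at which the `i`-th update of `v` may be resolved. -/
def resolveTimes (g : Outcome V) (v : V) (i : ℕ) : Set ℝ :=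
  {s | (s = S.readyTime G D g v i ∨
      ∃ u, G.Adj v u ∧ ∃ k < S.before u v i, s = S.arrival D g u v k) ∧
    S.readyTime G D g v i ≤ s ∧ S.Settled G y₀ g v i (S.known D g v i s)}

/-- One round of the recursion for the outcome. -/
def step (g : Outcome V) : Outcome V := fun v i =>
  (S.accepts v i (S.value y₀ g v i) fun u => S.value y₀ g u (S.before u v i),
    sInf (S.resolveTimes G D y₀ g v i))

/-- The outcome of the main algorithm. -/
def run [Fintype V] : Outcome V := (S.step G D y₀)^[∑ v, S.count v] fun _ _ => (false, 0)

/-- `rank` witnesses that the updates are consistently ordered. -/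
structure IsRanked [Fintype V] (rank : V → ℕ → ℕ) : Prop where
  lt_total : ∀ v i, i < S.count v → rank v i < ∑ u, S.count u
  mono : ∀ v i j, i < j → j < S.count v → rank v i < rank v j
  before_count : ∀ u v i, i < S.count v → S.before u v i ≤ S.count u
  before_rank : ∀ u v i k, i < S.count v → k < S.before u v i → rank u k < rank v i

variable {G D y₀ S}

/-! #### Locality of the recursion -/

theorem levelDone_congr {S' : Timetable V q} (hc : S'.count = S.count) :
    ∀ ℓ u v, S'.levelDone D ℓ u v = S.levelDone D ℓ u v
  | 0, u, v => by simp [levelDone, hc]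
  | ℓ + 1, u, v => by simp [levelDone, hc, levelDone_congr hc ℓ]

theorem value_congr {S' : Timetable V q} {g g' : Outcome V} {v : V} : ∀ {i : ℕ},
    (∀ k < i, g' v k = g v k ∧ S'.proposal v k = S.proposal v k) →
    S'.value y₀ g' v i = S.value y₀ g v i
  | 0, _ => rfl
  | i + 1, h => by
    simp only [value]
    rw [value_congr fun k hk => h k (by omega), (h i (by omega)).1, (h i (by omega)).2]

theorem arrival_congr {S' : Timetable V q} (hc : S'.count = S.count) (hd : S'.depth = S.depth)
    {g g' : Outcome V} {u v : V} : ∀ {k : ℕ}, (∀ k' ≤ k, g' u k' = g u k') →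
    S'.arrival D g' u v k = S.arrival D g u v k
  | 0, h => by simp [arrival, phaseOneCount, hc, hd, levelDone_congr hc, h 0 le_rfl]
  | k + 1, h => by
    simp only [arrival, phaseOneCount, hc, hd, h (k + 1) le_rfl]
    rw [arrival_congr hc hd fun k' hk' => h k' (by omega)]

theorem possible_congr {S' : Timetable V q} {g g' : Outcome V} {u : V} {b j : ℕ}
    (h : ∀ k < b, g' u k = g u k ∧ S'.proposal u k = S.proposal u k) :
    S'.possible y₀ g' u b j = S.possible y₀ g u b j := by
  ext c
  simp only [possible, Set.mem_ofPred_eq]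
  rw [value_congr fun k hk => h k (by omega)]
  refine or_congr Iff.rfl (exists_congr fun k => and_congr_right fun _ => ?_)
  exact ⟨fun ⟨h1, h2⟩ => ⟨h1, by rw [← (h k h1).2, h2]⟩,
    fun ⟨h1, h2⟩ => ⟨h1, by rw [(h k h1).2, h2]⟩⟩

/-- `S'` has the same clocks as `S`, and `S'`, `g'` agree with `S`, `g` on all updates of rank below
`n`. -/
structure AgreesBelow (rank : V → ℕ → ℕ) (n : ℕ) (S S' : Timetable V q) (g g' : Outcome V) :
    Prop where
  count : S'.count = S.count
  depth : S'.depth = S.depth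
  before : S'.before = S.before
  outcome : ∀ v i, i < S.count v → rank v i < n → g' v i = g v i
  proposal : ∀ v i, i < S.count v → rank v i < n → S'.proposal v i = S.proposal v i

section Locality

variable [Fintype V] {rank : V → ℕ → ℕ} {S' : Timetable V q} {g g' : Outcome V} {v : V} {i : ℕ}

theorem IsRanked.lt_count_of_before (hr : S.IsRanked rank) (hi : i < S.count v) {u : V} {k : ℕ}
    (hk : k < S.before u v i) : k < S.count u :=
  lt_of_lt_of_le hk (hr.before_count u v i hi)

theorem AgreesBelow.own (hr : S.IsRanked rank) (hi : i < S.count v)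
    (h : AgreesBelow rank (rank v i) S S' g g') :
    ∀ k < i, g' v k = g v k ∧ S'.proposal v k = S.proposal v k := fun k hk =>
  ⟨h.outcome v k (hk.trans hi) (hr.mono v k i hk hi),
    h.proposal v k (hk.trans hi) (hr.mono v k i hk hi)⟩

theorem AgreesBelow.other (hr : S.IsRanked rank) (hi : i < S.count v)
    (h : AgreesBelow rank (rank v i) S S' g g') (u : V) :
    ∀ k < S.before u v i, g' u k = g u k ∧ S'.proposal u k = S.proposal u k := fun k hk =>
  ⟨h.outcome u k (hr.lt_count_of_before hi hk) (hr.before_rank u v i k hi hk),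
    h.proposal u k (hr.lt_count_of_before hi hk) (hr.before_rank u v i k hi hk)⟩

theorem AgreesBelow.arrival_eq (hr : S.IsRanked rank) (hi : i < S.count v)
    (h : AgreesBelow rank (rank v i) S S' g g') {u : V} {k : ℕ} (hk : k < S.before u v i) :
    S'.arrival D g' u v k = S.arrival D g u v k :=
  arrival_congr h.count h.depth fun k' hk' => (h.other hr hi u k' (hk'.trans_lt hk)).1

theorem AgreesBelow.known_eq (hr : S.IsRanked rank) (hi : i < S.count v)
    (h : AgreesBelow rank (rank v i) S S' g g') (s : ℝ) :
    S'.known D g' v i s = S.known D g v i s := by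
  ext u
  simp only [known, h.before]
  congr 1
  refine Finset.filter_congr fun k hk => ?_
  rw [h.arrival_eq hr hi (Finset.mem_range.1 hk)]

theorem AgreesBelow.candidates_eq (hr : S.IsRanked rank) (hi : i < S.count v)
    (h : AgreesBelow rank (rank v i) S S' g g') (j : V → ℕ) :
    S'.candidates G y₀ g' v i j = S.candidates G y₀ g v i j := by
  ext τ
  simp only [candidates, h.before, Set.mem_ofPred_eq]
  refine forall_congr' fun u => imp_congr_right fun _ => ?_
  rw [possible_congr (h.other hr hi u)]

theorem AgreesBelow.value_eq (hr : S.IsRanked rank) (hi : i < S.count v)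
    (h : AgreesBelow rank (rank v i) S S' g g') : S'.value y₀ g' v i = S.value y₀ g v i :=
  value_congr (h.own hr hi)

theorem AgreesBelow.settled_iff (hr : S.IsRanked rank) (hi : i < S.count v)
    (h : AgreesBelow rank (rank v i) S S' g g') (ha : S'.accepts v i = S.accepts v i)
    (j : V → ℕ) : S'.Settled G y₀ g' v i j ↔ S.Settled G y₀ g v i j := by
  simp only [Settled, h.candidates_eq hr hi, h.value_eq hr hi, ha]

/-- Readiness, relevant arrivals, own value and candidate sets at `(v, i)` involve only updates of
smaller rank. The proposal and the coin of `(v, i)` enter through `accepts v i` alone; this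
separation is what later makes resampling them possible. -/
theorem AgreesBelow.step_eq (hr : S.IsRanked rank) (hi : i < S.count v)
    (h : AgreesBelow rank (rank v i) S S' g g') (ha : S'.accepts v i = S.accepts v i) :
    S'.step G D y₀ g' v i = S.step G D y₀ g v i := by
  have hready : S'.readyTime G D g' v i = S.readyTime G D g v i := by
    cases i <;> simp [readyTime, enterTime, h.depth, levelDone_congr h.count]
    rename_i i
    rw [(h.own hr hi i (by omega)).1]
  have hval : (fun u => S'.value y₀ g' u (S.before u v i)) =
      fun u => S.value y₀ g u (S.before u v i) := by
    ext1 u; exact value_congr (h.other hr hi u)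
  simp only [step, h.before, hval, h.value_eq hr hi, ha, Prod.mk.injEq, true_and]
  congr 1
  ext s
  simp only [resolveTimes, hready, Set.mem_ofPred_eq, h.settled_iff hr hi ha, h.known_eq hr hi,
    h.before]
  refine and_congr_left fun _ => or_congr_right (exists_congr fun u => and_congr_right fun _ =>
    exists_congr fun k => and_congr_right fun hk => ?_)
  rw [h.arrival_eq hr hi hk]

/-- Each round fixes the outcomes of one further rank, so the starting values are forgotten. -/
theorem agreesBelow_iterate (hr : S.IsRanked rank) (g g' : Outcome V) (n : ℕ) :
    AgreesBelow rank n S S ((S.step G D y₀)^[n] g) ((S.step G D y₀)^[n] g') := by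
  induction n with
  | zero => exact ⟨rfl, rfl, rfl, by simp, by simp⟩
  | succ n ih =>
    refine ⟨rfl, rfl, rfl, fun v i hi hn => ?_, by simp⟩
    rw [Function.iterate_succ_apply', Function.iterate_succ_apply']
    refine AgreesBelow.step_eq hr hi ⟨rfl, rfl, rfl, fun u k hk hlt => ?_, by simp⟩ rfl
    exact ih.outcome u k hk (by omega)

/-- The outcome is a fixed point of the recursion. -/
theorem run_eq_step (hr : S.IsRanked rank) (hi : i < S.count v) :
    S.run G D y₀ v i = S.step G D y₀ (S.run G D y₀) v i := by
  -- Iterating from the default and from its image under `step` gives the same outcome on all ranks;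
  -- the second iteration is one round more of the first.
  have h := (agreesBelow_iterate (G := G) (D := D) (y₀ := y₀) hr (fun _ _ => (false, 0))
    (S.step G D y₀ fun _ _ => (false, 0)) (∑ u, S.count u)).outcome v i hi (hr.lt_total v i hi)
  rw [← Function.iterate_succ_apply, Function.iterate_succ_apply'] at h
  exact h.symm

/-- The outcome at an update depends only on the preceding updates and on the update itself. -/
theorem agreesBelow_run (hr : S.IsRanked rank) (n : ℕ) (hc : S'.count = S.count)
    (hd : S'.depth = S.depth) (hb : S'.before = S.before)
    (h : ∀ v i, i < S.count v → rank v i < n →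
      S'.proposal v i = S.proposal v i ∧ S'.accepts v i = S.accepts v i) :
    AgreesBelow rank n S S' (S.run G D y₀) (S'.run G D y₀) := by
  have hr' : S'.IsRanked rank := by
    obtain ⟨h1, h2, h3, h4⟩ := hr
    constructor <;> simpa only [hc, hb]
  induction n with
  | zero => exact ⟨hc, hd, hb, by simp, by simp⟩
  | succ n ih =>
    refine ⟨hc, hd, hb, fun v i hi hn => ?_, fun v i hi hn => (h v i hi hn).1⟩
    have ih := ih fun v i hi hn => h v i hi (by omega)
    rw [run_eq_step hr hi, run_eq_step hr' (by rwa [hc])]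
    refine AgreesBelow.step_eq hr hi ⟨hc, hd, hb, fun u k hk hlt => ?_, fun u k hk hlt => ?_⟩
      (h v i hi hn).2
    · exact ih.outcome u k hk (by omega)
    · exact ih.proposal u k hk (by omega)

end Locality
end Timetable

/-! ### Properties of the outcome -/

/-- For a downward closed predicate the filtered range is an initial segment, so comparing with its
size is the same as testing the predicate. This converts all counts of rings and of known decisions
into inequalities between times. -/
theorem lt_card_filter_range {P : ℕ → Prop} (hP : ∀ a b, a ≤ b → P b → P a) {n k : ℕ} :
    k < ((Finset.range n).filter P).card ↔ k < n ∧ P k := by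
  constructor
  · intro h
    by_contra hk
    have : (Finset.range n).filter P ⊆ Finset.range k := by
      intro a ha
      simp only [Finset.mem_filter, Finset.mem_range] at ha ⊢
      by_contra hka
      exact hk ⟨by omega, hP k a (by omega) ha.2⟩
    have := Finset.card_le_card this
    simp only [Finset.card_range] at this
    omega
  · rintro ⟨h1, h2⟩
    have : Finset.range (k + 1) ⊆ (Finset.range n).filter P := by
      intro a ha
      simp only [Finset.mem_filter, Finset.mem_range] at ha ⊢
      exact ⟨by omega, hP a k (by omega) h2⟩
    have := Finset.card_le_card this
    simp only [Finset.card_range] at this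
    omega

/-- A discrete intermediate value theorem. It isolates the single decision that settles an update
and the last configuration before a deadline. -/
theorem exists_switch {P : ℕ → Prop} {a b : ℕ} (hab : a ≤ b) (ha : ¬ P a) (hb : P b) :
    ∃ k, a ≤ k ∧ k < b ∧ ¬ P k ∧ P (k + 1) := by
  induction b, hab using Nat.le_induction with
  | base => exact absurd hb ha
  | succ n hn ih =>
    by_cases h : P n
    · obtain ⟨k, h1, h2, h3⟩ := ih h
      exact ⟨k, h1, by omega, h3⟩
    · exact ⟨n, hn, by omega, h, hb⟩

theorem le_burst (delay : ℕ → ℝ → ℝ) (d : ℝ) (k : ℕ) (s : ℝ) : ∀ n, d ≤ burst delay d k s n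
  | 0 => le_rfl
  | n + 1 => (le_burst delay d k s n).trans (le_max_left _ _)

theorem burst_le {delay : ℕ → ℝ → ℝ} (hd : ∀ k s, delay k s ≤ 1) {d : ℝ} {k : ℕ} {s : ℝ}
    (h : d ≤ s + 1) : ∀ n, burst delay d k s n ≤ s + 1
  | 0 => h
  | n + 1 => max_le (burst_le hd h n) (by linarith [hd (k + n) s])

namespace Timetable

variable {V : Type*} {q : ℕ} {G : SimpleGraph V} {D : Scheduler V} {y₀ : V → Fin q}
  {S : Timetable V q}

theorem levelDone_nonneg : ∀ ℓ u v, 0 ≤ S.levelDone D ℓ u v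
  | 0, _, _ => le_burst _ _ _ _ _
  | ℓ + 1, u, v => (levelDone_nonneg ℓ u v).trans (le_burst _ _ _ _ _)

theorem levelDone_le_succ (ℓ : ℕ) (u v : V) :
    S.levelDone D ℓ u v ≤ S.levelDone D (ℓ + 1) u v := le_burst _ _ _ _ _

theorem levelDone_mono (u v : V) : Monotone fun ℓ => S.levelDone D ℓ u v :=
  monotone_nat_of_le_succ fun ℓ => levelDone_le_succ ℓ u v

theorem levelDone_zero_le (u v : V) : S.levelDone D 0 u v ≤ 1 :=
  (burst_le (D.delay_le_one u v) (by norm_num) _).trans (by norm_num)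

/-- The blocks of level `ℓ + 1` leave `u` when level `ℓ` has arrived from `v`, and travel at most
one unit. The FIFO rule adds nothing, because the preceding level in the same direction was itself
delivered within one unit of an earlier moment of sending. -/
theorem levelDone_succ_le : ∀ ℓ u v, S.levelDone D (ℓ + 1) u v ≤ S.levelDone D ℓ v u + 1
  | 0, u, v => burst_le (D.delay_le_one u v)
      ((levelDone_zero_le u v).trans (by linarith [levelDone_nonneg (S := S) (D := D) 0 v u])) _
  | ℓ + 1, u, v => burst_le (D.delay_le_one u v)
      ((levelDone_succ_le ℓ u v).trans (by linarith [levelDone_le_succ (S := S) (D := D) ℓ v u])) _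

theorem levelDone_le : ∀ (ℓ : ℕ) (u v : V), S.levelDone D ℓ u v ≤ ℓ + 1
  | 0, u, v => by simpa using levelDone_zero_le u v
  | ℓ + 1, u, v => by
    have := levelDone_succ_le (S := S) (D := D) ℓ u v
    have := levelDone_le ℓ v u
    push_cast; linarith

theorem arrival_mono (g : Outcome V) (u v : V) : Monotone (S.arrival D g u v) :=
  monotone_nat_of_le_succ fun _ => le_max_left _ _

theorem lt_arrival (g : Outcome V) (u v : V) : ∀ k, (g u k).2 < S.arrival D g u v k
  | 0 => lt_of_lt_of_le (by linarith [D.delay_pos u v (S.phaseOneCount u v) (g u 0).2])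
      (le_max_right _ _)
  | k + 1 => lt_of_lt_of_le
      (by linarith [D.delay_pos u v (S.phaseOneCount u v + (k + 1)) (g u (k + 1)).2])
      (le_max_right _ _)

theorem lt_known_iff {g : Outcome V} {v : V} {i : ℕ} {s : ℝ} {u : V} {k : ℕ} :
    k < S.known D g v i s u ↔ k < S.before u v i ∧ S.arrival D g u v k ≤ s :=
  lt_card_filter_range fun _ _ hab h => (arrival_mono g u v hab).trans h

/-- The number of relevant decisions of `u` that are known to `v` immediately before time `s`. -/
def knownUntil (D : Scheduler V) (S : Timetable V q) (g : Outcome V) (v : V) (i : ℕ) (s : ℝ)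
    (u : V) : ℕ :=
  ((Finset.range (S.before u v i)).filter fun k => S.arrival D g u v k < s).card

theorem lt_knownUntil_iff {g : Outcome V} {v : V} {i : ℕ} {s : ℝ} {u : V} {k : ℕ} :
    k < S.knownUntil D g v i s u ↔ k < S.before u v i ∧ S.arrival D g u v k < s :=
  lt_card_filter_range fun _ _ hab h => (arrival_mono g u v hab).trans_lt h

theorem knownUntil_le_known {g : Outcome V} {v : V} {i : ℕ} {s : ℝ} {u : V} :
    S.knownUntil D g v i s u ≤ S.known D g v i s u := by
  by_contra! h
  have h1 := lt_knownUntil_iff.1 h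
  exact lt_irrefl _ (lt_known_iff.2 ⟨h1.1, h1.2.le⟩)

theorem value_mem_possible {g : Outcome V} {u : V} {b j : ℕ} :
    S.value y₀ g u b ∈ S.possible y₀ g u b j := by
  rcases le_total b j with h | h
  · exact Or.inl (by rw [min_eq_right h])
  · induction b, h using Nat.le_induction with
    | base => exact Or.inl (by simp)
    | succ b hb ih =>
      simp only [value]
      split_ifs with hc
      · exact Or.inr ⟨b, hb, by omega, rfl⟩
      · rcases ih with h | ⟨k, h1, h2, h3⟩
        · exact Or.inl (by rw [h, min_eq_left hb, min_eq_left (by omega)])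
        · exact Or.inr ⟨k, h1, by omega, h3⟩

/-- Learning an accepted decision replaces the current value by a proposal that was already
possible; learning a rejection only discards the proposal. -/
theorem possible_succ_subset {g : Outcome V} {u : V} {b j : ℕ} :
    S.possible y₀ g u b (j + 1) ⊆ S.possible y₀ g u b j := by
  rintro c (h | ⟨k, h1, h2, h3⟩)
  · rcases lt_or_ge j b with hj | hj
    · rw [min_eq_left (by omega)] at h
      simp only [value] at h
      split_ifs at h
      · exact Or.inr ⟨j, le_rfl, hj, h.symm⟩
      · exact Or.inl (by rw [h, min_eq_left hj.le])
    · exact Or.inl (by rw [h, min_eq_right hj, min_eq_right (by omega)])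
  · exact Or.inr ⟨k, by omega, h2, h3⟩

theorem possible_antitone {g : Outcome V} {u : V} {b : ℕ} :
    Antitone (S.possible y₀ g u b) :=
  antitone_nat_of_succ_le fun _ => possible_succ_subset

theorem possible_of_le {g : Outcome V} {u : V} {b j : ℕ} (h : b ≤ j) :
    S.possible y₀ g u b j = {S.value y₀ g u b} := by
  ext c
  constructor
  · rintro (h1 | ⟨k, h1, h2, -⟩)
    · rwa [min_eq_right h] at h1
    · omega
  · intro h1
    rw [Set.mem_singleton_iff.1 h1]
    exact value_mem_possible

/-- Decisions on updates after the `i`-th update of `v` carry no information about it, so only the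
numbers cut off at `before` have to be compared. -/
theorem candidates_subset {g : Outcome V} {v : V} {i : ℕ} {j j' : V → ℕ}
    (h : ∀ u, G.Adj v u → min (j u) (S.before u v i) ≤ j' u) :
    S.candidates G y₀ g v i j' ⊆ S.candidates G y₀ g v i j := by
  intro τ hτ u hu
  rcases le_total (j u) (S.before u v i) with h1 | h1
  · exact possible_antitone ((min_eq_left h1).symm.le.trans (h u hu)) (hτ u hu)
  · rw [possible_of_le h1, ← possible_of_le (j := j' u)]
    · exact hτ u hu
    · exact (min_eq_right h1).symm.le.trans (h u hu)

theorem Settled.mono {g : Outcome V} {v : V} {i : ℕ} {j j' : V → ℕ}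
    (hs : S.Settled G y₀ g v i j) (h : ∀ u, G.Adj v u → min (j u) (S.before u v i) ≤ j' u) :
    S.Settled G y₀ g v i j' := fun τ hτ τ' hτ' =>
  hs τ (candidates_subset h hτ) τ' (candidates_subset h hτ')

theorem truth_mem_candidates {g : Outcome V} {v : V} {i : ℕ} {j : V → ℕ} :
    (fun u => S.value y₀ g u (S.before u v i)) ∈ S.candidates G y₀ g v i j :=
  fun _ _ => value_mem_possible

/-- The filters depend only on the neighbours. -/
def IsLocal (G : SimpleGraph V) (S : Timetable V q) : Prop :=
  ∀ v i c (τ τ' : V → Fin q), (∀ u, G.Adj v u → τ u = τ' u) →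
    S.accepts v i c τ = S.accepts v i c τ'

theorem IsLocal.settled (hl : S.IsLocal G) {g : Outcome V} {v : V} {i : ℕ} {j : V → ℕ}
    (h : ∀ u, G.Adj v u → S.before u v i ≤ j u) : S.Settled G y₀ g v i j := by
  intro τ hτ τ' hτ'
  refine hl _ _ _ _ _ fun u hu => ?_
  have h1 := hτ u hu
  have h2 := hτ' u hu
  rw [possible_of_le (h u hu), Set.mem_singleton_iff] at h1 h2
  rw [h1, h2]

theorem enterTime_nonneg {v : V} : 0 ≤ S.enterTime G D v :=
  Real.iSup_nonneg fun u => by split_ifs; exacts [levelDone_nonneg _ _ _, le_rfl]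

theorem enterTime_le {v : V} {B : ℝ} (hB : 0 ≤ B)
    (h : ∀ u, G.Adj u v → S.levelDone D (S.depth u v) u v ≤ B) : S.enterTime G D v ≤ B :=
  Real.iSup_le (fun u => by split_ifs with hu; exacts [h u hu, hB]) hB

theorem enterTime_le_readyTime (g : Outcome V) (v : V) (i : ℕ) :
    S.enterTime G D v ≤ S.readyTime G D g v i := by
  cases i
  exacts [le_rfl, le_max_left _ _]

/-! ### Resolution moments as attained infima over finitely many events. -/

section Finite

variable [Fintype V]

theorem levelDone_le_enterTime {u v : V} (h : G.Adj u v) :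
    S.levelDone D (S.depth u v) u v ≤ S.enterTime G D v := by
  have := le_ciSup (f := fun u => if G.Adj u v then S.levelDone D (S.depth u v) u v else 0)
    (Set.finite_range _).bddAbove u
  rw [if_pos h] at this
  exact this

variable {rank : V → ℕ → ℕ} {v : V} {i : ℕ} {g : Outcome V}

/-- The moments at which the information that is relevant for an update changes. -/
def eventTimes (G : SimpleGraph V) (D : Scheduler V) (S : Timetable V q) (g : Outcome V) (v : V)
    (i : ℕ) : Set ℝ :=
  {s | s = S.readyTime G D g v i ∨ ∃ u, G.Adj v u ∧ ∃ k < S.before u v i, s = S.arrival D g u v k}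

theorem finite_eventTimes : (S.eventTimes G D g v i).Finite := by
  refine ((Set.finite_singleton (S.readyTime G D g v i)).union
    (Set.finite_iUnion fun u => ((Finset.range (S.before u v i)).finite_toSet.image
      (S.arrival D g u v)))).subset ?_
  rintro s (h | ⟨u, -, k, hk, h⟩)
  · exact Or.inl h
  · exact Or.inr (Set.mem_iUnion.2 ⟨u, k, by simpa using hk, h.symm⟩)

/-- Information changes only at the finitely many event times. Rounding an arbitrary moment down to
the last event therefore loses no information. -/
theorem exists_last_event {P : ℝ → Prop} (hP : ∀ a b, a ≤ b → P b → P a)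
    (h : P (S.readyTime G D g v i)) :
    ∃ s ∈ S.eventTimes G D g v i, S.readyTime G D g v i ≤ s ∧ P s ∧
      ∀ x ∈ S.eventTimes G D g v i, P x ↔ x ≤ s := by
  obtain ⟨s, ⟨h1, h2⟩, h3⟩ := Set.exists_max_image {s ∈ S.eventTimes G D g v i | P s} id
    (finite_eventTimes.subset fun _ h => h.1) ⟨_, Or.inl rfl, h⟩
  exact ⟨s, h1, h3 _ ⟨Or.inl rfl, h⟩, h2, fun x hx => ⟨fun h => h3 x ⟨hx, h⟩, fun h => hP _ _ h h2⟩⟩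

/-- At the last event up to `s` the same relevant decisions are known as at `s`, so that event is
itself a possible moment of resolution. -/
theorem sInf_resolveTimes_le {s : ℝ} (h : S.readyTime G D g v i ≤ s)
    (hs : S.Settled G y₀ g v i (S.known D g v i s)) :
    sInf (S.resolveTimes G D y₀ g v i) ≤ s := by
  obtain ⟨s', h1, h2, h3, h4⟩ := exists_last_event (P := fun x => x ≤ s)
    (fun a b hab hb => hab.trans hb) h
  suffices s' ∈ S.resolveTimes G D y₀ g v i from
    (csInf_le (finite_eventTimes.subset fun _ h => h.1).bddBelow this).trans h3
  refine ⟨h1, h2, hs.mono fun u hu => le_trans (min_le_left _ _) ?_⟩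
  by_contra! hlt
  obtain ⟨h5, h6⟩ := lt_known_iff.1 hlt
  exact lt_irrefl _ (lt_known_iff.2 ⟨h5, (h4 _ (Or.inr ⟨u, hu, _, h5, rfl⟩)).1 h6⟩)

/-- Used contrapositively: what is known strictly before the moment of resolution does not settle
the update, if the node has been ready before. -/
theorem sInf_resolveTimes_lt {s : ℝ} (h : S.readyTime G D g v i < s)
    (hs : S.Settled G y₀ g v i (S.knownUntil D g v i s)) :
    sInf (S.resolveTimes G D y₀ g v i) < s := by
  obtain ⟨s', h1, h2, h3, h4⟩ := exists_last_event (P := fun x => x < s)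
    (fun a b hab hb => hab.trans_lt hb) h
  suffices s' ∈ S.resolveTimes G D y₀ g v i from
    (csInf_le (finite_eventTimes.subset fun _ h => h.1).bddBelow this).trans_lt h3
  refine ⟨h1, h2, hs.mono fun u hu => le_trans (min_le_left _ _) ?_⟩
  by_contra! hlt
  obtain ⟨h5, h6⟩ := lt_knownUntil_iff.1 hlt
  exact lt_irrefl _ (lt_known_iff.2 ⟨h5, (h4 _ (Or.inr ⟨u, hu, _, h5, rfl⟩)).1 h6⟩)

/-- At the last of all events every relevant decision is known and each neighbour has one possible
value. The set is thus nonempty, and being finite it attains its infimum. -/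
theorem IsLocal.sInf_mem_resolveTimes (hl : S.IsLocal G) :
    sInf (S.resolveTimes G D y₀ g v i) ∈ S.resolveTimes G D y₀ g v i := by
  refine Set.Nonempty.csInf_mem ?_ (finite_eventTimes.subset fun _ h => h.1)
  obtain ⟨s', h1, h2, -, h4⟩ := exists_last_event (S := S) (G := G) (D := D) (g := g) (v := v)
    (i := i) (P := fun _ => True) (fun _ _ _ _ => trivial) trivial
  refine ⟨s', h1, h2, hl.settled fun u hu => ?_⟩
  by_contra! hlt
  exact lt_irrefl _ (lt_known_iff.2 ⟨hlt, (h4 _ (Or.inr ⟨u, hu, _, hlt, rfl⟩)).1 trivial⟩)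

/-! #### The fixed point -/

variable (G D y₀ S) in
/-- The moment at which the `i`-th update of `v` is resolved. -/
def resolvedAt (v : V) (i : ℕ) : ℝ := (S.run G D y₀ v i).2

theorem resolvedAt_eq (hr : S.IsRanked rank) (hi : i < S.count v) :
    S.resolvedAt G D y₀ v i = sInf (S.resolveTimes G D y₀ (S.run G D y₀) v i) := by
  rw [resolvedAt, run_eq_step hr hi]; rfl

theorem resolvedAt_mem (hl : S.IsLocal G) (hr : S.IsRanked rank) (hi : i < S.count v) :
    S.resolvedAt G D y₀ v i ∈ S.resolveTimes G D y₀ (S.run G D y₀) v i := by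
  rw [resolvedAt_eq hr hi]; exact hl.sInf_mem_resolveTimes

theorem readyTime_le_resolvedAt (hl : S.IsLocal G) (hr : S.IsRanked rank) (hi : i < S.count v) :
    S.readyTime G D (S.run G D y₀) v i ≤ S.resolvedAt G D y₀ v i :=
  (resolvedAt_mem hl hr hi).2.1

theorem enterTime_le_resolvedAt (hl : S.IsLocal G) (hr : S.IsRanked rank) (hi : i < S.count v) :
    S.enterTime G D v ≤ S.resolvedAt G D y₀ v i :=
  (enterTime_le_readyTime _ v i).trans (readyTime_le_resolvedAt hl hr hi)

theorem resolvedAt_le_succ (hl : S.IsLocal G) (hr : S.IsRanked rank) (hi : i + 1 < S.count v) :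
    S.resolvedAt G D y₀ v i ≤ S.resolvedAt G D y₀ v (i + 1) :=
  le_trans (le_max_right _ _) (readyTime_le_resolvedAt hl hr hi)

theorem resolvedAt_mono (hl : S.IsLocal G) (hr : S.IsRanked rank) {j : ℕ} (hj : j ≤ i)
    (hi : i < S.count v) : S.resolvedAt G D y₀ v j ≤ S.resolvedAt G D y₀ v i := by
  induction i, hj using Nat.le_induction with
  | base => exact le_rfl
  | succ i hj ih => exact (ih (by omega)).trans (resolvedAt_le_succ hl hr hi)

/-- The true values of the neighbours are one of the candidates, so once all candidates agree they
agree with the truth. This is the core of correctness. -/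
theorem run_fst_eq (hr : S.IsRanked rank) (hi : i < S.count v) {j : V → ℕ}
    (hs : S.Settled G y₀ (S.run G D y₀) v i j) {τ : V → Fin q}
    (hτ : τ ∈ S.candidates G y₀ (S.run G D y₀) v i j) :
    S.accepts v i (S.value y₀ (S.run G D y₀) v i) τ = (S.run G D y₀ v i).1 := by
  rw [run_eq_step hr hi]
  exact hs τ hτ _ truth_mem_candidates

/-- The last blocks from `u` to `v` answer a level that `u` has received by the time it enters Phase
II. Hence Phase I traffic cannot hold up the decisions of `u` by more than one unit. -/
theorem levelDone_depth_le (hsym : ∀ u v, S.depth u v = S.depth v u) {u v : V} (h : G.Adj u v) :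
    S.levelDone D (S.depth u v) u v ≤ S.enterTime G D u + 1 := by
  have h0 := enterTime_nonneg (S := S) (G := G) (D := D) (v := u)
  have h1 := levelDone_le_enterTime (S := S) (D := D) h.symm
  rw [hsym v u] at h1
  rcases hd : S.depth u v with _ | ℓ
  · exact (levelDone_zero_le u v).trans (by linarith)
  · have h2 := levelDone_succ_le (S := S) (D := D) ℓ u v
    have h3 := levelDone_le_succ (S := S) (D := D) ℓ v u
    rw [hd] at h1
    linarith

/-- A message can be held up by its predecessor on the channel, but the predecessor was sent no
later and also arrives within one unit of its sending. -/
theorem arrival_le (hl : S.IsLocal G) (hr : S.IsRanked rank)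
    (hsym : ∀ u v, S.depth u v = S.depth v u) {u v : V} (h : G.Adj u v) :
    ∀ {k : ℕ}, k < S.count u →
      S.arrival D (S.run G D y₀) u v k ≤ S.resolvedAt G D y₀ u k + 1
  | 0, hk => by
    refine max_le ((levelDone_depth_le hsym h).trans ?_) ?_
    · linarith [enterTime_le_resolvedAt (D := D) (y₀ := y₀) hl hr hk]
    · linarith [D.delay_le_one u v (S.phaseOneCount u v) (S.run G D y₀ u 0).2,
        show S.resolvedAt G D y₀ u 0 = (S.run G D y₀ u 0).2 from rfl]
  | k + 1, hk => by
    refine max_le ((arrival_le hl hr hsym h (by omega)).trans ?_) ?_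
    · linarith [resolvedAt_le_succ (D := D) (y₀ := y₀) hl hr hk]
    · linarith [D.delay_le_one u v (S.phaseOneCount u v + (k + 1)) (S.run G D y₀ u (k + 1)).2,
        show S.resolvedAt G D y₀ u (k + 1) = (S.run G D y₀ u (k + 1)).2 from rfl]

/-! #### Chains of updates -/

/-- The known decisions immediately before the `k`-th decision of `u` is taken into account, if
simultaneous decisions are taken into account in a fixed order of the nodes. -/
def knownDuring (D : Scheduler V) (S : Timetable V q) (g : Outcome V) (v : V) (i : ℕ) (u : V)
    (k : ℕ) (w : V) : ℕ :=
  if w = u then k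
  else if Fintype.equivFin V w < Fintype.equivFin V u then
    S.known D g v i (S.arrival D g u v k) w
  else S.knownUntil D g v i (S.arrival D g u v k) w

/-- The arrival of the decision on the `k`-th update of `u` settles the `i`-th update of `v`. -/
def Trigger (G : SimpleGraph V) (D : Scheduler V) (y₀ : V → Fin q) (S : Timetable V q)
    (u : V) (k : ℕ) (v : V) (i : ℕ) : Prop :=
  G.Adj v u ∧ k < S.before u v i ∧
    ¬ S.Settled G y₀ (S.run G D y₀) v i (S.knownDuring D (S.run G D y₀) v i u k) ∧
    S.Settled G y₀ (S.run G D y₀) v i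
      (Function.update (S.knownDuring D (S.run G D y₀) v i u k) u (k + 1))

/-- Just before the moment of resolution the update is not settled, and at that moment it is. The
simultaneous arrivals in between are added one at a time, so that a single decision can be held
responsible and its effect measured by one influence. -/
theorem exists_trigger (hl : S.IsLocal G) (hr : S.IsRanked rank) (hi : i < S.count v)
    (h : S.readyTime G D (S.run G D y₀) v i < S.resolvedAt G D y₀ v i) :
    ∃ u k, S.Trigger G D y₀ u k v i ∧
      S.resolvedAt G D y₀ v i = S.arrival D (S.run G D y₀) u v k := by
  set g := S.run G D y₀ with hg
  set s := S.resolvedAt G D y₀ v i with hs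
  set e := Fintype.equivFin V
  have hend : S.Settled G y₀ g v i (S.known D g v i s) := (resolvedAt_mem hl hr hi).2.2
  have hstart : ¬ S.Settled G y₀ g v i (S.knownUntil D g v i s) := fun hc =>
    lt_irrefl s (by
      conv_lhs => rw [hs, resolvedAt_eq hr hi]
      exact sInf_resolveTimes_lt h hc)
  -- The arrivals at time `s` from the first `n` nodes are counted, those from the others are not
  -- yet.
  let J : ℕ → V → ℕ := fun n w =>
    if (e w : ℕ) < n then S.known D g v i s w else S.knownUntil D g v i s w
  obtain ⟨n, -, hn, h1, h2⟩ := exists_switch (P := fun n => S.Settled G y₀ g v i (J n))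
    (a := 0) (b := Fintype.card V) (Nat.zero_le _) (by simpa [J] using hstart)
    (by simpa [J] using hend)
  set u := e.symm ⟨n, hn⟩ with hu
  have heu : e u = ⟨n, hn⟩ := by simp [hu]
  have hJu : J n u = S.knownUntil D g v i s u := by simp [J, heu]
  have hJ : J (n + 1) = Function.update (J n) u (S.known D g v i s u) := by
    ext w
    rcases eq_or_ne w u with rfl | hw
    · simp [J, heu]
    · have : (e w : ℕ) ≠ n := fun hc => hw (e.injective (by rw [heu]; exact Fin.ext hc))
      have : (e w : ℕ) < n + 1 ↔ (e w : ℕ) < n := by omega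
      simp [J, hw, this]
  -- Several decisions of the same node may arrive together, whence a second switch inside the
  -- contribution of `u`.
  obtain ⟨k, hk1, hk2, h3, h4⟩ := exists_switch
    (P := fun k => S.Settled G y₀ g v i (Function.update (J n) u k))
    (a := S.knownUntil D g v i s u) (b := S.known D g v i s u) knownUntil_le_known
    (by rw [← hJu, Function.update_eq_self]; exact h1) (by rw [← hJ]; exact h2)
  obtain ⟨hk3, hk4⟩ := lt_known_iff.1 hk2
  have hk5 : s = S.arrival D g u v k := by
    refine le_antisymm ?_ hk4
    by_contra! hc
    exact absurd (lt_knownUntil_iff.2 ⟨hk3, hc⟩) (by omega)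
  have hdur : S.knownDuring D g v i u k = Function.update (J n) u k := by
    ext w
    rcases eq_or_ne w u with rfl | hw
    · simp [knownDuring]
    · have h5 : Fintype.equivFin V w < Fintype.equivFin V u ↔ (e w : ℕ) < n := by
        change e w < e u ↔ _
        rw [heu, Fin.lt_def]
      simp only [knownDuring, hw, if_false, ← hk5, h5, J, ne_eq, not_false_eq_true,
        Function.update_of_ne]
  refine ⟨u, k, ⟨?_, hk3, ?_, ?_⟩, hk5⟩
  · by_contra hadj
    refine h3 (h4.mono fun w hw => (min_le_left _ _).trans (le_of_eq ?_))
    have : w ≠ u := fun hc => hadj (hc ▸ hw)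
    simp [this]
  · rw [hdur]; exact h3
  · rw [hdur, Function.update_idem]; exact h4

/-- A possible reason for the update `p` to be resolved late: either a preceding update of the same
node or a decision that settles `p`. -/
def Delays (G : SimpleGraph V) (D : Scheduler V) (y₀ : V → Fin q) (S : Timetable V q)
    (p p' : V × ℕ) : Prop :=
  (p.1 = p'.1 ∧ p'.2 < p.2) ∨ S.Trigger G D y₀ p'.1 p'.2 p.1 p.2

/-- An update that is resolved late is the end of a long chain of updates. -/
theorem exists_chain (hl : S.IsLocal G) (hr : S.IsRanked rank)
    (hsym : ∀ u v, S.depth u v = S.depth v u) {B : ℝ} (hB : ∀ v, S.enterTime G D v ≤ B) (n : ℕ) :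
    ∀ v i, i < S.count v → B + n < S.resolvedAt G D y₀ v i →
      ∃ l : List (V × ℕ), l.length = n ∧
        List.IsChain (S.Delays G D y₀) ((v, i) :: l) ∧
          ∀ p ∈ (v, i) :: l, p.2 < S.count p.1 := by
  induction n with
  | zero => exact fun v i hi _ => ⟨[], rfl, by simp, by simpa using hi⟩
  | succ n ih =>
    intro v i hi hlt
    push_cast at hlt
    suffices ∃ p : V × ℕ, p.2 < S.count p.1 ∧ B + n < S.resolvedAt G D y₀ p.1 p.2 ∧
        S.Delays G D y₀ (v, i) p by
      obtain ⟨⟨u, k⟩, hk, hlt', hd⟩ := this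
      obtain ⟨l, h1, h2, h3⟩ := ih u k hk hlt'
      refine ⟨(u, k) :: l, by simp [h1], List.isChain_cons_cons.2 ⟨hd, h2⟩, ?_⟩
      rintro p (_ | ⟨_, hp⟩)
      exacts [hi, h3 p (by assumption)]
    -- An update resolved as soon as it is ready was waiting for its predecessor at the same node,
    -- since entering Phase II happens by time `B`. Otherwise it waited for a decision, which cost
    -- at most one unit.
    rcases (readyTime_le_resolvedAt (G := G) (D := D) (y₀ := y₀) hl hr hi).eq_or_lt with h | h
    · cases i with
      | zero =>
        have := hB v
        simp only [readyTime] at h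
        have : (0 : ℝ) ≤ n := by positivity
        linarith
      | succ i =>
        refine ⟨(v, i), by dsimp only; omega, ?_, Or.inl ⟨rfl, by simp⟩⟩
        have h1 := hB v
        have : (0 : ℝ) ≤ n := by positivity
        rw [← h] at hlt
        simp only [readyTime, lt_max_iff] at hlt
        rcases hlt with hlt | hlt
        · linarith
        · exact lt_trans (by linarith) hlt
    · obtain ⟨u, k, ht, heq⟩ := exists_trigger hl hr hi h
      have hk := hr.lt_count_of_before hi ht.2.1
      refine ⟨(u, k), hk, ?_, Or.inr ht⟩
      have := arrival_le (G := G) (D := D) (y₀ := y₀) hl hr hsym ht.1.symm hk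
      dsimp only
      linarith

end Finite
end Timetable

/-! ### Clocks and update times -/

section Clocks

variable {q : ℕ} {r : ℕ → Coins q}

theorem ringTime_succ (r : ℕ → Coins q) (i : ℕ) :
    ringTime r (i + 1) = ringTime r i + (r (i + 1)).1 := by
  rw [ringTime, Finset.sum_range_succ]; rfl

theorem strictMono_ringTime (h : ∀ i, 0 < (r i).1) : StrictMono (ringTime r) :=
  strictMono_nat_of_lt_succ fun i => by rw [ringTime_succ]; linarith [h (i + 1)]

theorem ringTime_pos (h : ∀ i, 0 < (r i).1) (i : ℕ) : 0 < ringTime r i :=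
  Finset.sum_pos (fun _ _ => h _) ⟨0, by simp⟩

/-- A finite initial segment of the natural numbers is determined by its size. -/
theorem lt_ncard_iff {P : ℕ → Prop} (hP : ∀ a b, a ≤ b → P b → P a) (hfin : ∃ n, ¬ P n) {i : ℕ} :
    i < {i | P i}.ncard ↔ P i := by
  obtain ⟨n, hn⟩ := hfin
  have hlt : ∀ i, P i → i < n := fun i hi => by
    by_contra! h
    exact hn (hP _ _ h hi)
  have : {i | P i} = ((Finset.range n).filter P : Finset ℕ) := by
    ext i
    simpa using hlt i
  rw [this, Set.ncard_coe_finset, lt_card_filter_range hP]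
  exact and_iff_right_of_imp (hlt i)

end Clocks

namespace NodeInput

variable {V : Type*} {q : ℕ} (I : NodeInput V q)

/-- Truncating a finer truncation gives the coarser one; the receiver can thus refine a known time
by appending one block. -/
theorem truncTime_succ (ℓ i : ℕ) :
    I.truncTime (ℓ + 1) i = I.truncTime ℓ i * 2 ^ I.blockLength + I.digitBlock (ℓ + 1) i := by
  have h : I.truncTime (ℓ + 1) i / 2 ^ I.blockLength = I.truncTime ℓ i := by
    rw [truncTime, truncTime, ← Nat.cast_two, ← Nat.cast_pow, ← Nat.cast_pow,
      ← Nat.floor_div_natCast]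
    congr 1
    rw [show I.blockLength * (ℓ + 1 + 1) = I.blockLength * (ℓ + 1) + I.blockLength by ring, pow_add]
    push_cast
    field_simp
  rw [← h, digitBlock, mul_comm]
  exact (Nat.div_add_mod _ _).symm

theorem digitBlock_lt (ℓ i : ℕ) : I.digitBlock ℓ i < 2 ^ I.blockLength :=
  Nat.mod_lt _ (by positivity)

end NodeInput

/-! ### The timetable given by the random choices. -/

section Network

variable {V : Type*} [Fintype V] {G : SimpleGraph V} {q : ℕ}

/-- The input of the node `v` for the main algorithm. -/
def node (X : MetropolisChain G q) (T : ℝ) (y₀ : V → Fin q) (ω : V × ℕ → Coins q) (v : V) :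
    NodeInput V q where
  nbrs := G.neighborSet v
  card := Fintype.card V
  T := T
  init := y₀ v
  filter := X.filter v
  coins := coinsAt ω v

variable (X : MetropolisChain G q) (T : ℝ) (y₀ : V → Fin q) (ω : V × ℕ → Coins q)

/-- The truncated times of some updates of `u` and of `v` coincide. -/
def Coincide (u v : V) (ℓ : ℕ) : Prop :=
  ∃ i < (node X T y₀ ω u).numUpdates, ∃ k < (node X T y₀ ω v).numUpdates,
    (node X T y₀ ω u).truncTime ℓ i = (node X T y₀ ω v).truncTime ℓ k

/-- The combinatorial data of the main algorithm for the random choices `ω`. -/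
def timetable : Timetable V q where
  count v := (node X T y₀ ω v).numUpdates
  depth u v := sInf {ℓ | ¬ Coincide X T y₀ ω u v ℓ}
  -- The constant values beyond the last update make the timetable depend on finitely many entries;
  -- its range is then countable, which gives measurability.
  before u v i := if i < (node X T y₀ ω v).numUpdates then
    ((Finset.range (node X T y₀ ω u).numUpdates).filter fun k =>
      ringTime (coinsAt ω u) k < ringTime (coinsAt ω v) i).card else 0
  proposal v i := if i < (node X T y₀ ω v).numUpdates then (ω (v, i)).2.1 else y₀ v
  accepts v i c τ := if i < (node X T y₀ ω v).numUpdates then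
    decide ((ω (v, i)).2.2 < (X.filter v c (ω (v, i)).2.1 (fun u => τ u) : ℝ)) else false

/-- The clocks are in general position. -/
structure RegularClocks : Prop where
  pos : ∀ p, 0 < (ω p).1
  unbounded : ∀ v, ∃ i, T < ringTime (coinsAt ω v) i
  separated : ∀ u v, u ≠ v → ∃ ℓ, ¬ Coincide X T y₀ ω u v ℓ

variable {X T y₀ ω}

theorem Coincide.symm {u v : V} {ℓ : ℕ} (h : Coincide X T y₀ ω u v ℓ) :
    Coincide X T y₀ ω v u ℓ := by
  obtain ⟨i, hi, k, hk, h⟩ := h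
  exact ⟨k, hk, i, hi, h.symm⟩

theorem timetable_depth_comm (u v : V) :
    (timetable X T y₀ ω).depth u v = (timetable X T y₀ ω).depth v u := by
  simp only [timetable]
  congr 1
  ext ℓ
  exact not_congr ⟨Coincide.symm, Coincide.symm⟩

theorem coincide_of_lt_depth {u v : V} {ℓ : ℕ} (h : ℓ < (timetable X T y₀ ω).depth u v) :
    Coincide X T y₀ ω u v ℓ :=
  not_not.1 (Nat.notMem_of_lt_sInf h)

theorem count_pos_of_lt_depth {u v : V} {ℓ : ℕ} (h : ℓ < (timetable X T y₀ ω).depth u v) :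
    0 < (timetable X T y₀ ω).count u := by
  obtain ⟨i, hi, -⟩ := coincide_of_lt_depth h
  exact lt_of_le_of_lt (Nat.zero_le _) hi

theorem timetable_isLocal : (timetable X T y₀ ω).IsLocal G := by
  intro v i c τ τ' h
  have : (fun u : G.neighborSet v => τ u) = fun u : G.neighborSet v => τ' u := by
    ext1 u; exact h u u.2
  simp [timetable, this]

/-! ### Consequences of general position: counts and ranks in terms of ring times. -/

namespace RegularClocks

variable (h : RegularClocks X T y₀ ω)
include h

theorem strictMono (v : V) : StrictMono (ringTime (coinsAt ω v)) :=
  strictMono_ringTime fun i => h.pos (v, i)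

theorem lt_count_iff {v : V} {i : ℕ} :
    i < (timetable X T y₀ ω).count v ↔ ringTime (coinsAt ω v) i < T := by
  obtain ⟨n, hn⟩ := h.unbounded v
  exact lt_ncard_iff (P := fun i => ringTime (coinsAt ω v) i < T)
    (fun a b hab hb => ((h.strictMono v).monotone hab).trans_lt hb) ⟨n, hn.not_gt⟩

theorem lt_before_iff {u v : V} {i k : ℕ} (hi : i < (timetable X T y₀ ω).count v) :
    k < (timetable X T y₀ ω).before u v i ↔
      ringTime (coinsAt ω u) k < ringTime (coinsAt ω v) i := by
  simp only [timetable, show i < (node X T y₀ ω v).numUpdates from hi, if_true]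
  rw [lt_card_filter_range fun a b hab hb => ((h.strictMono u).monotone hab).trans_lt hb]
  exact and_iff_right_of_imp fun hk => h.lt_count_iff.2 (hk.trans (h.lt_count_iff.1 hi))

theorem not_coincide_depth {u v : V} (hne : u ≠ v) :
    ¬ Coincide X T y₀ ω u v ((timetable X T y₀ ω).depth u v) :=
  Nat.sInf_mem (s := {ℓ | ¬ Coincide X T y₀ ω u v ℓ}) (h.separated u v hne)

/-- At the final precision the truncated times are in the correct order. -/
theorem truncTime_le_iff {u v : V} (hne : u ≠ v) {i k : ℕ}
    (hi : i < (timetable X T y₀ ω).count v) (hk : k < (timetable X T y₀ ω).count u) :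
    (node X T y₀ ω u).truncTime ((timetable X T y₀ ω).depth u v) k ≤
        (node X T y₀ ω v).truncTime ((timetable X T y₀ ω).depth u v) i ↔
      k < (timetable X T y₀ ω).before u v i := by
  rw [h.lt_before_iff hi]
  have hmono : ∀ x y : ℝ, x ≤ y →
      ⌊x * 2 ^ ((node X T y₀ ω v).blockLength * ((timetable X T y₀ ω).depth u v + 1))⌋₊ ≤
        ⌊y * 2 ^ ((node X T y₀ ω v).blockLength * ((timetable X T y₀ ω).depth u v + 1))⌋₊ :=
    fun x y hxy => Nat.floor_le_floor (by gcongr)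
  constructor
  · intro hle
    by_contra! hc
    exact h.not_coincide_depth hne ⟨k, hk, i, hi, le_antisymm hle (hmono _ _ hc)⟩
  · exact fun hlt => hmono _ _ hlt.le

theorem ringTime_ne {u v : V} (hne : u ≠ v) {i k : ℕ}
    (hi : i < (timetable X T y₀ ω).count v) (hk : k < (timetable X T y₀ ω).count u) :
    ringTime (coinsAt ω u) k ≠ ringTime (coinsAt ω v) i := by
  intro he
  refine h.not_coincide_depth hne ⟨k, hk, i, hi, ?_⟩
  simp only [NodeInput.truncTime, node, he]
  rfl

/-- The number of updates that precede an update. -/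
theorem isRanked : (timetable X T y₀ ω).IsRanked fun v i =>
    (((Finset.univ : Finset V).sigma fun u => Finset.range ((timetable X T y₀ ω).count u)).filter
      fun p => ringTime (coinsAt ω p.1) p.2 < ringTime (coinsAt ω v) i).card := by
  have key : ∀ u v k i, k < (timetable X T y₀ ω).count u →
      ringTime (coinsAt ω u) k < ringTime (coinsAt ω v) i →
      (((Finset.univ : Finset V).sigma fun u => Finset.range ((timetable X T y₀ ω).count u)).filter
        fun p => ringTime (coinsAt ω p.1) p.2 < ringTime (coinsAt ω u) k).card <
      (((Finset.univ : Finset V).sigma fun u => Finset.range ((timetable X T y₀ ω).count u)).filter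
        fun p => ringTime (coinsAt ω p.1) p.2 < ringTime (coinsAt ω v) i).card := by
    intro u v k i hk hlt
    refine Finset.card_lt_card (Finset.ssubset_iff_of_subset ?_ |>.2 ⟨⟨u, k⟩, ?_, ?_⟩)
    · exact fun p hp => by
        simp only [Finset.mem_filter] at hp ⊢
        exact ⟨hp.1, hp.2.trans hlt⟩
    · simpa [hk] using hlt
    · simp
  refine ⟨fun v i hi => ?_, fun v i j hij hj => key v v i j (hij.trans hj) (h.strictMono v hij),
    fun u v i hi => ?_, fun u v i k hi hk => ?_⟩
  · calc _ < (((Finset.univ : Finset V).sigma fun u =>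
          Finset.range ((timetable X T y₀ ω).count u))).card := by
          refine Finset.card_lt_card (Finset.filter_ssubset.2 ⟨⟨v, i⟩, by simpa using hi, by simp⟩)
      _ = _ := by simp
  · by_contra! hc
    have := (h.lt_before_iff hi).1 hc
    have := h.lt_count_iff.2 (this.trans (h.lt_count_iff.1 hi))
    exact lt_irrefl _ this
  · have := (h.lt_before_iff hi).1 hk
    exact key u v k i (h.lt_count_iff.2 (this.trans (h.lt_count_iff.1 hi))) this

end RegularClocks
end Network

/-! ### Phase I at a node -/

section Network

variable {V : Type*} [Fintype V] {G : SimpleGraph V} {q : ℕ}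
  (X : MetropolisChain G q) (T : ℝ) (y₀ : V → Fin q) (ω : V × ℕ → Coins q) (D : Scheduler V)

/-- What a neighbour knows about `u` after the first `r` messages of Phase I. -/
def viewAt (u : V) (r : ℕ) : NbrView q :=
  let m := (timetable X T y₀ ω).count u
  { history := if r = 0 then [] else [y₀ u]
    updates := (List.range (min (r - 1) m)).map fun i =>
      ((node X T y₀ ω u).truncTime ((r - (m + 2)) / m) i, (ω (u, i)).2.1)
    closed := decide (m + 2 ≤ r)
    level := (r - (m + 2)) / m
    blocks := (List.range ((r - (m + 2)) % m)).map
      ((node X T y₀ ω u).digitBlock ((r - (m + 2)) / m + 1)) }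

/-- The `k`-th message from `u` to `v`. -/
def message (u v : V) (k : ℕ) : Msg q :=
  let m := (timetable X T y₀ ω).count u
  if k = 0 then .initial (y₀ u)
  else if k ≤ m then .update ((node X T y₀ ω u).truncTime 0 (k - 1)) (ω (u, k - 1)).2.1
  else if k = m + 1 then .endOfUpdates
  else if k < (timetable X T y₀ ω).phaseOneCount u v then
    .digits ((node X T y₀ ω u).digitBlock ((k - (m + 2)) / m + 1) ((k - (m + 2)) % m))
  else .decision ((timetable X T y₀ ω).run G D y₀ u (k - (timetable X T y₀ ω).phaseOneCount u v)).1

/-- The number of messages of Phase I that `v` has sent to `u` when it has received `r` messages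
from `u`. -/
def phaseOneSent (v u : V) (r : ℕ) : ℕ :=
  let m := (timetable X T y₀ ω).count u
  (timetable X T y₀ ω).count v + 2 + (timetable X T y₀ ω).count v *
    min ((timetable X T y₀ ω).depth u v) (if r < m + 2 then 0 else (r - (m + 2)) / m + 1)

/-- The answer of `v` when it has received `r` messages of Phase I from `u`. -/
def replyAt (v u : V) (r : ℕ) : List (Msg q) :=
  let m := (timetable X T y₀ ω).count u
  if m + 2 ≤ r ∧ (r - (m + 2)) % m = 0 ∧ (r - (m + 2)) / m < (timetable X T y₀ ω).depth u v then
    (List.range ((timetable X T y₀ ω).count v)).map fun i =>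
      .digits ((node X T y₀ ω v).digitBlock ((r - (m + 2)) / m + 1) i)
  else []

variable {X T y₀ ω D}

theorem le_phaseOneCount (u v : V) :
    (timetable X T y₀ ω).count u + 2 ≤ (timetable X T y₀ ω).phaseOneCount u v :=
  Nat.le_add_right _ _

/-- The number of complete levels among the first `r` messages of Phase I. -/
theorem level_lt_depth {u v : V} {r : ℕ} (hr : r < (timetable X T y₀ ω).phaseOneCount u v)
    (hc : (timetable X T y₀ ω).count u + 2 ≤ r) :
    (r - ((timetable X T y₀ ω).count u + 2)) / (timetable X T y₀ ω).count u <
      (timetable X T y₀ ω).depth u v := by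
  refine Nat.div_lt_of_lt_mul ?_
  rw [Timetable.phaseOneCount] at hr
  rw [mul_comm]; omega

theorem level_le_depth {u v : V} {r : ℕ} (hr : r ≤ (timetable X T y₀ ω).phaseOneCount u v) :
    (r - ((timetable X T y₀ ω).count u + 2)) / (timetable X T y₀ ω).count u ≤
      (timetable X T y₀ ω).depth u v := by
  refine Nat.div_le_of_le_mul ?_
  rw [Timetable.phaseOneCount] at hr
  rw [mul_comm]; omega

theorem viewAt_zero (u : V) : viewAt X T y₀ ω u 0 =
    { history := [], updates := [], closed := false, level := 0, blocks := [] } := by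
  simp [viewAt]

theorem ambiguous_viewAt_iff {u v : V} {r : ℕ} (hc : (timetable X T y₀ ω).count u + 2 ≤ r) :
    (node X T y₀ ω v).Ambiguous (viewAt X T y₀ ω u r) ↔ Coincide X T y₀ ω u v
      ((r - ((timetable X T y₀ ω).count u + 2)) / (timetable X T y₀ ω).count u) := by
  have : min (r - 1) ((timetable X T y₀ ω).count u) = (timetable X T y₀ ω).count u := by omega
  simp only [NodeInput.Ambiguous, viewAt, this, List.mem_map, List.mem_range, Coincide]
  constructor
  · rintro ⟨i, hi, _, ⟨k, hk, rfl⟩, h⟩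
    exact ⟨k, hk, i, hi, h⟩
  · rintro ⟨k, hk, i, hi, h⟩
    exact ⟨i, hi, _, ⟨k, hk, rfl⟩, h⟩

/-- By minimality of `depth` all lower levels have coincidences, and at level `depth` there is none.
So `v` is satisfied exactly with the last Phase I message of `u`. -/
theorem ready_viewAt_iff (h : RegularClocks X T y₀ ω) {u v : V} (hne : u ≠ v) {r : ℕ}
    (hr : r ≤ (timetable X T y₀ ω).phaseOneCount u v) :
    (node X T y₀ ω v).Ready (viewAt X T y₀ ω u r) ↔
      r = (timetable X T y₀ ω).phaseOneCount u v := by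
  by_cases hc : (timetable X T y₀ ω).count u + 2 ≤ r
  · rw [NodeInput.Ready, ambiguous_viewAt_iff hc]
    simp only [viewAt, hc, decide_true, true_and]
    constructor
    · intro h1
      by_contra hlt
      exact h1 (coincide_of_lt_depth (level_lt_depth (by omega) hc))
    · rintro rfl
      have : ((timetable X T y₀ ω).phaseOneCount u v - ((timetable X T y₀ ω).count u + 2)) /
          (timetable X T y₀ ω).count u = (timetable X T y₀ ω).depth u v := by
        rw [Timetable.phaseOneCount, Nat.add_sub_cancel_left]
        rcases Nat.eq_zero_or_pos ((timetable X T y₀ ω).count u) with h0 | h0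
        · rw [h0, Nat.div_zero]
          by_contra h1
          have := count_pos_of_lt_depth (show 0 < (timetable X T y₀ ω).depth u v by omega)
          omega
        · rw [Nat.mul_div_cancel _ h0]
      rw [this]
      exact h.not_coincide_depth hne
  · have := le_phaseOneCount (X := X) (T := T) (y₀ := y₀) (ω := ω) u v
    simp only [NodeInput.Ready, viewAt, hc, decide_false, Bool.false_eq_true, false_and, false_iff]
    omega

theorem refinement_viewAt (h : RegularClocks X T y₀ ω) {u v : V} (hne : u ≠ v) {r : ℕ}
    (hr : r ≤ (timetable X T y₀ ω).phaseOneCount u v)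
    (hc : (timetable X T y₀ ω).count u + 2 ≤ r)
    (hm : (r - ((timetable X T y₀ ω).count u + 2)) % (timetable X T y₀ ω).count u = 0) :
    (node X T y₀ ω v).refinement (viewAt X T y₀ ω u r) = replyAt X T y₀ ω v u r := by
  rw [NodeInput.refinement, replyAt]
  have hiff : (node X T y₀ ω v).Ambiguous (viewAt X T y₀ ω u r) ↔
      (r - ((timetable X T y₀ ω).count u + 2)) / (timetable X T y₀ ω).count u <
        (timetable X T y₀ ω).depth u v := by
    rw [ambiguous_viewAt_iff hc]
    refine ⟨fun h1 => ?_, coincide_of_lt_depth⟩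
    by_contra hlt
    have := level_le_depth hr
    rw [show (r - ((timetable X T y₀ ω).count u + 2)) / (timetable X T y₀ ω).count u =
      (timetable X T y₀ ω).depth u v by omega] at h1
    exact h.not_coincide_depth hne h1
  simp only [hiff, hc, hm, true_and]
  rfl

/-- Both the state after a Phase I message and the reply depend only on how many messages have
arrived. The four cases are the four kinds of Phase I messages. -/
theorem onReceive_phaseOne (h : RegularClocks X T y₀ ω) {u v : V} (hne : u ≠ v) {r : ℕ}
    (hr : r < (timetable X T y₀ ω).phaseOneCount u v) {s : NodeState V q}
    (hs : s.view u = viewAt X T y₀ ω u r) :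
    (node X T y₀ ω v).onReceive s u (message X T y₀ ω D u v r) =
      (node X T y₀ ω v).phaseOneEvent s u (viewAt X T y₀ ω u (r + 1))
        (replyAt X T y₀ ω v u (r + 1)) := by
  set m := (timetable X T y₀ ω).count u with hm
  unfold message
  simp only [← hm]
  split_ifs with h0 h1 h2
  · subst h0
    have : ¬ (m + 2 ≤ 0 + 1) := by omega
    simp only [NodeInput.onReceive, replyAt, ← hm, this, false_and, if_false]
    congr 1
    rw [hs]
    simp [viewAt]
  · have h3 : ¬ (m + 2 ≤ r + 1) := by omega
    have h4 : ¬ (m + 2 ≤ r) := by omega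
    have h5 : r - (m + 2) = 0 := by omega
    have h6 : r + 1 - (m + 2) = 0 := by omega
    simp only [NodeInput.onReceive, replyAt, ← hm, h3, false_and, if_false]
    congr 1
    rw [hs]
    simp only [viewAt, ← hm, h3, h4, h5, h6, h0]
    obtain ⟨r, rfl⟩ := Nat.exists_eq_succ_of_ne_zero h0
    have h7 : min (r + 1) m = r + 1 := by omega
    have h8 : min r m = r := by omega
    simp [h7, h8, List.range_succ]
  · have h3 : m + 2 ≤ r + 1 := by omega
    have h4 : ¬ (m + 2 ≤ r) := by omega
    have h5 : r - (m + 2) = 0 := by omega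
    have h6 : r + 1 - (m + 2) = 0 := by omega
    have h7 : min (r + 1 - 1) m = m := by omega
    have h8 : min (r - 1) m = m := by omega
    have hv : ({ s.view u with closed := true } : NbrView q) = viewAt X T y₀ ω u (r + 1) := by
      rw [hs]
      simp only [viewAt, ← hm, h3, h4, h5, h6, h0, h7, h8]
      simp
    simp only [NodeInput.onReceive, hv]
    rw [refinement_viewAt h hne (by omega) h3 (by rw [← hm, h6]; simp)]
  · have h4 : m + 2 ≤ r := by omega
    have hpos : 0 < m := count_pos_of_lt_depth (level_lt_depth hr h4)
    obtain ⟨x, rfl⟩ := Nat.exists_eq_add_of_le h4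
    have h5 : m + 2 + x - (m + 2) = x := by omega
    have h6 : m + 2 + x + 1 - (m + 2) = x + 1 := by omega
    have h7 : min (m + 2 + x + 1 - 1) m = m := by omega
    have h8 : min (m + 2 + x - 1) m = m := by omega
    have h9 : (m + 2 ≤ m + 2 + x) := by omega
    have h10 : (m + 2 ≤ m + 2 + x + 1) := by omega
    have hdm := Nat.div_add_mod x m
    have hlt := Nat.mod_lt x hpos
    have hb : (node X T y₀ ω v).blockLength = (node X T y₀ ω u).blockLength := rfl
    have hv : (s.view u).addDigits (node X T y₀ ω v).blockLength
        ((node X T y₀ ω u).digitBlock ((m + 2 + x - (m + 2)) / m + 1) ((m + 2 + x - (m + 2)) % m)) =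
        viewAt X T y₀ ω u (m + 2 + x + 1) := by
      rw [hs, NbrView.addDigits]
      simp only [viewAt, ← hm, h5, h6, h7, h8, h9, h10, List.length_append, List.length_map,
        List.length_range, List.length_singleton]
      -- This block is the last one of its level: the collected blocks are merged into the times,
      -- and the level increases.
      by_cases hx : x % m + 1 = m
      · have hd : (x + 1) / m = x / m + 1 := by
          have : x + 1 = m * (x / m + 1) := by rw [mul_add, mul_one]; omega
          rw [this, Nat.mul_div_cancel_left _ hpos]
        have hmod : (x + 1) % m = 0 := by
          have : x + 1 = m * (x / m + 1) := by rw [mul_add, mul_one]; omega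
          rw [this, Nat.mul_mod_right]
        rw [if_pos hx]
        simp only [hd, hmod]
        rw [show [(node X T y₀ ω u).digitBlock (x / m + 1) (x % m)] =
          [x % m].map ((node X T y₀ ω u).digitBlock (x / m + 1)) from rfl, ← List.map_append,
          ← List.range_succ, show (x % m).succ = m from hx, List.zipWith_map, List.zipWith_self]
        congr 1
        · simp
        refine List.map_congr_left fun i _ => ?_
        rw [NodeInput.truncTime_succ, hb]
      · have hd : (x + 1) / m = x / m := by
          have : x + 1 = m * (x / m) + (x % m + 1) := by omega
          rw [this, Nat.mul_add_div hpos, Nat.div_eq_of_lt (by omega : x % m + 1 < m), add_zero]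
        have hmod : (x + 1) % m = x % m + 1 := by
          have : x + 1 = m * (x / m) + (x % m + 1) := by omega
          rw [this, Nat.mul_add_mod, Nat.mod_eq_of_lt (by omega : x % m + 1 < m)]
        rw [if_neg hx]
        simp only [hd, hmod, List.range_succ, List.map_append, List.map_singleton]
        simp
    simp only [NodeInput.onReceive, hv]
    congr 1
    have hbl : (viewAt X T y₀ ω u (m + 2 + x + 1)).blocks = [] ↔ (x + 1) % m = 0 := by
      simp [viewAt, ← hm, h6]
    simp only [hbl]
    split_ifs with hz
    · exact refinement_viewAt h hne (by omega) (by rw [← hm]; omega) (by rw [← hm, h6]; exact hz)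
    · rw [replyAt, if_neg]
      rw [← hm, h6]
      tauto

theorem phaseOneSent_zero (v u : V) :
    phaseOneSent X T y₀ ω v u 0 = (timetable X T y₀ ω).count v + 2 := by
  simp [phaseOneSent]

theorem phaseOneSent_le (v u : V) (r : ℕ) :
    phaseOneSent X T y₀ ω v u r ≤ (timetable X T y₀ ω).phaseOneCount v u := by
  rw [phaseOneSent, Timetable.phaseOneCount, timetable_depth_comm v u, mul_comm]
  gcongr
  exact min_le_left _ _

theorem phaseOneSent_of_le {v u : V} {r : ℕ}
    (hr : (timetable X T y₀ ω).phaseOneCount u v ≤ r) :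
    phaseOneSent X T y₀ ω v u r = (timetable X T y₀ ω).phaseOneCount v u := by
  rw [phaseOneSent, Timetable.phaseOneCount, timetable_depth_comm v u, mul_comm]
  congr 2
  refine min_eq_left ?_
  rw [Timetable.phaseOneCount] at hr
  rw [if_neg (by omega)]
  rcases Nat.eq_zero_or_pos ((timetable X T y₀ ω).depth u v) with h0 | h0
  · rw [h0]; exact Nat.zero_le _
  · have hm := count_pos_of_lt_depth h0
    have : (timetable X T y₀ ω).depth u v ≤
        (r - ((timetable X T y₀ ω).count u + 2)) / (timetable X T y₀ ω).count u := by
      rw [Nat.le_div_iff_mul_le hm]; omega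
    exact this.trans (Nat.le_succ _)

theorem announcement_eq (v u : V) :
    (node X T y₀ ω v).announcement =
      (List.Ico 0 ((timetable X T y₀ ω).count v + 2)).map (message X T y₀ ω D v u) := by
  set m := (timetable X T y₀ ω).count v with hm
  have : List.Ico 0 (m + 2) = 0 :: ((List.range m).map (· + 1) ++ [m + 1]) := by
    rw [List.Ico.zero_bot, List.range_succ, List.range_succ_eq_map]
    rfl
  rw [this, NodeInput.announcement]
  simp only [List.map_cons, List.map_append, List.map_map, List.map_nil, List.cons_append]
  congr 1
  congr 1
  · refine List.map_congr_left fun i hi => ?_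
    have hi : i < m := List.mem_range.1 hi
    simp only [message, ← hm, Function.comp]
    rw [if_neg (by omega), if_pos (by omega)]
    rfl
  · simp [message, ← hm]

/-- The replies continue the numbered list of messages without gaps. The last clause records which
incoming message provokes the reply; it identifies the moment of sending with `levelDone`. -/
theorem replyAt_eq {v u : V} {r : ℕ} (hr : r < (timetable X T y₀ ω).phaseOneCount u v) :
    phaseOneSent X T y₀ ω v u r ≤ phaseOneSent X T y₀ ω v u (r + 1) ∧
    replyAt X T y₀ ω v u (r + 1) =
      (List.Ico (phaseOneSent X T y₀ ω v u r) (phaseOneSent X T y₀ ω v u (r + 1))).map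
        (message X T y₀ ω D v u) ∧
    ∀ k, phaseOneSent X T y₀ ω v u r ≤ k → k < phaseOneSent X T y₀ ω v u (r + 1) →
      (timetable X T y₀ ω).count v + 2 ≤ k ∧ k < (timetable X T y₀ ω).phaseOneCount v u ∧
        r + 1 = (timetable X T y₀ ω).count u + 2 +
          ((k - ((timetable X T y₀ ω).count v + 2)) / (timetable X T y₀ ω).count v) *
            (timetable X T y₀ ω).count u := by
  rcases Nat.eq_zero_or_pos ((timetable X T y₀ ω).depth u v) with h0 | h0
  · have : phaseOneSent X T y₀ ω v u r = phaseOneSent X T y₀ ω v u (r + 1) := by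
      simp [phaseOneSent, h0]
    rw [this]
    exact ⟨le_rfl, by simp [replyAt, h0], fun k h1 h2 => absurd h1 (by omega)⟩
  have hmu := count_pos_of_lt_depth h0
  have hmv := count_pos_of_lt_depth (h0.trans_eq (timetable_depth_comm u v))
  have hr' : r < (timetable X T y₀ ω).count u + 2 +
    (timetable X T y₀ ω).depth u v * (timetable X T y₀ ω).count u := hr
  have hn : (timetable X T y₀ ω).phaseOneCount v u = (timetable X T y₀ ω).count v + 2 +
      (timetable X T y₀ ω).count v * (timetable X T y₀ ω).depth u v := by
    rw [Timetable.phaseOneCount, timetable_depth_comm v u, mul_comm]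
  simp only [replyAt, phaseOneSent, hn]
  set m := (timetable X T y₀ ω).count u with hm
  set m' := (timetable X T y₀ ω).count v with hm'
  set L := (timetable X T y₀ ω).depth u v with hL
  by_cases hc : m + 2 ≤ r + 1 ∧ (r + 1 - (m + 2)) % m = 0 ∧ (r + 1 - (m + 2)) / m < L
  · rw [if_pos hc]
    obtain ⟨h1, h2, h3⟩ := hc
    obtain ⟨ℓ, hℓ⟩ : ∃ ℓ, r + 1 - (m + 2) = m * ℓ := Nat.dvd_of_mod_eq_zero h2
    rw [hℓ, Nat.mul_div_cancel_left _ hmu] at h3 ⊢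
    -- Just before the message that completes level `ℓ`, exactly `ℓ` refinements had been sent in
    -- reply.
    have hlev : (if r < m + 2 then 0 else (r - (m + 2)) / m + 1) = ℓ := by
      rcases Nat.eq_zero_or_pos ℓ with rfl | hpos
      · exact if_pos (by omega)
      · obtain ⟨ℓ, rfl⟩ := Nat.exists_eq_succ_of_ne_zero hpos.ne'
        rw [Nat.mul_succ] at hℓ
        have h4 : r - (m + 2) = m * ℓ + (m - 1) := by omega
        rw [if_neg (by omega), h4, Nat.mul_add_div hmu, Nat.div_eq_of_lt (by omega)]
    rw [hlev, if_neg (by omega), min_eq_right h3.le, min_eq_right (by omega : ℓ + 1 ≤ L)]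
    have hdm : ∀ i < m', (m' + 2 + m' * ℓ + i - (m' + 2)) / m' = ℓ ∧
        (m' + 2 + m' * ℓ + i - (m' + 2)) % m' = i := fun i hi => by
      rw [show m' + 2 + m' * ℓ + i - (m' + 2) = m' * ℓ + i by omega]
      exact ⟨by rw [Nat.mul_add_div hmv, Nat.div_eq_of_lt hi, add_zero],
        by rw [Nat.mul_add_mod, Nat.mod_eq_of_lt hi]⟩
    have hlt : ∀ i < m', m' + 2 + m' * ℓ + i < m' + 2 + m' * L := fun i hi => by
      have : m' * (ℓ + 1) ≤ m' * L := Nat.mul_le_mul_left _ h3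
      rw [Nat.mul_succ] at this; omega
    refine ⟨by gcongr; omega, ?_, fun k hk1 hk2 => ?_⟩
    · rw [List.Ico, show m' + 2 + m' * (ℓ + 1) - (m' + 2 + m' * ℓ) = m' by
        rw [Nat.mul_succ]; omega, List.range'_eq_map_range, List.map_map]
      refine List.map_congr_left fun i hi => ?_
      have hi := List.mem_range.1 hi
      simp only [Function.comp, message, ← hm']
      rw [if_neg (by omega), if_neg (by omega), if_neg (by omega), hn, if_pos (hlt i hi),
        (hdm i hi).1, (hdm i hi).2]
    · obtain ⟨i, rfl⟩ := Nat.exists_eq_add_of_le hk1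
      rw [Nat.mul_succ] at hk2
      have hi : i < m' := by omega
      rw [(hdm i hi).1]
      exact ⟨by omega, hlt i hi, by rw [mul_comm ℓ]; omega⟩
  -- No reply is due: the announcement is incomplete, or no level has been completed, or the
  -- required depth has been reached. In each case the number of refinements sent does not change.
  · have heq : min L (if r < m + 2 then 0 else (r - (m + 2)) / m + 1) =
        min L (if r + 1 < m + 2 then 0 else (r + 1 - (m + 2)) / m + 1) := by
      rcases lt_or_ge (r + 1) (m + 2) with h1 | h1
      · rw [if_pos h1, if_pos (by omega)]
      rw [if_neg (by omega : ¬ r + 1 < m + 2)]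
      by_cases h2 : (r + 1 - (m + 2)) % m = 0
      · have h3 : L ≤ (r + 1 - (m + 2)) / m := by
          by_contra! h3
          exact hc ⟨h1, h2, h3⟩
        have h4 := (Nat.le_div_iff_mul_le hmu).1 h3
        rw [min_eq_left (h3.trans (Nat.le_succ _)), min_eq_left]
        rw [if_neg]
        · have : L - 1 ≤ (r - (m + 2)) / m := by
            rw [Nat.le_div_iff_mul_le hmu, Nat.sub_mul]; omega
          omega
        · have : 1 * 1 ≤ L * m := Nat.mul_le_mul h0 hmu
          omega
      · have h3 : r + 1 - (m + 2) ≠ 0 := fun h3 => h2 (by rw [h3, Nat.zero_mod])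
        rw [if_neg (by omega)]
        congr 2
        have h4 : r + 1 - (m + 2) = (r - (m + 2)) + 1 := by omega
        rw [h4] at h2 ⊢
        rw [Nat.succ_div, if_neg (fun h5 => h2 (Nat.mod_eq_zero_of_dvd h5))]; rfl
    rw [if_neg hc, heq]
    exact ⟨le_rfl, by simp, fun k h1 h2 => absurd h1 (by omega)⟩

end Network

/-! ### Phase II at a node -/

theorem countP_lt_range (b : ℕ) : ∀ m, (List.range m).countP (fun k => decide (k < b)) = min m b
  | 0 => by simp
  | m + 1 => by
    rw [List.range_succ, List.countP_append, countP_lt_range b m]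
    by_cases h : m < b
    · simp [h]; omega
    · simp [h]; omega

section Network

variable {V : Type*} [Fintype V] {G : SimpleGraph V} {q : ℕ}
  (X : MetropolisChain G q) (T : ℝ) (y₀ : V → Fin q) (ω : V × ℕ → Coins q) (D : Scheduler V)

/-- The value of `u` after its first `i` updates. -/
def valueAt (u : V) (i : ℕ) : Fin q :=
  (timetable X T y₀ ω).value y₀ ((timetable X T y₀ ω).run G D y₀) u i

/-- The decision on the `i`-th update of `u`. -/
def decisionAt (u : V) (i : ℕ) : Bool := ((timetable X T y₀ ω).run G D y₀ u i).1

/-- The `i`-th update of `v` is decided by the first `j u` decisions of the neighbours `u`. -/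
def SettledAt (v : V) (i : ℕ) (j : V → ℕ) : Prop :=
  (timetable X T y₀ ω).Settled G y₀ ((timetable X T y₀ ω).run G D y₀) v i j

/-- What `v` knows about `u` when it has processed the first `j` decisions. -/
def viewTwo (u v : V) (j : ℕ) : NbrView q :=
  { viewAt X T y₀ ω u ((timetable X T y₀ ω).phaseOneCount u v) with
    history := (List.range (j + 1)).map (valueAt X T y₀ ω D u) }

variable {X T y₀ ω D}

theorem viewTwo_updates (u v : V) (j : ℕ) :
    (viewTwo X T y₀ ω D u v j).updates =
      (List.range ((timetable X T y₀ ω).count u)).map fun i =>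
        ((node X T y₀ ω u).truncTime ((timetable X T y₀ ω).depth u v) i, (ω (u, i)).2.1) := by
  have h0 := le_phaseOneCount (X := X) (T := T) (y₀ := y₀) (ω := ω) u v
  have h1 : min ((timetable X T y₀ ω).phaseOneCount u v - 1) ((timetable X T y₀ ω).count u) =
    (timetable X T y₀ ω).count u := by omega
  simp only [viewTwo, viewAt, h1]
  refine List.map_congr_left fun i hi => ?_
  have hi := List.mem_range.1 hi
  rw [Timetable.phaseOneCount, Nat.add_sub_cancel_left, Nat.mul_div_cancel _ (by omega)]

theorem viewTwo_level {u v : V} (j : ℕ) :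
    (viewTwo X T y₀ ω D u v j).level = (timetable X T y₀ ω).depth u v := by
  simp only [viewTwo, viewAt]
  rw [Timetable.phaseOneCount, Nat.add_sub_cancel_left]
  rcases Nat.eq_zero_or_pos ((timetable X T y₀ ω).depth u v) with h0 | h0
  · simp [h0]
  · exact Nat.mul_div_cancel _ (count_pos_of_lt_depth h0)

theorem viewTwo_zero (u v : V) : viewTwo X T y₀ ω D u v 0 =
    viewAt X T y₀ ω u ((timetable X T y₀ ω).phaseOneCount u v) := by
  have h0 := le_phaseOneCount (X := X) (T := T) (y₀ := y₀) (ω := ω) u v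
  have : (timetable X T y₀ ω).phaseOneCount u v ≠ 0 := by omega
  simp [viewTwo, viewAt, this, valueAt, Timetable.value]

theorem learn_viewTwo {u v : V} {j : ℕ}
    (hj : j < (timetable X T y₀ ω).count u) :
    (viewTwo X T y₀ ω D u v j).learn (decisionAt X T y₀ ω D u j) =
      viewTwo X T y₀ ω D u v (j + 1) := by
  have hprop : (timetable X T y₀ ω).proposal u j = (ω (u, j)).2.1 := if_pos hj
  have hval : valueAt X T y₀ ω D u (j + 1) = if decisionAt X T y₀ ω D u j then (ω (u, j)).2.1
      else valueAt X T y₀ ω D u j := by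
    rw [← hprop]; rfl
  rw [NbrView.learn]
  simp only [viewTwo_updates]
  simp only [viewTwo, List.length_map, List.length_range, Nat.add_sub_cancel]
  congr 1
  swap
  · exact (viewTwo_updates (D := D) u v j).symm
  rw [List.range_succ (n := j + 1), List.map_append, List.map_singleton, hval]
  congr 1
  split_ifs with hd
  · simp [hj]
  · rw [List.range_succ]; simp

/-- At the final precision, comparing truncated times is comparing true times, so the set formed by
the node from its view is the one of the recursion. -/
theorem possible_viewTwo (h : RegularClocks X T y₀ ω) {u v : V} (hne : u ≠ v) {i j : ℕ}
    (hi : i < (timetable X T y₀ ω).count v) (hj : j ≤ (timetable X T y₀ ω).count u) :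
    (node X T y₀ ω v).possible (viewTwo X T y₀ ω D u v j) i =
      (timetable X T y₀ ω).possible y₀ ((timetable X T y₀ ω).run G D y₀) u
        ((timetable X T y₀ ω).before u v i) j := by
  have hb := h.isRanked.before_count u v i hi
  have hlen : (viewTwo X T y₀ ω D u v j).history.length = j + 1 := by simp [viewTwo]
  simp only [NodeInput.possible, viewTwo_level, viewTwo_updates, hlen, Nat.add_sub_cancel]
  have hle : ∀ k < (timetable X T y₀ ω).count u,
      ((node X T y₀ ω u).truncTime ((timetable X T y₀ ω).depth u v) k ≤
        (node X T y₀ ω v).truncTime ((timetable X T y₀ ω).depth u v) i ↔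
      k < (timetable X T y₀ ω).before u v i) := fun k hk => h.truncTime_le_iff hne hi hk
  -- If all decisions of `u` are known there is no entry at index `j`, and the condition holds
  -- vacuously; this matches `before ≤ count`.
  have hcond : (∀ r, ((List.range ((timetable X T y₀ ω).count u)).map fun i =>
        ((node X T y₀ ω u).truncTime ((timetable X T y₀ ω).depth u v) i, (ω (u, i)).2.1))[j]? =
        some r → (node X T y₀ ω v).truncTime ((timetable X T y₀ ω).depth u v) i < r.1) ↔
      (timetable X T y₀ ω).before u v i ≤ j := by
    rcases hj.eq_or_lt with rfl | hj
    · simpa using hb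
    · rw [← not_lt, ← hle j hj]
      simp [hj]
  simp only [hcond]
  split_ifs with hc
  · rw [List.countP_map]
    have : (List.range ((timetable X T y₀ ω).count u)).countP
        ((fun r : ℕ × Fin q => decide
          (r.1 ≤ (node X T y₀ ω v).truncTime ((timetable X T y₀ ω).depth u v) i)) ∘
        fun i => ((node X T y₀ ω u).truncTime ((timetable X T y₀ ω).depth u v) i, (ω (u, i)).2.1)) =
        (timetable X T y₀ ω).before u v i := by
      rw [← min_eq_right hb, ← countP_lt_range]
      refine List.countP_congr fun k hk => ?_
      simp [hle k (List.mem_range.1 hk)]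
    rw [this]
    ext y
    have hlt : (timetable X T y₀ ω).before u v i < j + 1 := by omega
    rw [Timetable.possible_of_le hc]
    simp [viewTwo, hlt, valueAt, eq_comm]
  · ext y
    simp only [Timetable.possible, Set.mem_union, Set.mem_ofPred_eq]
    refine or_congr ?_ (exists_congr fun k => ?_)
    · rw [min_eq_left (by omega)]
      simp [viewTwo, valueAt, List.range_succ, eq_comm]
    · constructor
      · rintro ⟨h1, r, h2, h3, h4⟩
        obtain ⟨hk', rfl⟩ := List.getElem?_eq_some_iff.1 h2
        simp only [List.length_map, List.length_range] at hk'
        simp only [List.getElem_map, List.getElem_range] at h3 h4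
        exact ⟨by omega, (hle k ‹_›).1 h3, by rw [← h4]; exact if_pos ‹_›⟩
      · rintro ⟨h1, h2, h3⟩
        have hk : k < (timetable X T y₀ ω).count u := by omega
        exact ⟨by omega, ((node X T y₀ ω u).truncTime ((timetable X T y₀ ω).depth u v) k,
          (ω (u, k)).2.1), by simp [hk], (hle k hk).2 h2, by rw [← h3]; exact (if_pos hk).symm⟩

variable (X T y₀ ω D)

/-- The node `v` is in Phase II and has processed the first `j u` decisions of its neighbours. -/
structure InPhaseTwo (v : V) (j : V → ℕ) (s : NodeState V q) : Prop where
  phaseTwo : s.phaseTwo = true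
  view : ∀ u, G.Adj v u → s.view u = viewTwo X T y₀ ω D u v (j u)
  le_count : ∀ u, G.Adj v u → j u ≤ (timetable X T y₀ ω).count u
  resolved_le : s.resolved ≤ (timetable X T y₀ ω).count v
  value : s.value = valueAt X T y₀ ω D v s.resolved
  settled : ∀ i < s.resolved, SettledAt X T y₀ ω D v i j

/-- The node `v` cannot resolve another update. -/
def Stuck (v : V) (j : V → ℕ) (s : NodeState V q) : Prop :=
  s.resolved = (timetable X T y₀ ω).count v ∨ ¬ SettledAt X T y₀ ω D v s.resolved j

/-- From the state `s`, the node has resolved as many updates as possible. -/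
structure Advances (v : V) (j : V → ℕ) (s : NodeState V q) (r : NodeState V q × List Bool) :
    Prop where
  inPhaseTwo : InPhaseTwo X T y₀ ω D v j r.1
  queue : r.1.queue = s.queue
  le : s.resolved ≤ r.1.resolved
  decisions : r.2 = (List.Ico s.resolved r.1.resolved).map (decisionAt X T y₀ ω D v)
  stuck : Stuck X T y₀ ω D v j r.1

variable {X T y₀ ω D}

theorem mem_candidates_iff (h : RegularClocks X T y₀ ω) {v : V} {j : V → ℕ} {s : NodeState V q}
    (hs : InPhaseTwo X T y₀ ω D v j s) (hlt : s.resolved < (timetable X T y₀ ω).count v)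
    (τ : V → Fin q) :
    (fun u : G.neighborSet v => τ u) ∈ (node X T y₀ ω v).candidates s s.resolved ↔
      τ ∈ (timetable X T y₀ ω).candidates G y₀ ((timetable X T y₀ ω).run G D y₀) v
        s.resolved j := by
  simp only [NodeInput.candidates, Timetable.candidates, Set.mem_ofPred_eq]
  constructor
  · intro h1 u hu
    have := h1 ⟨u, hu⟩
    rwa [hs.view u hu, possible_viewTwo h hu.ne' hlt (hs.le_count u hu)] at this
  · rintro h1 ⟨u, hu⟩
    rw [hs.view u hu, possible_viewTwo h (G.ne_of_adj hu).symm hlt (hs.le_count u hu)]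
    exact h1 u hu

/-- The recursion uses configurations of all nodes, the node only those of its neighbourhood. As the
filters see only the neighbours, quantifying over either kind is equivalent. -/
theorem forall_candidates_iff (h : RegularClocks X T y₀ ω) {v : V} {j : V → ℕ}
    {s : NodeState V q} (hs : InPhaseTwo X T y₀ ω D v j s)
    (hlt : s.resolved < (timetable X T y₀ ω).count v) (P : Bool → Prop) :
    (∀ τ ∈ (timetable X T y₀ ω).candidates G y₀ ((timetable X T y₀ ω).run G D y₀) v
        s.resolved j, P ((timetable X T y₀ ω).accepts v s.resolved
          (valueAt X T y₀ ω D v s.resolved) τ)) ↔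
    ∀ τ : (node X T y₀ ω v).candidates s s.resolved,
      P (decide (((node X T y₀ ω v).coins s.resolved).2.2 < (node X T y₀ ω v).bias s τ)) := by
  have hacc : ∀ τ : V → Fin q, (timetable X T y₀ ω).accepts v s.resolved
      (valueAt X T y₀ ω D v s.resolved) τ = decide (((node X T y₀ ω v).coins s.resolved).2.2 <
        (node X T y₀ ω v).bias s fun u : G.neighborSet v => τ u) := by
    intro τ
    simp only [timetable, NodeInput.bias, hs.value,
      show s.resolved < (node X T y₀ ω v).numUpdates from hlt, if_true]
    rfl
  constructor
  · rintro h1 ⟨τ, hτ⟩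
    -- An arbitrary extension to the nodes that are not neighbours.
    let τ' : V → Fin q := fun u => if hu : u ∈ G.neighborSet v then τ ⟨u, hu⟩ else y₀ u
    have hτ' : (fun u : G.neighborSet v => τ' u) = τ := by
      ext1 u; exact dif_pos u.2
    have := h1 τ' ((mem_candidates_iff h hs hlt τ').1 (by rw [hτ']; exact hτ))
    rwa [hacc, hτ'] at this
  · intro h1 τ hτ
    rw [hacc]
    exact h1 ⟨_, (mem_candidates_iff h hs hlt τ).2 hτ⟩

theorem nonempty_candidates (h : RegularClocks X T y₀ ω) {v : V} {j : V → ℕ} {s : NodeState V q}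
    (hs : InPhaseTwo X T y₀ ω D v j s) (hlt : s.resolved < (timetable X T y₀ ω).count v) :
    Nonempty ((node X T y₀ ω v).candidates s s.resolved) :=
  ⟨⟨_, (mem_candidates_iff h hs hlt _).2 Timetable.truth_mem_candidates⟩⟩

/-- The infimum is over a finite nonempty set, so the coin is below it exactly if it is below every
acceptance probability; that is, all candidates, and hence also the truth, say "accept". -/
theorem lt_pAccept_iff (h : RegularClocks X T y₀ ω) {v : V} {j : V → ℕ} {s : NodeState V q}
    (hs : InPhaseTwo X T y₀ ω D v j s) (hlt : s.resolved < (timetable X T y₀ ω).count v) :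
    ((node X T y₀ ω v).coins s.resolved).2.2 < (node X T y₀ ω v).pAccept s ↔
      SettledAt X T y₀ ω D v s.resolved j ∧ decisionAt X T y₀ ω D v s.resolved = true := by
  have := nonempty_candidates h hs hlt
  have : Finite (node X T y₀ ω v).nbrs := Subtype.finite
  have h1 := forall_candidates_iff h hs hlt (fun b => b = true)
  have h2 : ((node X T y₀ ω v).coins s.resolved).2.2 < (node X T y₀ ω v).pAccept s ↔
      ∀ τ : (node X T y₀ ω v).candidates s s.resolved,
        ((node X T y₀ ω v).coins s.resolved).2.2 < (node X T y₀ ω v).bias s τ := by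
    constructor
    · exact fun h1 τ => h1.trans_le (ciInf_le (Set.finite_range _).bddBelow τ)
    · intro h1
      obtain ⟨τ, hτ⟩ := exists_eq_ciInf_of_finite
        (f := fun τ : (node X T y₀ ω v).candidates s s.resolved => (node X T y₀ ω v).bias s τ)
      rw [NodeInput.pAccept, ← hτ]; exact h1 τ
  simp only [decide_eq_true_iff] at h1
  rw [h2, ← h1]
  constructor
  · intro h3
    have hset : SettledAt X T y₀ ω D v s.resolved j := fun τ hτ τ' hτ' => by
      rw [show (timetable X T y₀ ω).value y₀ ((timetable X T y₀ ω).run G D y₀) v s.resolved =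
        valueAt X T y₀ ω D v s.resolved from rfl, h3 τ hτ, h3 τ' hτ']
    refine ⟨hset, ?_⟩
    rw [decisionAt, ← Timetable.run_fst_eq h.isRanked hlt hset Timetable.truth_mem_candidates]
    exact h3 _ Timetable.truth_mem_candidates
  · rintro ⟨h3, h4⟩ τ hτ
    exact (Timetable.run_fst_eq h.isRanked hlt h3 hτ).trans h4

theorem pReject_le_iff (h : RegularClocks X T y₀ ω) {v : V} {j : V → ℕ} {s : NodeState V q}
    (hs : InPhaseTwo X T y₀ ω D v j s) (hlt : s.resolved < (timetable X T y₀ ω).count v) :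
    1 - (node X T y₀ ω v).pReject s ≤ ((node X T y₀ ω v).coins s.resolved).2.2 ↔
      SettledAt X T y₀ ω D v s.resolved j ∧ decisionAt X T y₀ ω D v s.resolved = false := by
  have := nonempty_candidates h hs hlt
  have : Finite (node X T y₀ ω v).nbrs := Subtype.finite
  have h1 := forall_candidates_iff h hs hlt (fun b => b = false)
  have h2 : 1 - (node X T y₀ ω v).pReject s ≤ ((node X T y₀ ω v).coins s.resolved).2.2 ↔
      ∀ τ : (node X T y₀ ω v).candidates s s.resolved,
        ¬ ((node X T y₀ ω v).coins s.resolved).2.2 < (node X T y₀ ω v).bias s τ := by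
    simp only [not_lt]
    constructor
    · intro h1 τ
      have : (node X T y₀ ω v).pReject s ≤ 1 - (node X T y₀ ω v).bias s τ :=
        ciInf_le (f := fun τ : (node X T y₀ ω v).candidates s s.resolved =>
          1 - (node X T y₀ ω v).bias s τ) (Set.finite_range _).bddBelow τ
      linarith
    · intro h1
      obtain ⟨τ, hτ⟩ := exists_eq_ciInf_of_finite
        (f := fun τ : (node X T y₀ ω v).candidates s s.resolved => 1 - (node X T y₀ ω v).bias s τ)
      rw [NodeInput.pReject, ← hτ]
      linarith [h1 τ]
  simp only [decide_eq_false_iff_not] at h1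
  rw [h2, ← h1]
  constructor
  · intro h3
    have hset : SettledAt X T y₀ ω D v s.resolved j := fun τ hτ τ' hτ' => by
      rw [show (timetable X T y₀ ω).value y₀ ((timetable X T y₀ ω).run G D y₀) v s.resolved =
        valueAt X T y₀ ω D v s.resolved from rfl, h3 τ hτ, h3 τ' hτ']
    refine ⟨hset, ?_⟩
    rw [decisionAt, ← Timetable.run_fst_eq h.isRanked hlt hset Timetable.truth_mem_candidates]
    exact h3 _ Timetable.truth_mem_candidates
  · rintro ⟨h3, h4⟩ τ hτ
    exact (Timetable.run_fst_eq h.isRanked hlt h3 hτ).trans h4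

theorem valueAt_succ (v : V) {i : ℕ} (hi : i < (timetable X T y₀ ω).count v) :
    valueAt X T y₀ ω D v (i + 1) =
      if decisionAt X T y₀ ω D v i then (ω (v, i)).2.1 else valueAt X T y₀ ω D v i := by
  rw [← show (timetable X T y₀ ω).proposal v i = (ω (v, i)).2.1 from if_pos hi]; rfl

/-- Together the acceptance and the rejection test succeed exactly when the update is settled, so
the loop stops either at the end of the updates or at the first unsettled one. -/
theorem advances_resolveLoop (h : RegularClocks X T y₀ ω) {v : V} {j : V → ℕ} : ∀ (fuel : ℕ)
    (s : NodeState V q), InPhaseTwo X T y₀ ω D v j s →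
    fuel + s.resolved = (timetable X T y₀ ω).count v →
    Advances X T y₀ ω D v j s ((node X T y₀ ω v).resolveLoop fuel s)
  | 0, s, hs, hf => ⟨hs, rfl, le_rfl, by simp [NodeInput.resolveLoop],
      Or.inl ((Nat.zero_add _).symm.trans hf)⟩
  | fuel + 1, s, hs, hf => by
    have hlt : s.resolved < (timetable X T y₀ ω).count v := by omega
    have key : ∀ s' : NodeState V q, s' = { s with
          resolved := s.resolved + 1, value := valueAt X T y₀ ω D v (s.resolved + 1) } →
        SettledAt X T y₀ ω D v s.resolved j →
        Advances X T y₀ ω D v j s (((node X T y₀ ω v).resolveLoop fuel s').1,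
          decisionAt X T y₀ ω D v s.resolved :: ((node X T y₀ ω v).resolveLoop fuel s').2) := by
      rintro s' rfl hset
      obtain ⟨h1, h2, h3, h4, h5⟩ := advances_resolveLoop h fuel { s with
        resolved := s.resolved + 1, value := valueAt X T y₀ ω D v (s.resolved + 1) }
        ⟨hs.phaseTwo, hs.view, hs.le_count, hlt, rfl, fun i hi => by
          rcases Nat.lt_succ_iff_lt_or_eq.1 hi with hi | rfl
          exacts [hs.settled i hi, hset]⟩ (by dsimp only; omega)
      refine ⟨h1, h2, (Nat.le_succ _).trans h3, ?_, h5⟩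
      rw [List.Ico.eq_cons h3, h4]
      rfl
    have hacc := lt_pAccept_iff h hs hlt
    have hrej := pReject_le_iff h hs hlt
    rw [NodeInput.resolveLoop]
    dsimp only
    split_ifs with h1 h2
    · obtain ⟨h3, h4⟩ := hacc.1 h1
      have := key { s with resolved := s.resolved + 1, value := (ω (v, s.resolved)).2.1 }
        (by rw [valueAt_succ v hlt, h4]; rfl) h3
      rwa [h4] at this
    · obtain ⟨h3, h4⟩ := hrej.1 h2
      have := key { s with resolved := s.resolved + 1 }
        (by rw [valueAt_succ v hlt, h4, hs.value]; rfl) h3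
      rwa [h4] at this
    · refine ⟨hs, rfl, le_rfl, by simp, Or.inr fun hc => ?_⟩
      cases hd : decisionAt X T y₀ ω D v s.resolved
      · exact h2 (hrej.2 ⟨hc, hd⟩)
      · exact h1 (hacc.2 ⟨hc, hd⟩)

theorem advances_resolve (h : RegularClocks X T y₀ ω) {v : V} {j : V → ℕ}
    {s : NodeState V q} (hs : InPhaseTwo X T y₀ ω D v j s) :
    Advances X T y₀ ω D v j s ((node X T y₀ ω v).resolve s) :=
  advances_resolveLoop h _ s hs (Nat.sub_add_cancel hs.resolved_le)

theorem Advances.trans {v : V} {j j' : V → ℕ} {s : NodeState V q}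
    {r r' : NodeState V q × List Bool} (h : Advances X T y₀ ω D v j s r)
    (h' : Advances X T y₀ ω D v j' r.1 r') :
    Advances X T y₀ ω D v j' s (r'.1, r.2 ++ r'.2) :=
  ⟨h'.inPhaseTwo, h'.queue.trans h.queue, h.le.trans h'.le, by
    dsimp only
    rw [h.decisions, h'.decisions, ← List.map_append, List.Ico.append_consecutive h.le h'.le],
    h'.stuck⟩

theorem advances_process (h : RegularClocks X T y₀ ω) {v : V} {j : V → ℕ}
    {s : NodeState V q} (hs : InPhaseTwo X T y₀ ω D v j s) {u : V} (hu : G.Adj v u)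
    (hj : j u < (timetable X T y₀ ω).count u) :
    Advances X T y₀ ω D v (Function.update j u (j u + 1)) s
      ((node X T y₀ ω v).process s u (decisionAt X T y₀ ω D u (j u))) := by
  have hle : ∀ w, j w ≤ Function.update j u (j u + 1) w := fun w => by
    rcases eq_or_ne w u with rfl | hw
    · simp
    · simp [hw]
  have key : InPhaseTwo X T y₀ ω D v (Function.update j u (j u + 1))
      (s.setView u ((s.view u).learn (decisionAt X T y₀ ω D u (j u)))) := by
    refine ⟨hs.phaseTwo, fun w hw => ?_, fun w hw => ?_, hs.resolved_le, hs.value, fun i hi =>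
      (hs.settled i hi).mono fun w _ => (min_le_left _ _).trans (hle w)⟩
    · simp only [NodeState.setView]
      rcases eq_or_ne w u with rfl | hne
      · simp only [Function.update_self]
        rw [hs.view w hw, learn_viewTwo hj]
      · simp only [Function.update_of_ne hne]
        exact hs.view w hw
    · rcases eq_or_ne w u with rfl | hne
      · simpa using hj
      · simpa [hne] using hs.le_count w hw
  obtain ⟨h1, h2, h3, h4, h5⟩ := advances_resolve h key
  exact ⟨h1, h2, h3, h4, h5⟩

/-- Only the order of the decisions within each channel matters. The list may interleave different
neighbours arbitrarily, so nothing is assumed about it beyond its restriction to each sender. -/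
theorem advances_processAll (h : RegularClocks X T y₀ ω) {v : V} {j' : V → ℕ}
    (hj' : ∀ u, G.Adj v u → j' u ≤ (timetable X T y₀ ω).count u) : ∀ (l : List (V × Bool))
    (j : V → ℕ) (s : NodeState V q), InPhaseTwo X T y₀ ω D v j s → Stuck X T y₀ ω D v j s →
    (∀ p ∈ l, G.Adj v p.1) →
    (∀ u, G.Adj v u → j u ≤ j' u ∧ (l.filter fun p => p.1 = u).map Prod.snd =
      (List.Ico (j u) (j' u)).map (decisionAt X T y₀ ω D u)) →
    Advances X T y₀ ω D v j' s ((node X T y₀ ω v).processAll l s)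
  | [], j, s, hs, hst, _, hl => by
    have hj : ∀ u, G.Adj v u → j u = j' u := fun u hu => by
      obtain ⟨h1, h2⟩ := hl u hu
      have := congrArg List.length h2
      simp at this
      omega
    refine ⟨⟨hs.phaseTwo, fun u hu => by rw [← hj u hu]; exact hs.view u hu,
      fun u hu => by rw [← hj u hu]; exact hs.le_count u hu, hs.resolved_le, hs.value,
      fun i hi => (hs.settled i hi).mono fun u hu => (min_le_left _ _).trans (hj u hu).le⟩,
      rfl, le_rfl, by simp [NodeInput.processAll], hst.imp_right fun hn hc => hn ?_⟩
    exact hc.mono fun u hu => (min_le_left _ _).trans (hj u hu).ge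
  | (u, b) :: l, j, s, hs, hst, hadj, hl => by
    have hu : G.Adj v u := hadj (u, b) (by simp)
    obtain ⟨h1, h2⟩ := hl u hu
    have hlt : j u < j' u := by
      by_contra! hc
      rw [le_antisymm h1 hc] at h2
      simp at h2
    rw [List.Ico.eq_cons hlt] at h2
    simp only [decide_true, List.filter_cons_of_pos, List.map_cons, List.cons.injEq] at h2
    obtain ⟨rfl, h2⟩ := h2
    have hp := advances_process h hs hu (hlt.trans_le (hj' u hu))
    refine hp.trans (advances_processAll h hj' l _ _ hp.inPhaseTwo hp.stuck
      (fun p hp => hadj p (by simp [hp])) fun w hw => ?_)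
    rcases eq_or_ne w u with rfl | hne
    · simp only [Function.update_self]
      exact ⟨hlt, h2⟩
    · simp only [Function.update_of_ne hne]
      have := hl w hw
      rwa [List.filter_cons_of_neg (by simpa using hne.symm)] at this

end Network

/-! ### The reaction of a node to a message -/

section Network

variable {V : Type*} [Fintype V] {G : SimpleGraph V} {q : ℕ}
  (X : MetropolisChain G q) (T : ℝ) (y₀ : V → Fin q) (ω : V × ℕ → Coins q) (D : Scheduler V)

/-- The node `v` is in Phase I and has received the first `r u` messages of its neighbours. -/
structure InPhaseOne (v : V) (r : V → ℕ) (s : NodeState V q) : Prop where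
  phaseTwo : s.phaseTwo = false
  view : ∀ u, G.Adj v u →
    s.view u = viewAt X T y₀ ω u (min (r u) ((timetable X T y₀ ω).phaseOneCount u v))
  queue : ∀ u, G.Adj v u → (s.queue.filter fun p => p.1 = u).map Prod.snd =
    (List.Ico 0 (r u - (timetable X T y₀ ω).phaseOneCount u v)).map (decisionAt X T y₀ ω D u)
  queue_adj : ∀ p ∈ s.queue, G.Adj v p.1
  resolved : s.resolved = 0
  value : s.value = y₀ v

/-- The number of messages from `u` to `v`. -/
def messageCount (u v : V) : ℕ :=
  (timetable X T y₀ ω).phaseOneCount u v + (timetable X T y₀ ω).count u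

/-- `s` is the state of the node `v` when it has received the first `r u` messages of its
neighbours. -/
def Consistent (v : V) (r : V → ℕ) (s : NodeState V q) : Prop :=
  (InPhaseOne X T y₀ ω D v r s ∧
      ∃ u, G.Adj v u ∧ r u < (timetable X T y₀ ω).phaseOneCount u v) ∨
    (InPhaseTwo X T y₀ ω D v (fun u => r u - (timetable X T y₀ ω).phaseOneCount u v) s ∧
      s.queue = [] ∧ (∀ u, G.Adj v u → (timetable X T y₀ ω).phaseOneCount u v ≤ r u) ∧
      Stuck X T y₀ ω D v (fun u => r u - (timetable X T y₀ ω).phaseOneCount u v) s)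

/-- The number of messages that `v` has sent to `x` when it has received the first `r u` messages of
its neighbours and has resolved `n` updates. -/
def sentCount (v x : V) (r : V → ℕ) (n : ℕ) : ℕ := phaseOneSent X T y₀ ω v x (r x) + n

variable {X T y₀ ω D}

theorem decisions_eq (v x : V) (n n' : ℕ) :
    ((List.Ico n n').map (decisionAt X T y₀ ω D v)).map Msg.decision =
      (List.Ico ((timetable X T y₀ ω).phaseOneCount v x + n)
        ((timetable X T y₀ ω).phaseOneCount v x + n')).map (message X T y₀ ω D v x) := by
  have h0 := le_phaseOneCount (X := X) (T := T) (y₀ := y₀) (ω := ω) v x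
  rw [add_comm _ n, add_comm _ n', ← List.Ico.map_add, List.map_map, List.map_map]
  refine List.map_congr_left fun i _ => ?_
  simp only [Function.comp, message]
  rw [if_neg (by omega), if_neg (by omega), if_neg (by omega), if_neg (by omega)]
  congr 3
  omega

/-- On entering, the node resolves what is settled without any decision and then processes the
queue. The decisions emitted by both phases form one consecutive list starting at its first update.
-/
theorem consistent_tryEnter (h : RegularClocks X T y₀ ω) {v : V} {r : V → ℕ} {s : NodeState V q}
    (hr : ∀ u, G.Adj v u → r u ≤ messageCount X T y₀ ω u v)
    (hs : InPhaseOne X T y₀ ω D v r s) :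
    Consistent X T y₀ ω D v r ((node X T y₀ ω v).tryEnter s).1 ∧
    ((node X T y₀ ω v).tryEnter s).2 =
      (List.Ico 0 ((node X T y₀ ω v).tryEnter s).1.resolved).map (decisionAt X T y₀ ω D v) := by
  have hready : (s.phaseTwo = false ∧ ∀ u ∈ (node X T y₀ ω v).nbrs,
      (node X T y₀ ω v).Ready (s.view u)) ↔
      ∀ u, G.Adj v u → (timetable X T y₀ ω).phaseOneCount u v ≤ r u := by
    simp only [hs.phaseTwo, true_and]
    refine forall_congr' fun u => forall_congr' fun hu => ?_
    rw [hs.view u hu, ready_viewAt_iff h (G.ne_of_adj hu).symm (min_le_right _ _), min_eq_right_iff]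
  rw [NodeInput.tryEnter]
  by_cases hc : ∀ u, G.Adj v u → (timetable X T y₀ ω).phaseOneCount u v ≤ r u
  · rw [if_pos (hready.2 hc)]
    have h2 : InPhaseTwo X T y₀ ω D v (fun _ => 0) { s with phaseTwo := true } := by
      refine ⟨rfl, fun u hu => ?_, fun _ _ => Nat.zero_le _, ?_, ?_, ?_⟩
      · rw [viewTwo_zero]
        exact (hs.view u hu).trans (by rw [min_eq_right (hc u hu)])
      · simp [hs.resolved]
      · simp [hs.resolved, hs.value, valueAt, Timetable.value]
      · simp [hs.resolved]
    have h3 := advances_resolve h h2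
    have h4 := advances_processAll (D := D) h (v := v)
      (j' := fun u => r u - (timetable X T y₀ ω).phaseOneCount u v)
      (fun u hu => by have := hr u hu; rw [messageCount] at this; omega) s.queue
      (fun _ => 0)
      { ((node X T y₀ ω v).resolve { s with phaseTwo := true }).1 with queue := [] }
      ⟨h3.inPhaseTwo.1, h3.inPhaseTwo.2, h3.inPhaseTwo.3, h3.inPhaseTwo.4, h3.inPhaseTwo.5,
        h3.inPhaseTwo.6⟩ h3.stuck hs.queue_adj fun u hu => ⟨Nat.zero_le _, hs.queue u hu⟩
    have hq : ((node X T y₀ ω v).resolve { s with phaseTwo := true }).1.queue = s.queue := h3.queue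
    dsimp only
    rw [hq]
    refine ⟨Or.inr ⟨h4.inPhaseTwo, h4.queue, hc, h4.stuck⟩, ?_⟩
    rw [h4.decisions, h3.decisions, ← List.map_append,
      List.Ico.append_consecutive h3.le h4.le]
    simp [hs.resolved]
  · rw [if_neg (fun hn => hc (hready.1 hn))]
    push Not at hc
    exact ⟨Or.inl ⟨hs, hc⟩, by simp [hs.resolved]⟩

/-- An isolated node enters Phase II at once and may resolve updates. A node with a neighbour still
lacks the messages of that neighbour, so on actual channels only the announcement is sent. -/
theorem consistent_start (h : RegularClocks X T y₀ ω) (v : V) :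
    Consistent X T y₀ ω D v (fun _ => 0) (mainAlgorithm X T y₀ ω v).start.1 ∧
    ∀ x, G.Adj v x → (mainAlgorithm X T y₀ ω v).start.2 x =
      (List.Ico 0 (sentCount X T y₀ ω v x (fun _ => 0)
        (mainAlgorithm X T y₀ ω v).start.1.resolved)).map (message X T y₀ ω D v x) ∧
      (mainAlgorithm X T y₀ ω v).start.1.resolved = 0 := by
  have h1 := consistent_tryEnter (D := D) h (v := v) (r := fun _ => 0)
    (s := (node X T y₀ ω v).initialState) (fun _ _ => Nat.zero_le _)
    ⟨rfl, fun u _ => by rw [Nat.zero_min, viewAt_zero]; rfl, by simp [NodeInput.initialState],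
      by simp [NodeInput.initialState], rfl, rfl⟩
  refine ⟨h1.1, fun x hx => ?_⟩
  have h0 : ((node X T y₀ ω v).tryEnter (node X T y₀ ω v).initialState).1.resolved = 0 := by
    rcases h1.1 with ⟨h2, -⟩ | ⟨-, -, h2, -⟩
    · exact h2.resolved
    · have := h2 x hx
      have := le_phaseOneCount (X := X) (T := T) (y₀ := y₀) (ω := ω) x v
      dsimp only at *
      omega
  have h2 := h1.2
  refine ⟨?_, h0⟩
  change (node X T y₀ ω v).announcement ++ ((node X T y₀ ω v).tryEnter
    (node X T y₀ ω v).initialState).2.map Msg.decision = (List.Ico 0 (_ + ((node X T y₀ ω v).tryEnter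
    (node X T y₀ ω v).initialState).1.resolved)).map _
  rw [h0] at h2 ⊢
  rw [h2, announcement_eq (D := D) v x, phaseOneSent_zero]
  simp

/-- A node state depends on the execution only through the numbers of received messages. Every newly
sent message is either a refinement provoked by the present one or a decision on an update resolved
now; the final alternative keeps this apart for the computation of the moments of sending. -/
theorem consistent_receive (h : RegularClocks X T y₀ ω) {u v : V} {r : V → ℕ} {s : NodeState V q}
    (hr : ∀ u, G.Adj v u → r u ≤ messageCount X T y₀ ω u v)
    (hs : Consistent X T y₀ ω D v r s) (hu : G.Adj v u) (hru : r u < messageCount X T y₀ ω u v) :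
    let r' := Function.update r u (r u + 1)
    let t := (node X T y₀ ω v).onReceive s u (message X T y₀ ω D u v (r u))
    Consistent X T y₀ ω D v r' t.1 ∧ s.resolved ≤ t.1.resolved ∧
    ∀ x, G.Adj v x →
      sentCount X T y₀ ω v x r s.resolved ≤ sentCount X T y₀ ω v x r' t.1.resolved ∧
      t.2 x = (List.Ico (sentCount X T y₀ ω v x r s.resolved)
        (sentCount X T y₀ ω v x r' t.1.resolved)).map (message X T y₀ ω D v x) ∧
      ∀ k, sentCount X T y₀ ω v x r s.resolved ≤ k →
        k < sentCount X T y₀ ω v x r' t.1.resolved →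
        (x = u ∧ (timetable X T y₀ ω).count v + 2 ≤ k ∧
          k < (timetable X T y₀ ω).phaseOneCount v u ∧
          r u + 1 = (timetable X T y₀ ω).count u + 2 +
            ((k - ((timetable X T y₀ ω).count v + 2)) / (timetable X T y₀ ω).count v) *
              (timetable X T y₀ ω).count u) ∨
        ∃ i, s.resolved ≤ i ∧ i < t.1.resolved ∧
          k = (timetable X T y₀ ω).phaseOneCount v x + i := by
  intro r' t
  have hr' : ∀ w, G.Adj v w → r' w ≤ messageCount X T y₀ ω w v := fun w hw => by
    rcases eq_or_ne w u with rfl | hne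
    · simpa [r'] using hru
    · simpa [r', hne] using hr w hw
  have hne := G.ne_of_adj hu
  rcases lt_or_ge (r u) ((timetable X T y₀ ω).phaseOneCount u v) with hlt | hge
  · -- a message of Phase I
    have hs1 : InPhaseOne X T y₀ ω D v r s := by
      rcases hs with ⟨h1, -⟩ | ⟨-, -, h1, -⟩
      · exact h1
      · exact absurd (h1 u hu) (by omega)
    have ht : t = (node X T y₀ ω v).phaseOneEvent s u (viewAt X T y₀ ω u (r u + 1))
        (replyAt X T y₀ ω v u (r u + 1)) :=
      onReceive_phaseOne h hne.symm hlt (by rw [hs1.view u hu, min_eq_left hlt.le])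
    have hs2 : InPhaseOne X T y₀ ω D v r' (s.setView u (viewAt X T y₀ ω u (r u + 1))) := by
      refine ⟨hs1.phaseTwo, fun w hw => ?_, fun w hw => ?_, hs1.queue_adj, hs1.resolved,
        hs1.value⟩
      · simp only [NodeState.setView]
        rcases eq_or_ne w u with rfl | hwu
        · simp [r', min_eq_left (Nat.succ_le_of_lt hlt)]
        · simp only [Function.update_of_ne hwu, r']
          exact hs1.view w hw
      · have := hs1.queue w hw
        rcases eq_or_ne w u with rfl | hwu
        · simp only [NodeState.setView, r', Function.update_self]
          rw [Nat.sub_eq_zero_of_le hlt.le] at this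
          rwa [Nat.sub_eq_zero_of_le hlt]
        · simpa only [NodeState.setView, r', Function.update_of_ne hwu] using this
    obtain ⟨h1, h2⟩ := consistent_tryEnter h hr' hs2
    have ht1 : t.1 = ((node X T y₀ ω v).tryEnter
      (s.setView u (viewAt X T y₀ ω u (r u + 1)))).1 := by rw [ht]; rfl
    rw [← ht1] at h1 h2
    have hdec : ∀ x, G.Adj v x → ((List.Ico 0 t.1.resolved).map
        (decisionAt X T y₀ ω D v)).map Msg.decision =
        (List.Ico (phaseOneSent X T y₀ ω v x (r' x))
          (sentCount X T y₀ ω v x r' t.1.resolved)).map (message X T y₀ ω D v x) ∧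
        (0 < t.1.resolved →
          phaseOneSent X T y₀ ω v x (r' x) = (timetable X T y₀ ω).phaseOneCount v x) := by
      intro x hx
      rw [sentCount]
      rcases h1 with ⟨h3, -⟩ | ⟨-, -, h3, -⟩
      · simp [h3.resolved]
      · rw [phaseOneSent_of_le (h3 x hx), decisions_eq v x]
        simp
    have ht2 : ∀ x, t.2 x = (if x = u then replyAt X T y₀ ω v u (r u + 1) else []) ++
        ((List.Ico 0 t.1.resolved).map (decisionAt X T y₀ ω D v)).map Msg.decision := by
      intro x
      rw [← h2, ht]; rfl
    refine ⟨h1, by rw [hs1.resolved]; exact Nat.zero_le _, fun x hx => ?_⟩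
    obtain ⟨hd1, hd2⟩ := hdec x hx
    rw [ht2, hd1]
    have hsent : sentCount X T y₀ ω v x r s.resolved = phaseOneSent X T y₀ ω v x (r x) := by
      rw [sentCount, hs1.resolved, add_zero]
    rw [hsent]
    rcases eq_or_ne x u with rfl | hxu
    · obtain ⟨h4, h5, h6⟩ := replyAt_eq (X := X) (T := T) (y₀ := y₀) (ω := ω) (D := D) hlt
      have hr'x : r' x = r x + 1 := by simp [r']
      simp only [hr'x] at hd2 ⊢
      rw [if_pos trivial, h5, ← List.map_append]
      have h7 : phaseOneSent X T y₀ ω v x (r x + 1) ≤ sentCount X T y₀ ω v x r' t.1.resolved := by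
        rw [sentCount, hr'x]; exact Nat.le_add_right _ _
      refine ⟨h4.trans h7, by rw [List.Ico.append_consecutive h4 h7], fun k hk1 hk2 => ?_⟩
      rcases lt_or_ge k (phaseOneSent X T y₀ ω v x (r x + 1)) with hk | hk
      · exact Or.inl ⟨trivial, h6 k hk1 hk⟩
      · rw [sentCount, hr'x] at hk2
        have := hd2 (by omega)
        rw [this] at hk hk2
        exact Or.inr ⟨k - (timetable X T y₀ ω).phaseOneCount v x, by rw [hs1.resolved]; omega,
          by omega, by omega⟩
    · have hr'x : r' x = r x := by simp [r', hxu]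
      simp only [hr'x] at hd2 ⊢
      rw [if_neg hxu, List.nil_append]
      refine ⟨by rw [sentCount, hr'x]; exact Nat.le_add_right _ _, rfl, fun k hk1 hk2 => ?_⟩
      rw [sentCount, hr'x] at hk2
      have := hd2 (by omega)
      rw [this] at hk1 hk2
      exact Or.inr ⟨k - (timetable X T y₀ ω).phaseOneCount v x, by rw [hs1.resolved]; omega,
          by omega, by omega⟩
  · -- a decision
    have hm : message X T y₀ ω D u v (r u) = .decision
        (decisionAt X T y₀ ω D u (r u - (timetable X T y₀ ω).phaseOneCount u v)) := by
      have h0 := le_phaseOneCount (X := X) (T := T) (y₀ := y₀) (ω := ω) u v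
      simp only [message]
      rw [if_neg (by omega), if_neg (by omega), if_neg (by omega), if_neg (by omega)]
      rfl
    have hsent : ∀ x, phaseOneSent X T y₀ ω v x (r' x) = phaseOneSent X T y₀ ω v x (r x) := by
      intro x
      rcases eq_or_ne x u with rfl | hxu
      · rw [phaseOneSent_of_le hge, phaseOneSent_of_le]
        simp only [r', Function.update_self]; omega
      · simp [r', hxu]
    have hru2 : r u - (timetable X T y₀ ω).phaseOneCount u v < (timetable X T y₀ ω).count u := by
      rw [messageCount] at hru; omega
    -- A decision may arrive while `v` still waits for Phase I messages of another neighbour `w`;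
    -- then it is only queued.
    rcases hs with ⟨hs1, w, hw, hlt⟩ | ⟨hs1, hq, hall, hst⟩
    · have ht : t = ({ s with queue := s.queue ++ [(u, decisionAt X T y₀ ω D u
          (r u - (timetable X T y₀ ω).phaseOneCount u v))] }, fun _ => []) := by
        simp only [t, hm, NodeInput.onReceive, hs1.phaseTwo]
        simp
      rw [ht]
      refine ⟨Or.inl ⟨⟨hs1.phaseTwo, fun x hx => ?_, fun x hx => ?_, ?_, hs1.resolved,
        hs1.value⟩, w, hw, ?_⟩, le_rfl, fun x hx => ?_⟩
      · dsimp only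
        rw [hs1.view x hx]
        rcases eq_or_ne x u with rfl | hxu
        · simp only [r', Function.update_self]
          rw [min_eq_right hge, min_eq_right (by omega)]
        · simp [r', hxu]
      · dsimp only
        rw [List.filter_append, List.map_append, hs1.queue x hx]
        rcases eq_or_ne x u with rfl | hxu
        · simp only [r', Function.update_self]
          rw [show r x + 1 - (timetable X T y₀ ω).phaseOneCount x v =
            (r x - (timetable X T y₀ ω).phaseOneCount x v) + 1 by omega,
            List.Ico.succ_top (Nat.zero_le _)]
          simp
        · simp [r', hxu, hxu.symm]
      · intro p hp
        rcases List.mem_append.1 hp with hp | hp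
        · exact hs1.queue_adj p hp
        · rw [List.mem_singleton.1 hp]; exact hu
      · have : w ≠ u := by rintro rfl; omega
        simpa [r', this] using hlt
      · simp only [sentCount, hsent]
        exact ⟨le_rfl, by simp, fun k h1 h2 => absurd h1 (by omega)⟩
    · have hp := advances_process h hs1 hu hru2
      have ht : t = (((node X T y₀ ω v).process s u (decisionAt X T y₀ ω D u
          (r u - (timetable X T y₀ ω).phaseOneCount u v))).1, fun _ =>
          ((node X T y₀ ω v).process s u (decisionAt X T y₀ ω D u
          (r u - (timetable X T y₀ ω).phaseOneCount u v))).2.map Msg.decision) := by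
        simp only [t, hm, NodeInput.onReceive, hs1.phaseTwo]
        simp
      have hj : Function.update (fun u => r u - (timetable X T y₀ ω).phaseOneCount u v) u
          (r u - (timetable X T y₀ ω).phaseOneCount u v + 1) =
          fun u => r' u - (timetable X T y₀ ω).phaseOneCount u v := by
        ext x
        rcases eq_or_ne x u with rfl | hxu
        · simp only [r', Function.update_self]; omega
        · simp [r', hxu]
      rw [hj] at hp
      rw [ht]
      refine ⟨Or.inr ⟨hp.inPhaseTwo, hp.queue.trans hq, fun x hx => (hall x hx).trans ?_,
        hp.stuck⟩, hp.le, fun x hx => ?_⟩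
      · rcases eq_or_ne x u with rfl | hxu
        · simp [r']
        · simp [r', hxu]
      · simp only [sentCount, hsent]
        rw [phaseOneSent_of_le (hall x hx), hp.decisions, decisions_eq v x]
        have := hp.le
        exact ⟨by omega, rfl, fun k h1 h2 => Or.inr
          ⟨k - (timetable X T y₀ ω).phaseOneCount v x, by omega, by omega, by omega⟩⟩

end Network

/-! ### Executions -/

section Network

variable {V : Type*} [Fintype V] {G : SimpleGraph V} {q : ℕ}
  (X : MetropolisChain G q) (T : ℝ) (y₀ : V → Fin q) (ω : V × ℕ → Coins q) (D : Scheduler V)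

/-- The moment at which the `i`-th update of `v` is resolved. -/
def resolveTime (v : V) (i : ℕ) : ℝ := (timetable X T y₀ ω).resolvedAt G D y₀ v i

/-- The moment at which the `k`-th message from `u` to `v` is sent. -/
def sendTime (u v : V) (k : ℕ) : ℝ :=
  let m := (timetable X T y₀ ω).count u
  if k < m + 2 then 0
  else if k < (timetable X T y₀ ω).phaseOneCount u v then
    (timetable X T y₀ ω).levelDone D ((k - (m + 2)) / m) v u
  else resolveTime X T y₀ ω D u (k - (timetable X T y₀ ω).phaseOneCount u v)

/-- The moment at which the first `k` messages from `u` to `v` have been delivered. -/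
def deliveryTime (u v : V) : ℕ → ℝ
  | 0 => 0
  | k + 1 => max (deliveryTime u v k)
      (sendTime X T y₀ ω D u v k + D.delay u v k (sendTime X T y₀ ω D u v k))

variable {X T y₀ ω D}

theorem deliveryTime_mono (u v : V) : Monotone (deliveryTime X T y₀ ω D u v) :=
  monotone_nat_of_le_succ fun _ => le_max_left _ _

theorem sendTime_lt_deliveryTime (u v : V) (k : ℕ) :
    sendTime X T y₀ ω D u v k < deliveryTime X T y₀ ω D u v (k + 1) :=
  lt_of_lt_of_le (lt_add_of_pos_right _ (D.delay_pos _ _ _ _)) (le_max_right _ _)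

theorem burst_eq_deliveryTime {u v : V} {k : ℕ} {s : ℝ} : ∀ {n : ℕ},
    (∀ i < n, sendTime X T y₀ ω D u v (k + i) = s) →
    burst (D.delay u v) (deliveryTime X T y₀ ω D u v k) k s n =
      deliveryTime X T y₀ ω D u v (k + n)
  | 0, _ => rfl
  | n + 1, h => by
    rw [burst, burst_eq_deliveryTime fun i hi => h i (by omega), ← add_assoc, deliveryTime,
      h n (by omega)]

/-- All blocks of one level are sent at the same moment, so a `burst` is a segment of the recursion
for `deliveryTime`. -/
theorem levelDone_eq {u v : V} : ∀ {ℓ : ℕ}, ℓ ≤ (timetable X T y₀ ω).depth u v →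
    (timetable X T y₀ ω).levelDone D ℓ u v = deliveryTime X T y₀ ω D u v
      ((timetable X T y₀ ω).count u + 2 + ℓ * (timetable X T y₀ ω).count u)
  | 0, _ => by
    rw [Timetable.levelDone, zero_mul, add_zero]
    conv_rhs => rw [← Nat.zero_add ((timetable X T y₀ ω).count u + 2)]
    exact burst_eq_deliveryTime (k := 0) fun i hi => if_pos (by rwa [Nat.zero_add])
  | ℓ + 1, hℓ => by
    rw [Timetable.levelDone, levelDone_eq (Nat.le_of_succ_le hℓ), burst_eq_deliveryTime]
    · congr 1; ring
    · intro i hi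
      have h1 : (ℓ + 1) * (timetable X T y₀ ω).count u ≤
        (timetable X T y₀ ω).depth u v * (timetable X T y₀ ω).count u := Nat.mul_le_mul_right _ hℓ
      rw [Nat.succ_mul] at h1
      simp only [sendTime]
      rw [if_neg (by omega), if_pos (by rw [Timetable.phaseOneCount]; omega)]
      congr 1
      rw [add_assoc, Nat.add_sub_cancel_left, mul_comm ℓ, Nat.mul_add_div (by omega),
        Nat.div_eq_of_lt hi, add_zero]

theorem levelDone_depth_eq {u v : V} :
    (timetable X T y₀ ω).levelDone D ((timetable X T y₀ ω).depth u v) u v =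
      deliveryTime X T y₀ ω D u v ((timetable X T y₀ ω).phaseOneCount u v) :=
  levelDone_eq le_rfl

theorem sendTime_decision (u v : V) (i : ℕ) :
    sendTime X T y₀ ω D u v ((timetable X T y₀ ω).phaseOneCount u v + i) =
      resolveTime X T y₀ ω D u i := by
  have := le_phaseOneCount (X := X) (T := T) (y₀ := y₀) (ω := ω) u v
  simp only [sendTime]
  rw [if_neg (by omega), if_neg (by omega), Nat.add_sub_cancel_left]

theorem arrival_eq (u v : V) : ∀ k, (timetable X T y₀ ω).arrival D
    ((timetable X T y₀ ω).run G D y₀) u v k =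
      deliveryTime X T y₀ ω D u v ((timetable X T y₀ ω).phaseOneCount u v + k + 1)
  | 0 => by
    have := sendTime_decision (X := X) (T := T) (y₀ := y₀) (ω := ω) (D := D) u v 0
    rw [add_zero] at this
    rw [Timetable.arrival, add_zero, deliveryTime, levelDone_depth_eq, this]
    rfl
  | k + 1 => by
    have h : deliveryTime X T y₀ ω D u v ((timetable X T y₀ ω).phaseOneCount u v + (k + 1) + 1) =
      max (deliveryTime X T y₀ ω D u v ((timetable X T y₀ ω).phaseOneCount u v + (k + 1))) _ := rfl
    rw [Timetable.arrival, arrival_eq u v k, h, sendTime_decision]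
    rfl

theorem Consistent.resolved_le {v : V} {r : V → ℕ} {s : NodeState V q}
    (hs : Consistent X T y₀ ω D v r s) : s.resolved ≤ (timetable X T y₀ ω).count v := by
  rcases hs with ⟨h, -⟩ | ⟨h, -⟩
  · rw [h.resolved]; exact Nat.zero_le _
  · exact h.resolved_le

theorem Consistent.received {v : V} {r : V → ℕ} {s : NodeState V q}
    (hs : Consistent X T y₀ ω D v r s) (h : 0 < s.resolved) {u : V} (hu : G.Adj v u) :
    (timetable X T y₀ ω).phaseOneCount u v ≤ r u := by
  rcases hs with ⟨h1, -⟩ | ⟨-, -, h1, -⟩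
  · exact absurd h1.resolved h.ne'
  · exact h1 u hu

/-- A node resolves no update too early. -/
theorem Consistent.resolveTime_le (h : RegularClocks X T y₀ ω) {v : V} {r : V → ℕ}
    {s : NodeState V q} (hs : Consistent X T y₀ ω D v r s) {t : ℝ} (ht : 0 ≤ t)
    (hr : ∀ u, G.Adj v u → deliveryTime X T y₀ ω D u v (r u) ≤ t) :
    ∀ i < s.resolved, resolveTime X T y₀ ω D v i ≤ t := by
  rcases hs with ⟨h1, -⟩ | ⟨h1, -, h2, -⟩
  · rw [h1.resolved]; exact fun i hi => absurd hi (Nat.not_lt_zero i)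
  have henter : (timetable X T y₀ ω).enterTime G D v ≤ t :=
    Timetable.enterTime_le ht fun u hu => by
      rw [levelDone_depth_eq]
      exact (deliveryTime_mono u v (h2 u hu.symm)).trans (hr u hu.symm)
  intro i
  induction i with
  | zero =>
    intro hi
    rw [resolveTime, Timetable.resolvedAt_eq h.isRanked (hi.trans_le h1.resolved_le)]
    refine Timetable.sInf_resolveTimes_le henter ((h1.settled 0 hi).mono fun u hu => ?_)
    by_contra! hlt
    refine lt_irrefl _ (Timetable.lt_known_iff.2 ⟨hlt.trans_le (min_le_right _ _), ?_⟩)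
    rw [arrival_eq]
    refine (deliveryTime_mono u v ?_).trans (hr u hu)
    have := hlt.trans_le (min_le_left _ _)
    omega
  | succ i ih =>
    intro hi
    rw [resolveTime, Timetable.resolvedAt_eq h.isRanked (hi.trans_le h1.resolved_le)]
    refine Timetable.sInf_resolveTimes_le (max_le henter (ih (by omega)))
      ((h1.settled _ hi).mono fun u hu => ?_)
    by_contra! hlt
    refine lt_irrefl _ (Timetable.lt_known_iff.2 ⟨hlt.trans_le (min_le_right _ _), ?_⟩)
    rw [arrival_eq]
    refine (deliveryTime_mono u v ?_).trans (hr u hu)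
    have := hlt.trans_le (min_le_left _ _)
    omega

variable (X T y₀ ω D)

/-- The messages from `u` to `v` with numbers from `a` to `b - 1`, with their moments of delivery. -/
def messageSlice (u v : V) (a b : ℕ) : List (ℝ × Msg q) :=
  (List.Ico a b).map fun k => (deliveryTime X T y₀ ω D u v (k + 1), message X T y₀ ω D u v k)

/-- The number of messages from `u` to `v` that have been sent. -/
def sentTotal (c : Config V (NodeState V q) (Msg q)) (r : V → V → ℕ) (u v : V) : ℕ :=
  sentCount X T y₀ ω u v (fun w => r w u) (c.state u).resolved

/-- The configuration `c` when the first `r u v` messages from `u` to `v` have been delivered. -/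
structure Invariant (c : Config V (NodeState V q) (Msg q)) (r : V → V → ℕ) : Prop where
  consistent : ∀ v, Consistent X T y₀ ω D v (fun u => r u v) (c.state v)
  le : ∀ u v, G.Adj u v → r u v ≤ sentTotal X T y₀ ω c r u v
  sent : ∀ u v, G.Adj u v → c.sent u v = sentTotal X T y₀ ω c r u v
  channel : ∀ u v, G.Adj u v →
    c.channel u v = messageSlice X T y₀ ω D u v (r u v) (sentTotal X T y₀ ω c r u v)
  channel_nil : ∀ u v, ¬ G.Adj u v → c.channel u v = []
  received_zero : ∀ u v, ¬ G.Adj u v → r u v = 0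
  delivered : ∀ u v, G.Adj u v → deliveryTime X T y₀ ω D u v (r u v) ≤ c.now
  pending : ∀ u v, G.Adj u v → ∀ k, r u v ≤ k → k < sentTotal X T y₀ ω c r u v →
    c.now ≤ deliveryTime X T y₀ ω D u v (k + 1)
  now_nonneg : 0 ≤ c.now

variable {X T y₀ ω D}

/-- If the new messages are sent at their predicted moment, then appending them by the FIFO rule
continues the predicted schedule. -/
theorem transmit_messageSlice {u v : V} {t : ℝ} {a : ℕ}
    (ha : deliveryTime X T y₀ ω D u v a ≤ t) (n : ℕ) : ∀ b, a ≤ b →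
    (∀ k, b ≤ k → k < b + n → sendTime X T y₀ ω D u v k = t) →
    transmit (D.delay u v) t b (messageSlice X T y₀ ω D u v a b)
      ((List.Ico b (b + n)).map (message X T y₀ ω D u v)) =
      messageSlice X T y₀ ω D u v a (b + n) := by
  induction n with
  | zero => intro b _ _; simp [transmit]
  | succ n ih =>
    intro b hab hs
    rw [List.Ico.eq_cons (by omega : b < b + (n + 1)), List.map_cons, transmit,
      show b + (n + 1) = b + 1 + n by ring]
    rw [← ih (b + 1) (by omega) fun k h1 h2 => hs k (by omega) (by omega)]
    congr 1
    rw [messageSlice, messageSlice, List.Ico.succ_top hab, List.map_append, List.map_singleton]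
    refine congrArg (fun x => _ ++ [x]) (Prod.ext ?_ rfl)
    dsimp only
    rw [show deliveryTime X T y₀ ω D u v (b + 1) = max (deliveryTime X T y₀ ω D u v b) _ from rfl,
      hs b le_rfl (by omega)]
    -- On an empty channel there is no predecessor in the list, and `transmit` compares with the
    -- present time instead. This makes no difference, because everything sent earlier has been
    -- delivered by time `t`.
    rcases hab.eq_or_lt with rfl | hlt
    · have := D.delay_pos u v a t
      simp only [List.Ico.self_empty, List.map_nil, List.getLast?_nil, Option.map_none,
        Option.getD_none]
      rw [max_eq_right (by linarith), max_eq_right (by linarith)]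
    · obtain ⟨b, rfl⟩ := Nat.exists_eq_succ_of_ne_zero (show b ≠ 0 by omega)
      rw [List.Ico.succ_top (by omega)]
      simp

theorem le_phaseOneSent {v u : V} {r ℓ : ℕ} (hℓ : ℓ < (timetable X T y₀ ω).depth u v)
    (hr : (timetable X T y₀ ω).count u + 2 + ℓ * (timetable X T y₀ ω).count u ≤ r) :
    (timetable X T y₀ ω).count v + 2 + (ℓ + 1) * (timetable X T y₀ ω).count v ≤
      phaseOneSent X T y₀ ω v u r := by
  have hm := count_pos_of_lt_depth hℓ
  simp only [phaseOneSent]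
  rw [if_neg (by omega), mul_comm]
  gcongr
  refine le_min hℓ (Nat.succ_le_succ ?_)
  rw [Nat.le_div_iff_mul_le hm]; omega

/-! ### Messages and decisions that must have arrived by a given moment. -/

namespace Invariant

variable {c : Config V (NodeState V q) (Msg q)} {r : V → V → ℕ}
  (hc : Invariant X T y₀ ω D c r)
include hc

/-- The hypothesis on `s` says that nothing is due up to time `s`; a message already sent and due by
then cannot still be in transit. -/
theorem lt_received {s : ℝ} (hs : ∀ x y, ∀ p ∈ c.channel x y, s < p.1) {u v : V}
    (huv : G.Adj u v) {k : ℕ} (hk : k < sentTotal X T y₀ ω c r u v)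
    (hd : deliveryTime X T y₀ ω D u v (k + 1) ≤ s) : k < r u v := by
  by_contra! hle
  refine absurd (hs u v (deliveryTime X T y₀ ω D u v (k + 1), message X T y₀ ω D u v k) ?_)
    (not_lt.2 hd)
  rw [hc.channel u v huv]
  exact List.mem_map.2 ⟨k, List.Ico.mem.2 ⟨hle, hk⟩, rfl⟩

/-- The recursion alternates between the two directions of an edge: level `ℓ + 1` from `u` was sent
because level `ℓ` from `v` had arrived. -/
theorem level_received {s : ℝ} (hs : ∀ x y, ∀ p ∈ c.channel x y, s < p.1) : ∀ (ℓ : ℕ) (u v : V),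
    G.Adj u v → ℓ ≤ (timetable X T y₀ ω).depth u v →
    (timetable X T y₀ ω).levelDone D ℓ u v ≤ s →
    (timetable X T y₀ ω).count u + 2 + ℓ * (timetable X T y₀ ω).count u ≤ r u v
  | 0, u, v, huv, hℓ, hd => by
    rw [levelDone_eq hℓ, zero_mul, add_zero] at hd
    have : (timetable X T y₀ ω).count u + 1 < sentTotal X T y₀ ω c r u v := by
      simp only [sentTotal, sentCount, phaseOneSent]; omega
    have := hc.lt_received hs huv this hd
    omega
  | ℓ + 1, u, v, huv, hℓ, hd => by
    have hlt : ℓ < (timetable X T y₀ ω).depth v u := by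
      rw [timetable_depth_comm]; exact hℓ
    have hm : 0 < (timetable X T y₀ ω).count u := count_pos_of_lt_depth hℓ
    have hsent := le_phaseOneSent hlt (level_received hs ℓ v u huv.symm hlt.le (le_trans ?_ hd))
    · rw [levelDone_eq hℓ] at hd
      have h1 : (timetable X T y₀ ω).count u + 2 + (ℓ + 1) * (timetable X T y₀ ω).count u =
        (timetable X T y₀ ω).count u + 1 + (ℓ + 1) * (timetable X T y₀ ω).count u + 1 := by ring
      rw [h1] at hd
      have := hc.lt_received hs huv (by rw [sentTotal, sentCount]; omega) hd
      omega
    · obtain ⟨m, hm'⟩ := Nat.exists_eq_succ_of_ne_zero hm.ne'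
      rw [Timetable.levelDone, hm', burst]
      exact (lt_add_of_pos_right _ (D.delay_pos _ _ _ _)).le.trans (le_max_right _ _)

theorem phaseOne_received {s : ℝ} (hs : ∀ x y, ∀ p ∈ c.channel x y, s < p.1) {v : V}
    (henter : (timetable X T y₀ ω).enterTime G D v ≤ s) {u : V} (hu : G.Adj v u) :
    (timetable X T y₀ ω).phaseOneCount u v ≤ r u v :=
  hc.level_received hs _ u v hu.symm le_rfl
    ((Timetable.levelDone_le_enterTime hu.symm).trans henter)

theorem inPhaseTwo {s : ℝ} (hs : ∀ x y, ∀ p ∈ c.channel x y, s < p.1) {v : V}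
    (henter : (timetable X T y₀ ω).enterTime G D v ≤ s) :
    InPhaseTwo X T y₀ ω D v (fun u => r u v - (timetable X T y₀ ω).phaseOneCount u v)
      (c.state v) ∧
    Stuck X T y₀ ω D v (fun u => r u v - (timetable X T y₀ ω).phaseOneCount u v) (c.state v) := by
  rcases hc.consistent v with ⟨-, u, hu, hlt⟩ | ⟨h1, -, -, h2⟩
  · exact absurd (hc.phaseOne_received hs henter hu) (by dsimp only at hlt; omega)
  · exact ⟨h1, h2⟩

/-- A node resolves no update too late. -/
theorem lt_resolved (h : RegularClocks X T y₀ ω) (n : ℕ) : ∀ (v : V) (i : ℕ),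
    i < (timetable X T y₀ ω).count v →
    (((Finset.univ : Finset V).sigma fun u => Finset.range ((timetable X T y₀ ω).count u)).filter
      fun p => ringTime (coinsAt ω p.1) p.2 < ringTime (coinsAt ω v) i).card = n →
    (∀ x y, ∀ p ∈ c.channel x y, resolveTime X T y₀ ω D v i < p.1) →
    i < (c.state v).resolved := by
  induction n using Nat.strong_induction_on with
  | _ n ih =>
  intro v i hi hn hs
  obtain ⟨h1, h2⟩ := hc.inPhaseTwo hs
    (Timetable.enterTime_le_resolvedAt timetable_isLocal h.isRanked hi)
  by_contra! hle
  rcases h2 with h2 | h2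
  · omega
  -- If `i` itself is the next unresolved update, then being stuck contradicts its being settled at
  -- its resolution moment. If an earlier update of `v` is unresolved, then that one has smaller
  -- rank and was due no later.
  rcases hle.eq_or_lt with heq | hlt
  · rw [heq] at h2
    refine h2 ((Timetable.resolvedAt_mem timetable_isLocal h.isRanked hi).2.2.mono fun u hu => ?_)
    refine (min_le_left _ _).trans ?_
    by_contra! hlt
    obtain ⟨hk1, hk2⟩ := Timetable.lt_known_iff.1 hlt
    -- The first decision of `u` that is missing at `v`. It is due by then, and its sender resolved
    -- it strictly earlier because delays are positive; by induction it has been sent, hence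
    -- delivered.
    set k := r u v - (timetable X T y₀ ω).phaseOneCount u v with hk
    have hku := h.isRanked.lt_count_of_before hi hk1
    have hlt2 : resolveTime X T y₀ ω D u k < resolveTime X T y₀ ω D v i :=
      lt_of_lt_of_le (Timetable.lt_arrival _ u v k) hk2
    have hres := ih _ (hn ▸ h.isRanked.before_rank u v i k hi hk1) u k hku rfl
      fun x y p hp => hlt2.trans (hs x y p hp)
    rw [arrival_eq] at hk2
    have := hc.lt_received hs hu.symm (k := (timetable X T y₀ ω).phaseOneCount u v + k) (by
      rw [sentTotal, sentCount,
        phaseOneSent_of_le ((hc.consistent u).received (by omega) hu.symm)]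
      omega) hk2
    omega
  · refine lt_irrefl _ (ih _ (hn ▸ h.isRanked.mono v _ i hlt hi) v (c.state v).resolved
      (hlt.trans hi) rfl fun x y p hp => 
      (Timetable.resolvedAt_mono timetable_isLocal h.isRanked hle hi).trans_lt (hs x y p hp))

theorem received_le {u v : V} (huv : G.Adj u v) : r u v ≤ messageCount X T y₀ ω u v := by
  have h1 := hc.le u v huv
  have h2 := (hc.consistent u).resolved_le
  have h3 := phaseOneSent_le (X := X) (T := T) (y₀ := y₀) (ω := ω) u v (r v u)
  rw [sentTotal, sentCount] at h1
  rw [messageCount]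
  omega

theorem sentTotal_le {u v : V} : sentTotal X T y₀ ω c r u v ≤ messageCount X T y₀ ω u v := by
  have h2 := (hc.consistent u).resolved_le
  have h3 := phaseOneSent_le (X := X) (T := T) (y₀ := y₀) (ω := ω) u v (r v u)
  rw [sentTotal, sentCount, messageCount]
  omega

end Invariant

theorem invariant_initialConfig (h : RegularClocks X T y₀ ω) :
    Invariant X T y₀ ω D (initialConfig G D (mainAlgorithm X T y₀ ω)) fun _ _ => 0 := by
  have hsent : ∀ u v, G.Adj u v → sentTotal X T y₀ ω (initialConfig G D (mainAlgorithm X T y₀ ω))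
      (fun _ _ => 0) u v = (timetable X T y₀ ω).count u + 2 := by
    intro u v huv
    have := ((consistent_start (D := D) h u).2 v huv).2
    rw [sentTotal, sentCount, phaseOneSent_zero]
    exact congrArg _ this
  have hmsg : ∀ u v, G.Adj u v → (mainAlgorithm X T y₀ ω u).start.2 v =
      (List.Ico 0 ((timetable X T y₀ ω).count u + 2)).map (message X T y₀ ω D u v) := by
    intro u v huv
    rw [((consistent_start (D := D) h u).2 v huv).1]
    congr 2
    exact hsent u v huv
  refine ⟨fun v => (consistent_start h v).1, fun _ _ _ => Nat.zero_le _, fun u v huv => ?_,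
    fun u v huv => ?_, fun u v huv => if_neg huv, fun _ _ _ => rfl, fun _ _ _ => le_rfl,
    fun u v huv k _ _ => ?_, le_rfl⟩
  · rw [hsent u v huv]
    simp [initialConfig, huv, hmsg u v huv]
  · rw [hsent u v huv]
    simp only [initialConfig, huv, if_true]
    rw [hmsg u v huv]
    have := transmit_messageSlice (X := X) (T := T) (y₀ := y₀) (ω := ω) (D := D) (u := u) (v := v)
      (t := 0) (a := 0) le_rfl ((timetable X T y₀ ω).count u + 2) 0 le_rfl
      (fun k _ hk => if_pos (by simpa using hk))
    simpa [messageSlice] using this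
  · exact deliveryTime_mono u v (Nat.zero_le _)

end Network

/-! ### Termination -/

section Network

variable {V : Type*} [Fintype V] {G : SimpleGraph V} {q : ℕ}
  {X : MetropolisChain G q} {T : ℝ} {y₀ : V → Fin q} {ω : V × ℕ → Coins q} {D : Scheduler V}

/-- Apart from bookkeeping, the point is that whatever is sent in reaction to the delivery is sent
at exactly its predicted moment. -/
theorem Invariant.step (h : RegularClocks X T y₀ ω) {c c' : Config V (NodeState V q) (Msg q)}
    {r : V → V → ℕ} (hc : Invariant X T y₀ ω D c r)
    (hstep : Step G D (mainAlgorithm X T y₀ ω) c c') :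
    ∃ u v, G.Adj u v ∧ Invariant X T y₀ ω D c'
      (Function.update r u (Function.update (r u) v (r u v + 1))) := by
  obtain ⟨u, v, t, m, rest, head, earliest⟩ := hstep
  have huv : G.Adj u v := by
    by_contra hn
    rw [hc.channel_nil u v hn] at head
    cases head
  have hne := G.ne_of_adj huv
  refine ⟨u, v, huv, ?_⟩
  set r' := Function.update r u (Function.update (r u) v (r u v + 1)) with hr'
  have hlt : r u v < sentTotal X T y₀ ω c r u v := by
    by_contra! hle
    rw [hc.channel u v huv, messageSlice, List.Ico.eq_nil_of_le hle] at head
    cases head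
  rw [hc.channel u v huv, messageSlice, List.Ico.eq_cons hlt, List.map_cons, List.cons.injEq,
    Prod.mk.injEq] at head
  obtain ⟨⟨ht, rfl⟩, hrest⟩ := head
  have hnow : c.now ≤ t := ht ▸ hc.pending u v huv _ le_rfl hlt
  have ht0 : 0 ≤ t := hc.now_nonneg.trans hnow
  have hr'u : r' u v = r u v + 1 := by simp [hr']
  have hr'ne : ∀ x y, ¬ (x = u ∧ y = v) → r' x y = r x y := by
    intro x y hxy
    rcases eq_or_ne x u with rfl | hx
    · have : y ≠ v := fun hy => hxy ⟨rfl, hy⟩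
      simp [hr', this]
    · simp [hr', hx]
  have hcol : (fun w => r' w v) = Function.update (fun w => r w v) u (r u v + 1) := by
    ext w
    rcases eq_or_ne w u with rfl | hw
    · simp [hr'u]
    · rw [hr'ne w v (fun hx => hw hx.1), Function.update_of_ne hw]
  have hcol' : ∀ y, y ≠ v → (fun w => r' w y) = fun w => r w y := fun y hy => by
    ext w; exact hr'ne w y (fun hx => hy hx.2)
  have hdel : ∀ x y, G.Adj x y → deliveryTime X T y₀ ω D x y (r' x y) ≤ t := by
    intro x y hxy
    by_cases hx : x = u ∧ y = v
    · obtain ⟨rfl, rfl⟩ := hx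
      rw [hr'u, ht]
    · rw [hr'ne x y hx]
      exact (hc.delivered x y hxy).trans hnow
  obtain ⟨h1, h2, h3⟩ := consistent_receive h (fun w hw => hc.received_le hw.symm)
    (hc.consistent v) huv.symm (hlt.trans_le hc.sentTotal_le)
  set o := (node X T y₀ ω v).onReceive (c.state v) u (message X T y₀ ω D u v (r u v)) with ho
  rw [← hcol] at h1 h3
  -- Not later than `t`, since the information now available settles the update; not earlier, since
  -- it would then have been resolved before this delivery. Ties do not matter, because the
  -- prediction counts all arrivals up to and including `t`.
  have hexact : ∀ i, (c.state v).resolved ≤ i → i < o.1.resolved →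
      resolveTime X T y₀ ω D v i = t := by
    intro i hi1 hi2
    refine le_antisymm (h1.resolveTime_le h ht0 (fun w hw => hdel w v hw.symm) i hi2) ?_
    by_contra! hlt'
    exact absurd (hc.lt_resolved h _ v i (hi2.trans_le h1.resolved_le) rfl
      fun x y p hp => hlt'.trans_le (earliest x y p hp)) (not_lt.2 hi1)
  have hstate : ∀ w, (deliver G D (mainAlgorithm X T y₀ ω) c u v t
      (message X T y₀ ω D u v (r u v)) rest).state w = if w = v then o.1 else c.state w := by
    intro w
    simp only [deliver, Function.update_apply]
    rfl
  have hout : ((mainAlgorithm X T y₀ ω v).receive (c.state v) u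
    (message X T y₀ ω D u v (r u v))).2 = o.2 := rfl
  set c' := deliver G D (mainAlgorithm X T y₀ ω) c u v t (message X T y₀ ω D u v (r u v)) rest
    with hc'
  have htot : ∀ x, sentTotal X T y₀ ω c' r' v x =
      sentCount X T y₀ ω v x (fun w => r' w v) o.1.resolved := by
    intro x; rw [sentTotal, hstate, if_pos rfl]
  have htot' : ∀ w x, w ≠ v → sentTotal X T y₀ ω c' r' w x = sentTotal X T y₀ ω c r w x := by
    intro w x hw; rw [sentTotal, hstate, if_neg hw, hcol' w hw]; rfl
  have hsend : ∀ x, G.Adj v x → ∀ k, sentTotal X T y₀ ω c r v x ≤ k →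
      k < sentTotal X T y₀ ω c' r' v x → sendTime X T y₀ ω D v x k = t := by
    intro x hx k hk1 hk2
    rw [htot] at hk2
    -- A refinement is provoked by the message that completes the preceding level, whose delivery
    -- time is `t`.
    rcases (h3 x hx).2.2 k hk1 hk2 with ⟨rfl, h4, h5, h6⟩ | ⟨i, h4, h5, rfl⟩
    · have hlev := level_lt_depth h5 h4
      rw [timetable_depth_comm] at hlev
      simp only [sendTime]
      rw [if_neg (by omega), if_pos h5, levelDone_eq hlev.le, ← h6, ht]
    · rw [sendTime_decision, hexact i h4 h5]
  have hmono : ∀ x, G.Adj v x → sentTotal X T y₀ ω c r v x ≤ sentTotal X T y₀ ω c' r' v x :=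
    fun x hx => by rw [htot]; exact (h3 x hx).1
  have hvu : ∀ x, ¬ (v = u ∧ x = v) := fun x hx => hne hx.1.symm
  refine ⟨fun w => ?_, fun x y hxy => ?_, fun x y hxy => ?_, fun x y hxy => ?_, fun x y hxy => ?_,
    fun x y hxy => ?_, hdel, fun x y hxy k hk1 hk2 => ?_, ht0⟩
  · rw [hstate]
    split_ifs with hw
    · rw [hw]; exact h1
    · rw [hcol' w hw]; exact hc.consistent w
  · rcases eq_or_ne x v with rfl | hx
    · rw [hr'ne _ _ (hvu y)]
      exact (hc.le _ y hxy).trans (hmono y hxy)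
    · rw [htot' x y hx]
      by_cases hxy' : x = u ∧ y = v
      · rw [hxy'.1, hxy'.2, hr'u]; exact hlt
      · rw [hr'ne x y hxy']; exact hc.le x y hxy
  · rcases eq_or_ne x v with rfl | hx
    · have hs : c'.sent x y = c.sent x y + (o.2 y).length := by
        simp only [hc', deliver, hxy, and_self, if_true, hout]
      rw [hs, hc.sent _ _ hxy, (h3 y hxy).2.1, htot, List.length_map, List.Ico.length]
      exact Nat.add_sub_of_le (h3 y hxy).1
    · rw [htot' x y hx]
      simp only [hc', deliver, hx, false_and, if_false]
      exact hc.sent x y hxy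
  · rcases eq_or_ne x v with rfl | hx
    · have hs : c'.channel x y =
          transmit (D.delay x y) t (c.sent x y) (c.channel x y) (o.2 y) := by
        simp only [hc', deliver, hxy, and_self, if_true, if_neg (hvu y), hout]
      rw [hs, hc.sent _ _ hxy, (h3 y hxy).2.1, hr'ne _ _ (hvu y), hc.channel _ _ hxy]
      have hm := hmono y hxy
      have := transmit_messageSlice (u := x) (v := y) (a := r x y)
        ((hc.delivered x y hxy).trans hnow)
        (sentTotal X T y₀ ω c' r' x y - sentTotal X T y₀ ω c r x y)
        (sentTotal X T y₀ ω c r x y) (hc.le x y hxy)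
        (fun k hk1 hk2 => hsend y hxy k hk1 (by omega))
      rw [Nat.add_sub_of_le hm] at this
      rw [← this, htot]
      rfl
    · rw [htot' x y hx]
      simp only [hc', deliver, hx, false_and, if_false]
      split_ifs with hxy'
      · rw [hxy'.1, hxy'.2, hr'u, ← hrest]; rfl
      · rw [hr'ne x y hxy']; exact hc.channel x y hxy
  · have hxy' : ¬ (x = u ∧ y = v) := fun h => hxy (by rw [h.1, h.2]; exact huv)
    simp only [hc', deliver, hxy, and_false, if_false, hxy']
    exact hc.channel_nil x y hxy
  · rw [hr'ne x y fun h => hxy (by rw [h.1, h.2]; exact huv)]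
    exact hc.received_zero x y hxy
  · change t ≤ _
    -- Messages sent before are due at `t` or later by the choice of the delivery; those sent now
    -- are due strictly later.
    by_cases hold : k < sentTotal X T y₀ ω c r x y
    · refine earliest x y (deliveryTime X T y₀ ω D x y (k + 1), message X T y₀ ω D x y k) ?_
      rw [hc.channel x y hxy]
      refine List.mem_map.2 ⟨k, List.Ico.mem.2 ⟨le_trans ?_ hk1, hold⟩, rfl⟩
      by_cases hxy' : x = u ∧ y = v
      · rw [hxy'.1, hxy'.2, hr'u]; exact Nat.le_succ _
      · rw [hr'ne x y hxy']
    · rcases eq_or_ne x v with rfl | hx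
      · rw [← hsend y hxy k (not_lt.1 hold) hk2]
        exact (sendTime_lt_deliveryTime _ _ _).le
      · rw [htot' x y hx] at hk2
        exact absurd hk2 hold

/-- When no message is due before time `B`, all nodes have terminated. -/
theorem Invariant.returns (h : RegularClocks X T y₀ ω) {c : Config V (NodeState V q) (Msg q)}
    {r : V → V → ℕ} (hc : Invariant X T y₀ ω D c r) {B : ℝ}
    (hB : ∀ x y, ∀ p ∈ c.channel x y, B < p.1)
    (henter : ∀ v, (timetable X T y₀ ω).enterTime G D v ≤ B)
    (hres : ∀ v, ∀ i < (timetable X T y₀ ω).count v, resolveTime X T y₀ ω D v i ≤ B) :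
    ∃ y, Returns (mainAlgorithm X T y₀ ω) c y := by
  refine ⟨fun v => (c.state v).value, fun v => if_pos ⟨?_, ?_⟩⟩
  · exact (hc.inPhaseTwo hB (henter v)).1.phaseTwo
  · refine le_antisymm (hc.consistent v).resolved_le ?_
    by_contra! hlt
    have hlt : (c.state v).resolved < (timetable X T y₀ ω).count v := hlt
    exact lt_irrefl _ (hc.lt_resolved h _ v _ hlt rfl fun x y p hp =>
      (hres v _ hlt).trans_lt (hB x y p hp))

theorem Invariant.eq_of_returns {c : Config V (NodeState V q) (Msg q)}
    {r : V → V → ℕ} (hc : Invariant X T y₀ ω D c r) {y : V → Fin q}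
    (hy : Returns (mainAlgorithm X T y₀ ω) c y) (v : V) :
    y v = valueAt X T y₀ ω D v ((timetable X T y₀ ω).count v) := by
  have h1 := hy v
  change (if (c.state v).phaseTwo = true ∧ (c.state v).resolved = _ then _ else _) = _ at h1
  split_ifs at h1 with h2
  obtain ⟨h3, h4⟩ := h2
  rcases hc.consistent v with ⟨h5, -⟩ | ⟨h5, -⟩
  · rw [h5.phaseTwo] at h3; cases h3
  · rw [← Option.some_inj.1 h1, h5.value]
    exact congrArg _ h4

section Executions

variable {e : ℕ → Config V (NodeState V q) (Msg q)}

theorem exists_invariant (h : RegularClocks X T y₀ ω)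
    (he : IsExecution G D (mainAlgorithm X T y₀ ω) e) (k : ℕ) :
    ∃ r, Invariant X T y₀ ω D (e k) r := by
  induction k with
  | zero => exact ⟨_, he.1 ▸ invariant_initialConfig h⟩
  | succ k ih =>
    obtain ⟨r, hr⟩ := ih
    rcases he.2 k with hs | ⟨-, hs⟩
    · obtain ⟨u, v, -, hinv⟩ := hr.step h hs
      exact ⟨_, hinv⟩
    · exact ⟨r, hs ▸ hr⟩

/-- Eventually no messages are in transit. -/
theorem exists_quiescent (h : RegularClocks X T y₀ ω)
    (he : IsExecution G D (mainAlgorithm X T y₀ ω) e) : ∃ k, ∀ u v, (e k).channel u v = [] := by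
  by_contra! hn
  -- As long as messages are in transit, every step raises the total number of deliveries by one;
  -- but this total is bounded.
  have key : ∀ k, ∃ r, Invariant X T y₀ ω D (e k) r ∧ ∑ u, ∑ v, r u v = k := by
    intro k
    induction k with
    | zero => exact ⟨_, he.1 ▸ invariant_initialConfig h, by simp⟩
    | succ k ih =>
      obtain ⟨r, hr, hsum⟩ := ih
      rcases he.2 k with hs | ⟨hs, -⟩
      · obtain ⟨u, v, -, hinv⟩ := hr.step h hs
        refine ⟨_, hinv, ?_⟩
        have h1 : ∀ x, ∑ y, Function.update r u (Function.update (r u) v (r u v + 1)) x y =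
            ∑ y, r x y + if x = u then 1 else 0 := by
          intro x
          split_ifs with hx
          · subst hx
            rw [Function.update_self, ← Finset.add_sum_erase _ _ (Finset.mem_univ v),
              ← Finset.add_sum_erase _ (r x) (Finset.mem_univ v), Function.update_self,
              Finset.sum_congr rfl fun y hy => Function.update_of_ne (Finset.ne_of_mem_erase hy) _ _]
            ring
          · rw [Function.update_of_ne hx, add_zero]
        rw [Finset.sum_congr rfl fun x _ => h1 x, Finset.sum_add_distrib, hsum]
        simp
      · obtain ⟨u, v, huv⟩ := hn k
        exact absurd (hs u v) huv
  obtain ⟨r, hr, hsum⟩ := key (∑ u, ∑ v, messageCount X T y₀ ω u v + 1)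
  have : ∑ u, ∑ v, r u v ≤ ∑ u, ∑ v, messageCount X T y₀ ω u v := by
    refine Finset.sum_le_sum fun u _ => Finset.sum_le_sum fun v _ => ?_
    by_cases huv : G.Adj u v
    · exact hr.received_le huv
    · rw [hr.received_zero u v huv]; exact Nat.zero_le _
  omega

theorem alwaysTerminates (h : RegularClocks X T y₀ ω) :
    AlwaysTerminates G D (mainAlgorithm X T y₀ ω) := by
  intro e he
  obtain ⟨k, hk⟩ := exists_quiescent h he
  obtain ⟨r, hr⟩ := exists_invariant h he k
  obtain ⟨B, hB⟩ := ((Set.finite_range ((timetable X T y₀ ω).enterTime G D)).union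
    (Set.finite_iUnion fun v => (Finset.range ((timetable X T y₀ ω).count v)).finite_toSet.image
      (resolveTime X T y₀ ω D v))).bddAbove
  refine ⟨k, hr.returns h (B := B) (fun x y p hp => ?_) (fun v => hB (Or.inl ⟨v, rfl⟩))
    fun v i hi => hB (Or.inr (Set.mem_iUnion.2 ⟨v, i, by simpa using hi, rfl⟩))⟩
  rw [hk x y] at hp
  cases hp

/-- The last configuration whose time is at most `B` has nothing more due up to `B`, either because
the next delivery is later or because no message is left. By then everything predicted to happen by
`B` has happened. -/
theorem terminatesWithin (h : RegularClocks X T y₀ ω) {B : ℝ} (h0 : 0 ≤ B)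
    (henter : ∀ v, (timetable X T y₀ ω).enterTime G D v ≤ B)
    (hres : ∀ v, ∀ i < (timetable X T y₀ ω).count v, resolveTime X T y₀ ω D v i ≤ B) :
    TerminatesWithin G D (mainAlgorithm X T y₀ ω) B := by
  intro e he
  suffices ∃ k, (e k).now ≤ B ∧ ∀ x y, ∀ p ∈ (e k).channel x y, B < p.1 by
    obtain ⟨k, hk1, hk2⟩ := this
    obtain ⟨r, hr⟩ := exists_invariant h he k
    obtain ⟨y, hy⟩ := hr.returns h hk2 henter hres
    exact ⟨k, y, hk1, hy⟩
  by_cases hall : ∀ k, (e k).now ≤ B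
  · obtain ⟨k, hk⟩ := exists_quiescent h he
    refine ⟨k, hall k, fun x y p hp => ?_⟩
    rw [hk x y] at hp
    cases hp
  · push Not at hall
    obtain ⟨k, -, -, hk1, hk2⟩ := exists_switch (P := fun k => B < (e k).now) (a := 0)
      (Nat.zero_le _) (by rw [he.1]; exact not_lt.2 h0) hall.choose_spec
    refine ⟨k, not_lt.1 hk1, fun x y p hp => ?_⟩
    rcases he.2 k with hs | ⟨-, hs⟩
    · generalize e (k + 1) = c' at hs hk2
      obtain ⟨u, v, t, m, rest, head, earliest⟩ := hs
      exact lt_of_lt_of_le hk2 (earliest x y p hp)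
    · rw [hs] at hk2
      exact absurd hk2 hk1

theorem eq_of_hasOutput (h : RegularClocks X T y₀ ω) {y : V → Fin q}
    (hy : HasOutput G D (mainAlgorithm X T y₀ ω) y) (v : V) :
    y v = valueAt X T y₀ ω D v ((timetable X T y₀ ω).count v) := by
  obtain ⟨e, he, k, hk⟩ := hy
  obtain ⟨r, hr⟩ := exists_invariant h he k
  exact hr.eq_of_returns hk v

theorem exists_message_of_isSent (h : RegularClocks X T y₀ ω) {m : Msg q}
    (hm : IsSent G D (mainAlgorithm X T y₀ ω) m) :
    ∃ u v k, G.Adj u v ∧ m = message X T y₀ ω D u v k := by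
  obtain ⟨e, he, k, u, v, t, hmem⟩ := hm
  obtain ⟨r, hr⟩ := exists_invariant h he k
  by_cases huv : G.Adj u v
  · rw [hr.channel u v huv] at hmem
    obtain ⟨i, -, hi⟩ := List.mem_map.1 hmem
    exact ⟨u, v, i, huv, (Prod.mk.inj hi).2.symm⟩
  · rw [hr.channel_nil u v huv] at hmem
    cases hmem

end Executions
end Network

/-! ### The output of the main algorithm is the state of the chain -/

section Network

theorem countP_fst_eq {V : Type*} {l : List (V × ℕ)} (hl : l.Nodup) {u : V} {m : ℕ}
    (hm : ∀ k, (u, k) ∈ l → k < m) :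
    l.countP (fun p => decide (p.1 = u)) =
      ((Finset.range m).filter fun k => (u, k) ∈ l).card := by
  rw [List.countP_eq_length_filter, ← List.toFinset_card_of_nodup (hl.filter _)]
  refine (Finset.card_bij (fun k _ => (u, k)) (fun k hk => ?_) (fun k _ k' _ h => ?_)
    fun p hp => ?_).symm
  · simpa using (Finset.mem_filter.1 hk).2
  · exact (Prod.mk.inj h).2
  · simp only [List.mem_toFinset, List.mem_filter, decide_eq_true_eq] at hp
    obtain ⟨p1, p2⟩ := p
    obtain ⟨h1, rfl⟩ := hp
    exact ⟨p2, by simpa using ⟨hm _ h1, h1⟩, rfl⟩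

variable {V : Type*} [Fintype V] {G : SimpleGraph V} {q : ℕ}
  {X : MetropolisChain G q} {T : ℝ} {y₀ : V → Fin q} {ω : V × ℕ → Coins q} {D : Scheduler V}

theorem mem_ringsUpTo
    (hT : ∀ p : V × ℕ, ringTime (coinsAt ω p.1) p.2 ≠ T) (p : V × ℕ) : p ∈ ringsUpTo ω T ↔ p.2 < (timetable X T y₀ ω).count p.1 := by
  obtain ⟨v, i⟩ := p
  have : {i | ringTime (coinsAt ω v) i ≤ T} = {i | ringTime (coinsAt ω v) i < T} := by
    ext i
    simp only [Set.mem_ofPred_eq]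
    exact ⟨fun hi => lt_of_le_of_ne hi (hT (v, i)), le_of_lt⟩
  rw [ringsUpTo, List.mem_insertionSort, List.mem_flatMap]
  constructor
  · rintro ⟨w, -, hw⟩
    obtain ⟨k, hk, he⟩ := List.mem_map.1 hw
    obtain ⟨rfl, rfl⟩ := Prod.mk.inj he
    rw [this] at hk
    exact List.mem_range.1 hk
  · intro hi
    exact ⟨v, by simp, List.mem_map.2 ⟨i, by rw [this]; exact List.mem_range.2 hi, rfl⟩⟩

theorem nodup_ringsUpTo (ω : V × ℕ → Coins q) (T : ℝ) : (ringsUpTo ω T).Nodup := by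
  rw [ringsUpTo, (List.perm_insertionSort _ _).nodup_iff, List.nodup_flatMap]
  refine ⟨fun v _ => List.nodup_range.map fun a b h => (Prod.mk.inj h).2,
    (Finset.nodup_toList _).imp fun {v w} hvw => ?_⟩
  intro p hp hp'
  obtain ⟨k, -, rfl⟩ := List.mem_map.1 hp
  obtain ⟨k', -, h⟩ := List.mem_map.1 hp'
  exact hvw (Prod.mk.inj h).1.symm

theorem pairwise_ringsUpTo (h : RegularClocks X T y₀ ω)
    (hT : ∀ p : V × ℕ, ringTime (coinsAt ω p.1) p.2 ≠ T) :
    (ringsUpTo ω T).Pairwise fun a b =>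
      ringTime (coinsAt ω a.1) a.2 < ringTime (coinsAt ω b.1) b.2 := by
  have h1 : (ringsUpTo ω T).Pairwise fun a b =>
      ringTime (coinsAt ω a.1) a.2 ≤ ringTime (coinsAt ω b.1) b.2 := by
    have : Std.Total fun a b : V × ℕ =>
      ringTime (coinsAt ω a.1) a.2 ≤ ringTime (coinsAt ω b.1) b.2 := ⟨fun _ _ => le_total _ _⟩
    have : IsTrans (V × ℕ) fun a b =>
      ringTime (coinsAt ω a.1) a.2 ≤ ringTime (coinsAt ω b.1) b.2 := ⟨fun _ _ _ => le_trans⟩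
    exact List.pairwise_insertionSort _ _
  refine ((h1.and (nodup_ringsUpTo ω T)).imp_of_mem ?_)
  intro a b ha hb hab
  refine lt_of_le_of_ne hab.1 fun he => hab.2 ?_
  obtain ⟨u, k⟩ := a
  obtain ⟨v, i⟩ := b
  by_cases huv : u = v
  · subst huv
    exact congrArg (Prod.mk u) ((h.strictMono u).injective he)
  · exact absurd he (h.ringTime_ne huv ((mem_ringsUpTo (X := X) (y₀ := y₀) hT _).1 hb) ((mem_ringsUpTo (X := X) (y₀ := y₀) hT _).1 ha))

theorem decisionAt_eq (h : RegularClocks X T y₀ ω) {v : V} {i : ℕ}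
    (hi : i < (timetable X T y₀ ω).count v) :
    decisionAt X T y₀ ω D v i = decide ((ω (v, i)).2.2 <
      (X.filter v (valueAt X T y₀ ω D v i) (ω (v, i)).2.1
        (fun u => valueAt X T y₀ ω D u ((timetable X T y₀ ω).before u v i)) : ℝ)) := by
  rw [decisionAt, Timetable.run_eq_step h.isRanked hi]
  simp only [Timetable.step]
  simp only [timetable, if_pos (show i < (node X T y₀ ω v).numUpdates from hi)]
  rfl

/-- Induction over initial segments of the rings: after such a segment, each node has the value that
it takes after as many updates as the segment contains at this node. The hypothesis `hT` reconciles
the rings up to and including `T` with the updates strictly before `T`. -/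
theorem foldl_ringsUpTo (h : RegularClocks X T y₀ ω)
    (hT : ∀ p : V × ℕ, ringTime (coinsAt ω p.1) p.2 ≠ T) (l : List (V × ℕ)) :
    ∀ l', l ++ l' = ringsUpTo ω T → l.foldl (metropolisUpdate X ω) y₀ =
      fun v => valueAt X T y₀ ω D v (l.countP fun p => decide (p.1 = v)) := by
  induction l using List.reverseRecOn with
  | nil => intro _ _; ext v; rfl
  | append_singleton l p ih =>
    intro l' hl
    obtain ⟨v, i⟩ := p
    have hl1 : l ++ (v, i) :: l' = ringsUpTo ω T := by rw [← hl]; simp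
    rw [List.foldl_append, ih _ hl1]
    have hi : i < (timetable X T y₀ ω).count v :=
      (mem_ringsUpTo (X := X) (y₀ := y₀) hT (v, i)).1 (by rw [← hl1]; simp)
    have hpw := pairwise_ringsUpTo h hT
    rw [← hl1, List.pairwise_append] at hpw
    obtain ⟨-, h2, h3⟩ := hpw
    rw [List.pairwise_cons] at h2
    have hmem : ∀ u k, (u, k) ∈ l ↔ k < (timetable X T y₀ ω).count u ∧
        ringTime (coinsAt ω u) k < ringTime (coinsAt ω v) i := by
      intro u k
      constructor
      · intro hk
        exact ⟨(mem_ringsUpTo (X := X) (y₀ := y₀) hT (u, k)).1 (by rw [← hl1]; simp [hk]), h3 _ hk (v, i) List.mem_cons_self⟩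
      · rintro ⟨hk, hlt⟩
        have := (mem_ringsUpTo (X := X) (y₀ := y₀) hT (u, k)).2 hk
        rw [← hl1, List.mem_append, List.mem_cons] at this
        rcases this with h4 | h4 | h4
        · exact h4
        · obtain ⟨rfl, rfl⟩ := Prod.mk.inj h4
          exact absurd hlt (lt_irrefl _)
        · exact absurd hlt (h2.1 _ h4).not_gt
    have hnd : l.Nodup := by
      have := nodup_ringsUpTo ω T
      rw [← hl1] at this
      exact this.of_append_left
    -- The segment before the ring `(v, i)` contains exactly the rings of `u` that precede it, so
    -- the current configuration is the one to which the recursion applies the filter.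
    have hcount : ∀ u, l.countP (fun p => decide (p.1 = u)) =
        (timetable X T y₀ ω).before u v i := by
      intro u
      rw [countP_fst_eq hnd fun k hk => ((hmem u k).1 hk).1]
      simp only [timetable, if_pos (show i < (node X T y₀ ω v).numUpdates from hi)]
      congr 1
      refine Finset.filter_congr fun k hk => ?_
      rw [hmem]
      exact and_iff_right (Finset.mem_range.1 hk)
    have hself : (timetable X T y₀ ω).before v v i = i := by
      refine le_antisymm ?_ ?_
      · by_contra! hc
        exact lt_irrefl _ ((h.lt_before_iff hi).1 hc)
      · by_contra! hc
        exact lt_irrefl _ ((h.lt_before_iff hi).2 (h.strictMono v hc))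
    ext u
    simp only [List.foldl_cons, List.foldl_nil, metropolisUpdate, hcount, hself,
      List.countP_append, List.countP_singleton]
    rcases eq_or_ne u v with rfl | hu
    · simp only [Function.update_self, decide_true, if_true, hself]
      rw [valueAt_succ u hi, decisionAt_eq h hi]
      simp
    · simp [Function.update_of_ne hu, hu.symm]

theorem chain_eq (h : RegularClocks X T y₀ ω)
    (hT : ∀ p : V × ℕ, ringTime (coinsAt ω p.1) p.2 ≠ T) (v : V) :
    chain X y₀ T ω v = valueAt X T y₀ ω D v ((timetable X T y₀ ω).count v) := by
  rw [chain, foldl_ringsUpTo (D := D) h hT _ [] (List.append_nil _)]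
  beta_reduce
  rw [countP_fst_eq (m := (timetable X T y₀ ω).count v) (nodup_ringsUpTo ω T)
    fun k hk => (mem_ringsUpTo (X := X) (y₀ := y₀) hT (v, k)).1 hk]
  congr 1
  rw [Finset.filter_true_of_mem, Finset.card_range]
  exact fun k hk => (mem_ringsUpTo (X := X) (y₀ := y₀) hT (v, k)).2 (Finset.mem_range.1 hk)

end Network

/-! ### The sizes of the messages -/

theorem length_encodeNat (k : ℕ) : (encodeNat k).length = 2 * k.size + 1 := by
  have : ∀ l : List Bool, (l.flatMap fun b => [true, b]).length = 2 * l.length := by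
    intro l
    induction l with
    | nil => rfl
    | cons b l ih => simp only [List.flatMap_cons, List.length_append, ih, List.length_cons,
        List.length_nil]; ring
  rw [encodeNat, List.length_append, this, ← Nat.size_eq_bits_len]
  rfl

theorem size_mul_log_two_le {k m : ℕ} (h : k ≤ m) :
    (k.size : ℝ) * Real.log 2 ≤ Real.log m + Real.log 2 := by
  have h2 : 0 < Real.log 2 := Real.log_pos one_lt_two
  rcases Nat.eq_zero_or_pos k with rfl | hk
  · simpa using add_nonneg (Real.log_natCast_nonneg m) h2.le
  obtain ⟨s, hs⟩ := Nat.exists_eq_succ_of_ne_zero (Nat.size_pos.2 hk).ne'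
  have h1 : (2 ^ s : ℕ) ≤ m := (Nat.lt_size.1 (by omega)).trans h
  have h3 : Real.log ((2 ^ s : ℕ) : ℝ) ≤ Real.log m :=
    Real.log_le_log (by positivity) (by exact_mod_cast h1)
  rw [Nat.cast_pow, Real.log_pow] at h3
  rw [hs]
  push_cast at h3 ⊢
  linarith

theorem log_add_one_le (m : ℕ) : Real.log ((m + 1 : ℕ) : ℝ) ≤ Real.log m + Real.log 2 := by
  rcases Nat.eq_zero_or_pos m with rfl | hm
  · simpa using Real.log_nonneg one_le_two
  · rw [← Real.log_mul (by positivity) (by norm_num)]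
    refine Real.log_le_log (by positivity) ?_
    have : (1 : ℝ) ≤ m := by exact_mod_cast hm
    push_cast
    linarith

theorem clog_mul_log_two_le {n m : ℕ} (hn : 0 < n) :
    (Nat.clog 2 (n ^ 4 * (m + 1)) : ℝ) * Real.log 2 ≤
      4 * Real.log n + Real.log m + 2 * Real.log 2 := by
  have h2 : 0 < Real.log 2 := Real.log_pos one_lt_two
  have hpos : 0 < n ^ 4 * (m + 1) := by positivity
  have hlog : Real.log ((n ^ 4 * (m + 1) : ℕ) : ℝ) ≤ 4 * Real.log n + Real.log m + Real.log 2 := by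
    rw [Nat.cast_mul, Real.log_mul (by positivity) (by positivity), Nat.cast_pow, Real.log_pow]
    have := log_add_one_le m
    push_cast at this ⊢
    linarith
  rcases Nat.eq_zero_or_pos (Nat.clog 2 (n ^ 4 * (m + 1))) with h0 | h0
  · rw [h0]
    have := Real.log_natCast_nonneg n
    have := Real.log_natCast_nonneg m
    push_cast
    linarith
  obtain ⟨s, hs⟩ := Nat.exists_eq_succ_of_ne_zero h0.ne'
  have h1 : 2 ^ s ≤ n ^ 4 * (m + 1) := by
    by_contra! hc
    have := Nat.clog_le_of_le_pow hc.le
    omega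
  have h3 : Real.log ((2 ^ s : ℕ) : ℝ) ≤ Real.log ((n ^ 4 * (m + 1) : ℕ) : ℝ) :=
    Real.log_le_log (by positivity) (by exact_mod_cast h1)
  rw [Nat.cast_pow, Real.log_pow] at h3
  rw [hs]
  push_cast at h3 hlog ⊢
  linarith

section Network

variable {V : Type*} [Fintype V] {G : SimpleGraph V} {q : ℕ}
  {X : MetropolisChain G q} {T : ℝ} {y₀ : V → Fin q} {ω : V × ℕ → Coins q} {D : Scheduler V}

theorem truncTime_le (h : RegularClocks X T y₀ ω) {u : V} {i : ℕ}
    (hi : i < (timetable X T y₀ ω).count u) :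
    (node X T y₀ ω u).truncTime 0 i ≤ ⌈T⌉₊ * 2 ^ (node X T y₀ ω u).blockLength := by
  refine Nat.floor_le_of_le ?_
  push_cast
  rw [mul_one]
  exact mul_le_mul_of_nonneg_right ((h.lt_count_iff.1 hi).le.trans (Nat.le_ceil T)) (by positivity)

/-- The longest messages are the updates, with `5` control bits and twice the sizes of a time and a
proposal. The time is at most `⌈T⌉ 2^b`, with `b` of order `log n + log ⌈T⌉`. An edge forces `n ≥
2`, so `log 2 ≤ log n` absorbs all constants into `21`; passing from binary to natural logarithms
costs another factor `2`, as `log 2 > 1/2`. -/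
theorem bitLength_message_le (h : RegularClocks X T y₀ ω) {u v : V} (huv : G.Adj u v) (k : ℕ) :
    ((message X T y₀ ω D u v k).bitLength : ℝ) ≤
      42 * (Real.log (Fintype.card V) + Real.log ⌈T⌉₊ + Real.log q) := by
  have h2 : (1 / 2 : ℝ) < Real.log 2 := by linarith [Real.log_two_gt_d9]
  have hn : 1 < Fintype.card V := Fintype.one_lt_card_iff.2 ⟨u, v, huv.ne⟩
  have hn2 : Real.log 2 ≤ Real.log (Fintype.card V) :=
    Real.log_le_log (by norm_num) (by exact_mod_cast hn)
  have hM := Real.log_natCast_nonneg ⌈T⌉₊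
  have hq := Real.log_natCast_nonneg q
  have hb := clog_mul_log_two_le (n := Fintype.card V) (m := ⌈T⌉₊) (by omega)
  have hc : ∀ c : Fin q, ((c : ℕ).size : ℝ) * Real.log 2 ≤ Real.log q + Real.log 2 :=
    fun c => size_mul_log_two_le c.2.le
  set A := Real.log (Fintype.card V) + Real.log ⌈T⌉₊ + Real.log q with hA
  suffices ((message X T y₀ ω D u v k).bitLength : ℝ) * Real.log 2 ≤ 21 * A by
    have h0 : (0 : ℝ) ≤ (message X T y₀ ω D u v k).bitLength := Nat.cast_nonneg _
    nlinarith
  simp only [message]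
  split_ifs with h0 h1 h3 h4
  · simp only [Msg.bitLength, Msg.encode, List.length_append, length_encodeNat, List.length_cons,
      List.length_nil]
    have := hc (y₀ u)
    push_cast
    linarith
  · simp only [Msg.bitLength, Msg.encode, List.length_append, length_encodeNat, List.length_cons,
      List.length_nil]
    have h5 := hc (ω (u, k - 1)).2.1
    have h6 := size_mul_log_two_le (truncTime_le h (u := u) (i := k - 1) (by omega))
    have h7 : Real.log ((⌈T⌉₊ * 2 ^ (node X T y₀ ω u).blockLength : ℕ) : ℝ) ≤
        Real.log ⌈T⌉₊ + Nat.clog 2 (Fintype.card V ^ 4 * (⌈T⌉₊ + 1)) * Real.log 2 := by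
      rcases Nat.eq_zero_or_pos ⌈T⌉₊ with h8 | h8
      · rw [h8]; simp; positivity
      · rw [Nat.cast_mul, Real.log_mul (by positivity) (by positivity), Nat.cast_pow, Real.log_pow]
        rfl
    push_cast at h7 ⊢
    push_cast at h6
    linarith
  · simp only [Msg.bitLength, Msg.encode, List.length_cons, List.length_nil]
    push_cast
    linarith
  · simp only [Msg.bitLength, Msg.encode, List.length_append, length_encodeNat, List.length_cons,
      List.length_nil]
    have h5 : ((node X T y₀ ω u).digitBlock ((k - ((timetable X T y₀ ω).count u + 2)) /
        (timetable X T y₀ ω).count u + 1) ((k - ((timetable X T y₀ ω).count u + 2)) %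
        (timetable X T y₀ ω).count u)).size ≤ Nat.clog 2 (Fintype.card V ^ 4 * (⌈T⌉₊ + 1)) :=
      Nat.size_le.2 ((node X T y₀ ω u).digitBlock_lt _ _)
    have h6 := mul_le_mul_of_nonneg_right (Nat.cast_le (α := ℝ).2 h5)
      (show (0 : ℝ) ≤ Real.log 2 by linarith)
    push_cast
    linarith
  · simp only [Msg.bitLength, Msg.encode, List.length_cons, List.length_nil]
    push_cast
    linarith

end Network

/-! ### Resampling -/

section Resampling

/-- Resampling one coordinate of a random family does not change its law. -/
theorem infinitePi_map_update {ι : Type*} [DecidableEq ι] {Ω : ι → Type*} [∀ i, MeasurableSpace (Ω i)]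
    (μ : ∀ i, Measure (Ω i)) [∀ i, IsProbabilityMeasure (μ i)] (p : ι) :
    ((Measure.infinitePi μ).prod (μ p)).map (fun x => Function.update x.1 p x.2) =
      Measure.infinitePi μ := by
  have hm : Measurable fun x : (∀ i, Ω i) × Ω p => Function.update x.1 p x.2 := by
    refine measurable_pi_lambda _ fun i => ?_
    rcases eq_or_ne i p with rfl | hi
    · simpa using measurable_snd
    · simp only [Function.update_of_ne hi]
      exact (measurable_pi_apply i).comp measurable_fst
  refine Measure.eq_infinitePi μ fun s t ht => ?_
  rw [Measure.map_apply hm (MeasurableSet.pi s.countable_toSet fun i _ => ht i)]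
  have : (fun x : (∀ i, Ω i) × Ω p => Function.update x.1 p x.2) ⁻¹' Set.pi s t =
      Set.pi (s.erase p) t ×ˢ (if p ∈ s then t p else Set.univ) := by
    ext ⟨ω, x⟩
    simp only [Set.mem_preimage, Set.mem_pi, Set.mem_prod, Finset.coe_erase, Finset.mem_coe,
      Set.mem_sdiff, Set.mem_singleton_iff]
    constructor
    · intro h
      refine ⟨fun i hi => by simpa [hi.2] using h i hi.1, ?_⟩
      split_ifs with hp
      · simpa using h p hp
      · trivial
    · rintro ⟨h1, h2⟩ i hi
      rcases eq_or_ne i p with rfl | hip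
      · simpa [hi] using h2
      · simpa [hip] using h1 i ⟨hi, hip⟩
  rw [this, Measure.prod_prod, Measure.infinitePi_pi μ fun i _ => ht i]
  split_ifs with hp
  · rw [mul_comm, Finset.mul_prod_erase s (fun i => μ i (t i)) hp]
  · rw [measure_univ, mul_one, Finset.erase_eq_of_notMem hp]

/-- Valid without measurability: the integral is attained by a measurable minorant, to which the
usual theorem applies. -/
theorem lintegral_prod_le' {α β : Type*} [MeasurableSpace α] [MeasurableSpace β]
    (μ : Measure α) (ν : Measure β) [SFinite ν] (f : α × β → ENNReal) :
    ∫⁻ z, f z ∂μ.prod ν ≤ ∫⁻ x, ∫⁻ y, f (x, y) ∂ν ∂μ := by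
  obtain ⟨g, hg, hgf, he⟩ := exists_measurable_le_lintegral_eq (μ.prod ν) f
  rw [he, lintegral_prod _ hg.aemeasurable]
  exact lintegral_mono fun x => lintegral_mono fun y => hgf _

variable {V : Type*} {G : SimpleGraph V} {q : ℕ} (X : MetropolisChain G q)

theorem lintegral_law_eq (p : V × ℕ) {f : (V × ℕ → Coins q) → ENNReal} (hf : Measurable f) :
    ∫⁻ ω, f ω ∂law X = ∫⁻ ω, ∫⁻ x, f (Function.update ω p x)
      ∂(expMeasure 1).prod ((X.proposal p.1).toMeasure.prod uniformCoin) ∂law X := by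
  have hm : Measurable fun x : (V × ℕ → Coins q) × Coins q => Function.update x.1 p x.2 := by
    refine measurable_pi_lambda _ fun i => ?_
    rcases eq_or_ne i p with rfl | hi
    · simpa using measurable_snd
    · simp only [Function.update_of_ne hi]
      exact (measurable_pi_apply i).comp measurable_fst
  conv_lhs => rw [law, ← infinitePi_map_update _ p]
  rw [lintegral_map hf hm]
  exact lintegral_prod _ (hf.comp hm).aemeasurable

/-- Resample a part of the randomness at `p`. -/
theorem lintegral_law_part_eq (p : V × ℕ) {α β : Type*} [MeasurableSpace α] [MeasurableSpace β]
    {μ : Measure α} {ν : Measure β} [IsProbabilityMeasure μ] [IsProbabilityMeasure ν] (e : α × β ≃ᵐ Coins q)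
    (he : (μ.prod ν).map e =
      (expMeasure 1).prod ((X.proposal p.1).toMeasure.prod uniformCoin))
    {f : (V × ℕ → Coins q) → ENNReal} (hf : Measurable f) :
    ∫⁻ ω, f ω ∂law X =
      ∫⁻ ω, ∫⁻ w, f (Function.update ω p (e (w, (e.symm (ω p)).2))) ∂μ ∂law X := by
  have hm : Measurable fun x : (V × ℕ → Coins q) × α =>
      Function.update x.1 p (e (x.2, (e.symm (x.1 p)).2)) := by
    refine measurable_pi_lambda _ fun i => ?_
    rcases eq_or_ne i p with rfl | hi
    · simp only [Function.update_self]
      exact e.measurable.comp (measurable_snd.prodMk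
        (e.symm.measurable.comp ((measurable_pi_apply i).comp measurable_fst)).snd)
    · simp only [Function.update_of_ne hi]
      exact (measurable_pi_apply i).comp measurable_fst
  have hg : Measurable fun ω : V × ℕ → Coins q =>
      ∫⁻ w, f (Function.update ω p (e (w, (e.symm (ω p)).2))) ∂μ :=
    (hf.comp hm).lintegral_prod_right'
  -- Both sides are compared after resampling everything at `p`. The part of it that `w` overwrites
  -- then integrates to `1`.
  rw [lintegral_law_eq X p hf, lintegral_law_eq X p hg, ← he]
  refine lintegral_congr fun ω => ?_
  have hu : Measurable fun x : Coins q => f (Function.update ω p x) :=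
    hf.comp (measurable_update ω)
  have hF : Measurable fun z : α × β => f (Function.update ω p (e z)) := hu.comp e.measurable
  have hG : Measurable fun x : Coins q => ∫⁻ w, f (Function.update (Function.update ω p x) p
      (e (w, (e.symm (Function.update ω p x p)).2))) ∂μ := hg.comp (measurable_update ω)
  rw [lintegral_map hu e.measurable, lintegral_map hG e.measurable]
  simp only [Function.update_self, Function.update_idem, MeasurableEquiv.symm_apply_apply]
  have hH : Measurable fun y : β => ∫⁻ w, f (Function.update ω p (e (w, y))) ∂μ :=
    hF.lintegral_prod_left'
  rw [lintegral_prod_symm _ hF.aemeasurable]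
  refine Eq.trans ?_ (lintegral_prod_symm (fun z : α × β =>
    ∫⁻ w, f (Function.update ω p (e (w, z.2))) ∂μ) (hH.comp measurable_snd).aemeasurable).symm
  refine lintegral_congr fun y => ?_
  simp only [lintegral_const, measure_univ, mul_one]

/-- Resample the waiting time at `p`. -/
theorem lintegral_law_wait_eq (p : V × ℕ) {f : (V × ℕ → Coins q) → ENNReal} (hf : Measurable f) :
    ∫⁻ ω, f ω ∂law X =
      ∫⁻ ω, ∫⁻ w, f (Function.update ω p (w, (ω p).2)) ∂expMeasure 1 ∂law X :=
  lintegral_law_part_eq X p (MeasurableEquiv.refl _) Measure.map_id hf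

/-- Resample the proposal and the coin at `p`. -/
theorem lintegral_law_coin_le (p : V × ℕ) (f : (V × ℕ → Coins q) → ENNReal) :
    ∫⁻ ω, f ω ∂law X ≤ ∫⁻ ω, ∫⁻ y, f (Function.update ω p ((ω p).1, y))
      ∂(X.proposal p.1).toMeasure.prod uniformCoin ∂law X := by
  -- A measurable minorant with the same integral allows for arbitrary `f`, at the price of an
  -- inequality.
  obtain ⟨g, hg, hgf, he⟩ := exists_measurable_le_lintegral_eq (law X) f
  rw [he, lintegral_law_part_eq X p MeasurableEquiv.prodComm Measure.prod_swap hg]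
  exact lintegral_mono fun x => lintegral_mono fun y => hgf _

theorem ae_law_apply {P : Coins q → Prop} (p : V × ℕ)
    (h : ∀ᵐ x ∂(expMeasure 1).prod ((X.proposal p.1).toMeasure.prod uniformCoin), P x) :
    ∀ᵐ ω ∂law X, P (ω p) :=
  (measurePreserving_eval_infinitePi (fun p : V × ℕ => (expMeasure 1).prod
    ((X.proposal p.1).toMeasure.prod uniformCoin)) p).quasiMeasurePreserving.ae h

instance : IsProbabilityMeasure (law X) := by rw [law]; infer_instance

end Resampling

/-! ### Exponential waiting times -/

section Exponential

open Set Real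

theorem lintegral_expMeasure {f : ℝ → ENNReal} (hf : Measurable f) :
    ∫⁻ w, f w ∂expMeasure 1 = ∫⁻ w in Ioi 0, ENNReal.ofReal (exp (-w)) * f w := by
  have : expMeasure 1 = volume.withDensity (exponentialPDF 1) := rfl
  have hm : Measurable (exponentialPDF 1) := (measurable_exponentialPDFReal 1).ennreal_ofReal
  rw [this, lintegral_withDensity_eq_lintegral_mul _ hm hf, ← lintegral_indicator measurableSet_Ioi]
  refine lintegral_congr_ae ?_
  filter_upwards [compl_mem_ae_iff.2 (Real.volume_singleton (a := 0))] with w hw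
  rcases lt_or_gt_of_ne (show w ≠ 0 from hw) with h | h
  · simp [exponentialPDF_of_neg h, h.not_gt]
  · simp [exponentialPDF_of_nonneg h.le, h]

theorem lintegral_exp_Ioi {c : ℝ} (hc : 0 < c) (r : ℝ) :
    ∫⁻ w in Ioi r, ENNReal.ofReal (exp (-(c * w))) = ENNReal.ofReal (exp (-(c * r)) / c) := by
  have hneg : -c < 0 := neg_lt_zero.2 hc
  have h := integral_exp_mul_Ioi hneg r
  rw [← ofReal_integral_eq_lintegral_ofReal]
  · congr 1
    simp only [neg_mul] at h
    rw [h]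
    field_simp
  · simp only [← neg_mul]
    exact integrableOn_exp_mul_Ioi hneg r
  · exact Filter.Eventually.of_forall fun x => (exp_pos _).le

/-- The weight `e ^ (-λ (t - s))` of a moment `t` after `s`. -/
def discount (c s t : ℝ) : ENNReal := if s < t then ENNReal.ofReal (exp (-(c * (t - s)))) else 0

theorem expMeasure_Iic_zero : expMeasure 1 (Iic 0) = 0 := by
  rw [← lintegral_indicator_one measurableSet_Iic,
    lintegral_expMeasure (measurable_one.indicator measurableSet_Iic),
    setLIntegral_congr_fun (g := 0) measurableSet_Ioi fun w hw => ?_]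
  · simp
  · simp [(show (0 : ℝ) < w from hw)]

theorem expMeasure_Ioi {r : ℝ} (hr : 0 ≤ r) : expMeasure 1 (Ioi r) = ENNReal.ofReal (exp (-r)) := by
  rw [← lintegral_indicator_one measurableSet_Ioi,
    lintegral_expMeasure (measurable_one.indicator measurableSet_Ioi)]
  have h : ∀ w, ENNReal.ofReal (exp (-w)) * (Ioi r).indicator 1 w =
      (Ioi r).indicator (fun w => ENNReal.ofReal (exp (-(1 * w)))) w := by
    intro w
    by_cases hw : w ∈ Ioi r <;> simp [hw]
  simp only [h]
  rw [setLIntegral_indicator measurableSet_Ioi, inter_eq_left.2 (Ioi_subset_Ioi hr),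
    lintegral_exp_Ioi one_pos]
  simp

theorem measurable_discount {α : Type*} [MeasurableSpace α] {c : ℝ} {s t : α → ℝ}
    (hs : Measurable s) (ht : Measurable t) : Measurable fun x => discount c (s x) (t x) :=
  Measurable.ite (measurableSet_lt hs ht) (by fun_prop) measurable_const

/-- If `r < 0` the discount at `0` is multiplied by the Laplace transform `1/(1 + c)` of the waiting
time. If `r ≥ 0`, then by lack of memory the waiting time restarts at `r`, given that it exceeds
`r`. -/
theorem lintegral_discount_le {c : ℝ} (hc : 0 < c) (r : ℝ) :
    ∫⁻ w, discount c r w ∂expMeasure 1 ≤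
      (ENNReal.ofReal (1 + c))⁻¹ *
        (discount c r 0 + if 0 ≤ r then expMeasure 1 (Ioi r) else 0) := by
  have hc1 : 0 < 1 + c := by linarith
  rw [lintegral_expMeasure (measurable_discount measurable_const measurable_id')]
  have h : ∀ w, ENNReal.ofReal (exp (-w)) * discount c r w = (Ioi r).indicator
      (fun w => ENNReal.ofReal (exp (c * r)) * ENNReal.ofReal (exp (-((1 + c) * w)))) w := by
    intro w
    by_cases hw : r < w
    · rw [discount, if_pos hw, indicator_of_mem (mem_Ioi.2 hw), ← ENNReal.ofReal_mul (exp_pos _).le,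
        ← ENNReal.ofReal_mul (exp_pos _).le, ← exp_add, ← exp_add]
      congr 2; ring
    · rw [discount, if_neg hw, indicator_of_notMem (mt mem_Ioi.1 hw), mul_zero]
  simp only [h]
  rw [setLIntegral_indicator measurableSet_Ioi, Ioi_inter_Ioi,
    lintegral_const_mul _ (by fun_prop), lintegral_exp_Ioi hc1, ← ENNReal.ofReal_mul (exp_pos _).le,
    ← ENNReal.ofReal_inv_of_pos hc1]
  rcases le_or_gt 0 r with hr | hr
  · rw [discount, if_neg hr.not_gt, if_pos hr, expMeasure_Ioi hr, zero_add,
      ← ENNReal.ofReal_mul (by positivity), max_eq_left hr, ← mul_div_assoc, ← exp_add]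
    apply le_of_eq
    rw [div_eq_inv_mul]
    congr 3; ring
  · rw [discount, if_pos hr, if_neg hr.not_ge, add_zero, ← ENNReal.ofReal_mul (by positivity),
      max_eq_right hr.le]
    apply le_of_eq
    congr 1
    simp [div_eq_inv_mul, mul_comm]

end Exponential

/-! ### Sums over the rings of a clock -/

section Campbell

variable {V : Type*} {G : SimpleGraph V} {q : ℕ} (X : MetropolisChain G q)

/-- The moment of the ring that precedes the `i`-th ring, or `0`. -/
def priorTime (r : ℕ → Coins q) (i : ℕ) : ℝ := ∑ k ∈ Finset.range i, (r k).1

theorem priorTime_succ (r : ℕ → Coins q) (i : ℕ) : priorTime r (i + 1) = ringTime r i := rfl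

theorem ringTime_eq (r : ℕ → Coins q) (i : ℕ) : ringTime r i = priorTime r i + (r i).1 := by
  rw [ringTime, Finset.sum_range_succ]; rfl

theorem measurable_priorTime (v : V) (i : ℕ) :
    Measurable fun ω : V × ℕ → Coins q => priorTime (coinsAt ω v) i :=
  Finset.measurable_sum _ fun k _ => (measurable_pi_apply (v, k)).fst

theorem measurable_ringTime (v : V) (i : ℕ) :
    Measurable fun ω : V × ℕ → Coins q => ringTime (coinsAt ω v) i := measurable_priorTime v (i + 1)

theorem priorTime_update (ω : V × ℕ → Coins q) {v w : V} {i k : ℕ} (h : w = v → k ≤ i)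
    (x : Coins q) : priorTime (coinsAt (Function.update ω (v, i) x) w) k =
      priorTime (coinsAt ω w) k := by
  refine Finset.sum_congr rfl fun j hj => ?_
  rw [coinsAt, Function.update_of_ne]
  · rfl
  · intro he
    obtain ⟨rfl, rfl⟩ := Prod.mk.inj he
    have := h rfl
    have := Finset.mem_range.1 hj
    omega

theorem ringTime_update (ω : V × ℕ → Coins q) {v w : V} {i k : ℕ} (h : w = v → k < i)
    (x : Coins q) : ringTime (coinsAt (Function.update ω (v, i) x) w) k =
      ringTime (coinsAt ω w) k := priorTime_update ω h x

theorem ringTime_update_self (ω : V × ℕ → Coins q) (v : V) (i : ℕ) (x : Coins q) :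
    ringTime (coinsAt (Function.update ω (v, i) x) v) i = priorTime (coinsAt ω v) i + x.1 := by
  rw [ringTime_eq, priorTime_update ω fun _ => le_rfl]
  simp [coinsAt]

theorem ae_wait_pos [Countable V] : ∀ᵐ ω ∂law X, ∀ p, 0 < (ω p).1 := by
  refine ae_all_iff.2 fun p => ae_law_apply X (P := fun x => 0 < x.1) p ?_
  have : ∀ᵐ w ∂expMeasure 1, 0 < w := by
    rw [ae_iff]
    simpa [Set.Iic] using expMeasure_Iic_zero
  exact Measure.quasiMeasurePreserving_fst.ae this

variable {X}
variable {g : (V × ℕ → Coins q) → ENNReal} {s : (V × ℕ → Coins q) → ℝ} {c : ℝ} {v : V}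

/-- Changing the waiting time at `p` does not change `f`. -/
def WaitFree {α : Type*} (p : V × ℕ) (f : (V × ℕ → Coins q) → α) : Prop :=
  ∀ ω w, f (Function.update ω p (w, (ω p).2)) = f ω

theorem discount_sub (c s t w : ℝ) : discount c s (t + w) = discount c (s - t) w := by
  simp only [discount, sub_lt_iff_lt_add']
  congr 4; ring

/-- One step from a ring to the next: the new discount is at most `1/(1 + c)` times the old one plus
the chance that `s` lies in the gap. Averaging over the `i`-th waiting time is legitimate if `g` and
`s` do not depend on it; the other alternative covers rings that cannot follow `s` where `g` is
nonzero. -/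
theorem lintegral_discount_ringTime_le (hc : 0 < c) (hg : Measurable g) (hs : Measurable s) {i : ℕ}
    (h : (∀ᵐ ω ∂law X, s ω < ringTime (coinsAt ω v) i → g ω = 0) ∨
      WaitFree (v, i) g ∧ WaitFree (v, i) s) :
    ∫⁻ ω, g ω * discount c (s ω) (ringTime (coinsAt ω v) i) ∂law X ≤
      (ENNReal.ofReal (1 + c))⁻¹ *
        (∫⁻ ω, g ω * discount c (s ω) (priorTime (coinsAt ω v) i) ∂law X +
          ∫⁻ ω, g ω * (if priorTime (coinsAt ω v) i ≤ s ω ∧ s ω < ringTime (coinsAt ω v) i then 1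
            else 0) ∂law X) := by
  rcases h with h | ⟨h1, h2⟩
  · rw [lintegral_congr_ae (g := 0)]
    · simp
    · filter_upwards [h] with ω hω
      by_cases hlt : s ω < ringTime (coinsAt ω v) i
      · simp [hω hlt]
      · simp [discount, hlt]
  have mp := measurable_priorTime (q := q) v i
  have mr := measurable_ringTime (q := q) v i
  have mi : Measurable fun ω : V × ℕ → Coins q => (if priorTime (coinsAt ω v) i ≤ s ω ∧
      s ω < ringTime (coinsAt ω v) i then 1 else 0 : ENNReal) :=
    Measurable.ite ((measurableSet_le mp hs).inter (measurableSet_lt hs mr)) measurable_const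
      measurable_const
  have m1 : Measurable fun ω : V × ℕ → Coins q =>
    g ω * discount c (s ω) (ringTime (coinsAt ω v) i) := hg.mul (measurable_discount hs mr)
  have m2 : Measurable fun ω : V × ℕ → Coins q => g ω * (if priorTime (coinsAt ω v) i ≤ s ω ∧
      s ω < ringTime (coinsAt ω v) i then 1 else 0) := hg.mul mi
  have m3 : Measurable fun ω : V × ℕ → Coins q =>
    g ω * discount c (s ω) (priorTime (coinsAt ω v) i) := hg.mul (measurable_discount hs mp)
  rw [lintegral_law_wait_eq X (v, i) m1, lintegral_law_wait_eq X (v, i) m2,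
    ← lintegral_add_left m3, ← lintegral_const_mul' _ _ (by simp; linarith)]
  refine lintegral_mono fun ω => ?_
  simp only [h1 ω, h2 ω, ringTime_update_self, priorTime_update ω fun _ => le_refl i]
  rw [lintegral_const_mul _ (measurable_discount measurable_const (by fun_prop)),
    lintegral_const_mul _ (Measurable.ite (by measurability) measurable_const measurable_const),
    ← mul_add, mul_left_comm]
  gcongr
  simp only [discount_sub]
  refine (lintegral_discount_le hc _).trans ?_
  rw [← discount_sub, add_zero]
  gcongr
  split_ifs with h0
  · rw [← lintegral_indicator_one measurableSet_Ioi]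
    refine lintegral_mono fun w => ?_
    simp only [Set.indicator_apply, Set.mem_Ioi, sub_nonneg.1 h0, true_and, sub_lt_iff_lt_add']
    rfl
  · exact zero_le

/-- The discounted number of rings of a clock after a moment `s` at which it is restarted. -/
theorem tsum_lintegral_discount_le [Countable V] (hc : 0 < c) (hg : Measurable g)
    (hs : Measurable s) (h0 : ∀ᵐ ω ∂law X, 0 ≤ s ω)
    (h : ∀ i, (∀ᵐ ω ∂law X, s ω < ringTime (coinsAt ω v) i → g ω = 0) ∨
      WaitFree (v, i) g ∧ WaitFree (v, i) s) :
    ∑' i, ∫⁻ ω, g ω * discount c (s ω) (ringTime (coinsAt ω v) i) ∂law X ≤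
      (ENNReal.ofReal c)⁻¹ * ∫⁻ ω, g ω ∂law X := by
  rcases eq_or_ne (∫⁻ ω, g ω ∂law X) ⊤ with htop | htop
  · rw [htop, ENNReal.mul_top (by simp)]
    exact le_top
  set z : ℕ → ENNReal := fun i =>
    ∫⁻ ω, g ω * discount c (s ω) (priorTime (coinsAt ω v) i) ∂law X with hz
  set e : ℕ → ENNReal := fun i => ∫⁻ ω, g ω * (if priorTime (coinsAt ω v) i ≤ s ω ∧
    s ω < ringTime (coinsAt ω v) i then 1 else 0) ∂law X with he
  have hstep : ∀ i, z (i + 1) ≤ (ENNReal.ofReal (1 + c))⁻¹ * (z i + e i) := fun i =>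
    lintegral_discount_ringTime_le hc hg hs (h i)
  have hz0 : z 0 = 0 := by
    simp only [hz]
    rw [lintegral_congr_ae (g := 0)]
    · simp
    · filter_upwards [h0] with ω hω
      simp [discount, priorTime, hω.not_gt]
  have hesum : ∀ n, ∑ i ∈ Finset.range n, e i ≤ ∫⁻ ω, g ω ∂law X := by
    intro n
    have mi : ∀ i, Measurable fun ω : V × ℕ → Coins q => (if priorTime (coinsAt ω v) i ≤ s ω ∧
        s ω < ringTime (coinsAt ω v) i then 1 else 0 : ENNReal) := fun i =>
      Measurable.ite ((measurableSet_le (measurable_priorTime v i) hs).inter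
        (measurableSet_lt hs (measurable_ringTime v i))) measurable_const measurable_const
    have m2 : ∀ i, Measurable fun ω : V × ℕ → Coins q => g ω * (if priorTime (coinsAt ω v) i ≤ s ω ∧
        s ω < ringTime (coinsAt ω v) i then 1 else 0) := fun i => hg.mul (mi i)
    rw [← lintegral_finsetSum _ fun i _ => m2 i]
    refine lintegral_mono_ae ?_
    filter_upwards [ae_wait_pos X, h0] with ω hω hsω
    rw [← Finset.mul_sum]
    -- The gaps between successive rings are disjoint, so `s` lies in at most one of them.
    suffices ∑ i ∈ Finset.range n, (if priorTime (coinsAt ω v) i ≤ s ω ∧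
        s ω < ringTime (coinsAt ω v) i then 1 else 0 : ENNReal) ≤
        if s ω < priorTime (coinsAt ω v) n then 1 else 0 by
      calc _ ≤ g ω * 1 := by
            gcongr
            exact this.trans (by split_ifs <;> simp)
        _ = _ := mul_one _
    induction n with
    | zero => simp
    | succ n ih =>
      rw [Finset.sum_range_succ, priorTime_succ]
      have hlt : priorTime (coinsAt ω v) n < ringTime (coinsAt ω v) n := by
        rw [ringTime_eq]; linarith [hω (v, n), show (coinsAt ω v n).1 = (ω (v, n)).1 from rfl]
      refine (add_le_add_left ih _).trans ?_
      by_cases h1 : s ω < priorTime (coinsAt ω v) n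
      · simp [h1, h1.trans hlt, h1.not_ge]
      · simp [h1, not_lt.1 h1]
  have hzle : ∀ i, z i ≤ ∫⁻ ω, g ω ∂law X := fun i => by
    refine lintegral_mono fun ω => ?_
    calc g ω * discount c (s ω) (priorTime (coinsAt ω v) i) ≤ g ω * 1 := by
          gcongr
          rw [discount]
          split_ifs with hlt
          · rw [ENNReal.ofReal_le_one, Real.exp_le_one_iff, neg_nonpos]
            exact mul_nonneg hc.le (sub_pos.2 hlt).le
          · exact zero_le
      _ = g ω := mul_one _
  rw [ENNReal.tsum_eq_iSup_nat]
  refine iSup_le fun n => ?_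
  change ∑ i ∈ Finset.range n, z (i + 1) ≤ _
  set S := ∑ i ∈ Finset.range n, z (i + 1) with hS
  have hSfin : S ≠ ⊤ := ENNReal.sum_ne_top.2 fun i _ => ne_top_of_le_ne_top htop (hzle _)
  have hz1 : ∑ i ∈ Finset.range n, z i ≤ S := by
    rw [hS]
    cases n with
    | zero => simp
    | succ n =>
      rw [Finset.sum_range_succ', hz0, add_zero, Finset.sum_range_succ (fun i => z (i + 1))]
      exact le_self_add
  -- Summing the one-step inequality gives `(1 + c) S ≤ S + ∫ g`. Since `S` is finite it cancels,
  -- leaving `c S ≤ ∫ g`.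
  have h1 : S ≤ (ENNReal.ofReal (1 + c))⁻¹ * (S + ∫⁻ ω, g ω ∂law X) := by
    calc S ≤ ∑ i ∈ Finset.range n, (ENNReal.ofReal (1 + c))⁻¹ * (z i + e i) :=
          Finset.sum_le_sum fun i _ => hstep i
      _ = (ENNReal.ofReal (1 + c))⁻¹ *
          (∑ i ∈ Finset.range n, z i + ∑ i ∈ Finset.range n, e i) := by
          rw [← Finset.mul_sum, Finset.sum_add_distrib]
      _ ≤ _ := by gcongr; exact hesum n
  have hc1 : ENNReal.ofReal (1 + c) ≠ 0 := by simp; linarith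
  rw [← ENNReal.mul_le_iff_le_inv hc1 ENNReal.ofReal_ne_top, ENNReal.ofReal_add one_pos.le hc.le,
    ENNReal.ofReal_one, add_mul, one_mul] at h1
  have h2 := (ENNReal.add_le_add_iff_left hSfin).1 h1
  rwa [ENNReal.mul_le_iff_le_inv (by simpa using hc) ENNReal.ofReal_ne_top] at h2

end Campbell

/-! ### Measurability -/

section Measurability

variable {Ω : Type*} [MeasurableSpace Ω]

/-- A positive value means that the set is one of countably many finite sets. The value `0` also
occurs for infinite sets and is treated as the complement. -/
theorem measurable_ncard {P : ℕ → Ω → Prop} (h : ∀ i, Measurable (P i)) :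
    Measurable fun ω => {i | P i ω}.ncard := by
  have hF : ∀ n, n ≠ 0 → MeasurableSet ((fun ω => {i | P i ω}.ncard) ⁻¹' {n}) := by
    intro n hn
    have : (fun ω => {i | P i ω}.ncard) ⁻¹' {n} =
        ⋃ F : Finset ℕ, {ω | F.card = n ∧ ∀ i, P i ω ↔ i ∈ F} := by
      ext ω
      simp only [Set.mem_preimage, Set.mem_singleton_iff, Set.mem_iUnion, Set.mem_ofPred_eq]
      constructor
      · intro hc
        have hfin := Set.finite_of_ncard_ne_zero (hc ▸ hn)
        refine ⟨hfin.toFinset, ?_, fun i => by simp⟩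
        rw [← hc, Set.ncard_eq_toFinset_card _ hfin]
      · rintro ⟨F, hF, hi⟩
        rw [show {i | P i ω} = (F : Set ℕ) from Set.ext hi, Set.ncard_coe_finset, hF]
    rw [this]
    exact MeasurableSet.iUnion fun F => measurableSet_setOfPred.2
      (measurable_const.and (Measurable.forall fun i => (h i).iff measurable_const))
  refine measurable_to_countable' fun n => ?_
  rcases eq_or_ne n 0 with rfl | hn
  · have : (fun ω => {i | P i ω}.ncard) ⁻¹' {0} =
        (⋃ n : ℕ, (fun ω => {i | P i ω}.ncard) ⁻¹' {n + 1})ᶜ := by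
      ext ω
      simp only [Set.mem_preimage, Set.mem_singleton_iff, Set.mem_compl_iff, Set.mem_iUnion,
        not_exists]
      exact ⟨fun h k => by omega, fun h => by_contra fun h0 => h _ (Nat.succ_pred h0).symm⟩
    rw [this]
    exact (MeasurableSet.iUnion fun n => hF _ n.succ_ne_zero).compl
  · exact hF n hn

theorem measurable_sInf_nat {P : ℕ → Ω → Prop} (h : ∀ i, Measurable (P i)) :
    Measurable fun ω => sInf {i | P i ω} := by
  refine measurable_to_countable' fun n => ?_
  have : (fun ω => sInf {i | P i ω}) ⁻¹' {n} =
      {ω | (P n ω ∧ ∀ m, m < n → ¬ P m ω) ∨ (n = 0 ∧ ∀ m, ¬ P m ω)} := by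
    ext ω
    simp only [Set.mem_preimage, Set.mem_singleton_iff, Set.mem_ofPred_eq]
    constructor
    · rintro rfl
      rcases Set.eq_empty_or_nonempty {i | P i ω} with he | he
      · exact Or.inr ⟨by rw [he, Nat.sInf_empty], fun m hm => (he ▸ hm : m ∈ (∅ : Set ℕ))⟩
      · exact Or.inl ⟨Nat.sInf_mem he, fun m hm => Nat.notMem_of_lt_sInf hm⟩
    · rintro (⟨h1, h2⟩ | ⟨rfl, h2⟩)
      · refine le_antisymm (Nat.sInf_le h1) ?_
        by_contra! hc
        exact h2 _ hc (Nat.sInf_mem (s := {i | P i ω}) ⟨n, h1⟩)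
      · exact Nat.sInf_eq_zero.2 (Or.inr (Set.eq_empty_of_forall_notMem h2))
  rw [this]
  exact measurableSet_setOfPred.2 (((h n).and (Measurable.forall fun m =>
    measurable_const.imp (h m).not)).or (measurable_const.and (Measurable.forall fun m => (h m).not)))

theorem measurable_comp_countable {α β : Type*} [MeasurableSpace α] [MeasurableSingletonClass α]
    [Countable α] [MeasurableSpace β] {N : Ω → α} {H : α → Ω → β} (hN : Measurable N)
    (hH : ∀ n, Measurable (H n)) : Measurable fun ω => H (N ω) ω :=
  (measurable_from_prod_countable_right (f := fun x : α × Ω => H x.1 x.2) hH).comp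
    (hN.prodMk measurable_id)

theorem measurable_prop_lt {f g : Ω → ℝ} (hf : Measurable f) (hg : Measurable g) :
    Measurable fun ω => f ω < g ω := measurableSet_setOfPred.1 (measurableSet_lt hf hg)

theorem measurable_prop_eq {β : Type*} [MeasurableSpace β] [MeasurableSingletonClass β]
    {f : Ω → β} (hf : Measurable f) (b : β) : Measurable fun ω => f ω = b :=
  measurableSet_setOfPred.1 (hf (measurableSet_singleton b))

end Measurability

/-! ### Measurability of the timetable. -/

section Network

variable {V : Type*} [Fintype V] {G : SimpleGraph V} {q : ℕ}
  (X : MetropolisChain G q) (T : ℝ) (y₀ : V → Fin q)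

theorem measurable_numUpdates (v : V) : Measurable fun ω => (node X T y₀ ω v).numUpdates :=
  measurable_ncard fun i => measurable_prop_lt (measurable_ringTime v i) measurable_const

theorem measurable_truncTime (v : V) (ℓ i : ℕ) :
    Measurable fun ω => (node X T y₀ ω v).truncTime ℓ i := by
  have h := (measurable_ringTime (q := q) v i).mul_const
    (2 ^ (Nat.clog 2 (Fintype.card V ^ 4 * (⌈T⌉₊ + 1)) * (ℓ + 1)) : ℝ)
  exact Nat.measurable_floor.comp h

theorem measurable_coincide (u v : V) (ℓ : ℕ) :
    Measurable fun ω => Coincide X T y₀ ω u v ℓ := by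
  have hlt : ∀ (w : V) (i : ℕ), Measurable fun ω => i < (node X T y₀ ω w).numUpdates := fun w i =>
    measurableSet_setOfPred.1 (measurable_numUpdates X T y₀ w measurableSet_Ioi)
  refine Measurable.exists fun i => (hlt u i).and (Measurable.exists fun k => (hlt v k).and ?_)
  exact measurableSet_setOfPred.1 (measurableSet_eq_fun (measurable_truncTime X T y₀ u ℓ i)
    (measurable_truncTime X T y₀ v ℓ k))

theorem measurable_depth (u v : V) : Measurable fun ω => (timetable X T y₀ ω).depth u v :=
  measurable_sInf_nat fun ℓ => (measurable_coincide X T y₀ u v ℓ).not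

theorem measurable_before (u v : V) (i : ℕ) :
    Measurable fun ω => (timetable X T y₀ ω).before u v i := by
  have h : ∀ m, Measurable fun ω : V × ℕ → Coins q => ((Finset.range m).filter fun k =>
      ringTime (coinsAt ω u) k < ringTime (coinsAt ω v) i).card := by
    intro m
    simp only [Finset.card_filter]
    exact Finset.measurable_sum _ fun k _ => Measurable.ite
      (measurableSet_lt (measurable_ringTime u k) (measurable_ringTime v i)) measurable_const
      measurable_const
  exact Measurable.ite (measurable_numUpdates X T y₀ v measurableSet_Ioi)
    (measurable_comp_countable (measurable_numUpdates X T y₀ u) h) measurable_const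

theorem measurable_proposal (v : V) (i : ℕ) :
    Measurable fun ω => (timetable X T y₀ ω).proposal v i :=
  Measurable.ite (measurable_numUpdates X T y₀ v measurableSet_Ioi)
    (measurable_pi_apply (v, i)).snd.fst measurable_const

theorem measurable_accepts (v : V) (i : ℕ) (c : Fin q) (τ : V → Fin q) :
    Measurable fun ω => (timetable X T y₀ ω).accepts v i c τ := by
  refine Measurable.ite (measurable_numUpdates X T y₀ v measurableSet_Ioi) ?_ measurable_const
  have h : Measurable fun ω : V × ℕ → Coins q => (ω (v, i)).2.2 <
      (X.filter v c (ω (v, i)).2.1 (fun u => τ u) : ℝ) :=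
    measurable_prop_lt (measurable_pi_apply (v, i)).snd.snd
      (Measurable.comp (g := fun c' => (X.filter v c c' (fun u => τ u) : ℝ))
        (measurable_of_finite _) (measurable_pi_apply (v, i)).snd.fst)
  exact Measurable.comp (g := fun p : Prop => decide p) (by fun_prop) h

theorem eq_of_map_range_eq {β : Type*} {f g : ℕ → β} (b : β) {m n : ℕ}
    (h : (List.range m).map f = (List.range n).map g) (hf : ∀ i, ¬ i < m → f i = b)
    (hg : ∀ i, ¬ i < n → g i = b) : f = g := by
  have hmn : m = n := by simpa using congrArg List.length h
  subst hmn
  ext1 i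
  by_cases hi : i < m
  · exact List.map_inj_left.1 h i (List.mem_range.2 hi)
  · rw [hf i hi, hg i hi]

/-- There are finitely many nodes and finitely many updates, and all entries beyond them are
constant. So a timetable is encoded by lists over countable types. -/
theorem countable_range_timetable : (Set.range (timetable X T y₀)).Countable := by
  let code : Timetable V q → (V → ℕ) × (V → V → ℕ) × (V → V → List ℕ) × (V → List (Fin q)) ×
      (V → List (Fin q → (V → Fin q) → Bool)) := fun S =>
    (S.count, S.depth, fun u v => (List.range (S.count v)).map (S.before u v),
      fun v => (List.range (S.count v)).map (S.proposal v),
      fun v => (List.range (S.count v)).map (S.accepts v))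
  refine Set.countable_of_injective_of_countable_image (f := code) ?_ (Set.to_countable _)
  rintro _ ⟨ω, rfl⟩ _ ⟨ω', rfl⟩ he
  simp only [code, Prod.mk.injEq] at he
  obtain ⟨h1, h2, h3, h4, h5⟩ := he
  have hb : (timetable X T y₀ ω).before = (timetable X T y₀ ω').before := by
    ext1 u; ext1 v
    exact eq_of_map_range_eq 0 (congrFun (congrFun h3 u) v) (fun i hi => if_neg hi)
      fun i hi => if_neg hi
  have hp : (timetable X T y₀ ω).proposal = (timetable X T y₀ ω').proposal := by
    ext1 v
    exact eq_of_map_range_eq (y₀ v) (congrFun h4 v) (fun i hi => if_neg hi)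
      fun i hi => if_neg hi
  have ha : (timetable X T y₀ ω).accepts = (timetable X T y₀ ω').accepts := by
    ext1 v
    refine eq_of_map_range_eq (fun _ _ => false) (congrFun h5 v) (fun i hi => ?_) fun i hi => ?_ <;>
    · ext c τ; exact if_neg hi
  generalize timetable X T y₀ ω = S at *
  generalize timetable X T y₀ ω' = S' at *
  cases S; cases S'
  simp_all

/-- All events that depend only on the timetable are measurable. -/
theorem measurableSet_timetable (s : Set (Timetable V q)) :
    MeasurableSet {ω | timetable X T y₀ ω ∈ s} := by
  have : {ω | timetable X T y₀ ω ∈ s} =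
      ⋃ S ∈ Set.range (timetable X T y₀) ∩ s, {ω | timetable X T y₀ ω = S} := by
    ext ω; simp
  rw [this]
  refine MeasurableSet.biUnion ((countable_range_timetable X T y₀).mono Set.inter_subset_left)
    fun S _ => ?_
  have : {ω | timetable X T y₀ ω = S} = {ω | (∀ v, (timetable X T y₀ ω).count v = S.count v) ∧
      (∀ u v, (timetable X T y₀ ω).depth u v = S.depth u v) ∧
      (∀ u v i, (timetable X T y₀ ω).before u v i = S.before u v i) ∧
      (∀ v i, (timetable X T y₀ ω).proposal v i = S.proposal v i) ∧
      ∀ v i c τ, (timetable X T y₀ ω).accepts v i c τ = S.accepts v i c τ} := by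
    ext ω
    simp only [Set.mem_ofPred_eq]
    constructor
    · rintro rfl; simp
    · rintro ⟨h1, h2, h3, h4, h5⟩
      generalize timetable X T y₀ ω = S' at *
      cases S; cases S'
      simp only [Timetable.mk.injEq]
      exact ⟨funext h1, funext₂ h2, funext₃ h3, funext₂ h4,
        funext fun v => funext fun i => funext fun c => funext fun τ => h5 v i c τ⟩
  rw [this, measurableSet_setOfPred]
  refine Measurable.and (Measurable.forall fun v =>
    measurable_prop_eq (measurable_numUpdates X T y₀ v) _) (Measurable.and
    (Measurable.forall fun u => Measurable.forall fun v =>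
      measurable_prop_eq (measurable_depth X T y₀ u v) _) (Measurable.and
    (Measurable.forall fun u => Measurable.forall fun v => Measurable.forall fun i =>
      measurable_prop_eq (measurable_before X T y₀ u v i) _) (Measurable.and
    (Measurable.forall fun v => Measurable.forall fun i =>
      measurable_prop_eq (measurable_proposal X T y₀ v i) _)
    (Measurable.forall fun v => Measurable.forall fun i => Measurable.forall fun c =>
      Measurable.forall fun τ => measurable_prop_eq (measurable_accepts X T y₀ v i c τ) _))))

end Network

/-! ### The clocks are almost surely in general position -/

section GeneralPosition

/-- Used as an exponential Markov inequality: it bounds the indicator of a short time window by a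
multiple of the discount. -/
theorem one_le_mul_discount {c s t k : ℝ} (h : s < t) (hk : c * (t - s) ≤ k) :
    1 ≤ ENNReal.ofReal (Real.exp k) * discount c s t := by
  rw [discount, if_pos h, ← ENNReal.ofReal_mul (Real.exp_pos _).le, ← Real.exp_add,
    ENNReal.one_le_ofReal, Real.one_le_exp_iff]
  linarith

variable {V : Type*} {G : SimpleGraph V} {q : ℕ} (X : MetropolisChain G q)

theorem ringTime_pos_of {ω : V × ℕ → Coins q} (h : ∀ p, 0 < (ω p).1) (v : V) (i : ℕ) :
    0 < ringTime (coinsAt ω v) i := ringTime_pos (fun k => h (v, k)) i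

theorem measurableSet_ringTime_lt (T : ℝ) (v : V) (i : ℕ) :
    MeasurableSet {ω : V × ℕ → Coins q | ringTime (coinsAt ω v) i < T} :=
  measurableSet_lt (measurable_ringTime v i) measurable_const

/-- The left side is the expected number of rings before `T`. Discounting at rate `1/T` loses at
most a factor `e` up to time `T`. -/
theorem tsum_law_ringTime_lt_le [Countable V] {T : ℝ} (hT : 0 ≤ T) (v : V) :
    ∑' i, law X {ω | ringTime (coinsAt ω v) i < T} ≤ ENNReal.ofReal (Real.exp 1 * T) := by
  rcases hT.eq_or_lt with rfl | hT
  · have : ∀ i, law X {ω | ringTime (coinsAt ω v) i < 0} = 0 := fun i => by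
      have : ∀ᵐ ω ∂law X, ¬ ringTime (coinsAt ω v) i < 0 := by
        filter_upwards [ae_wait_pos X] with ω hω
        exact (ringTime_pos_of hω v i).not_gt
      simpa only [not_not] using ae_iff.1 this
    simp [this]
  have h := tsum_lintegral_discount_le (X := X) (v := v) (c := T⁻¹) (g := fun _ => 1)
    (s := fun _ => 0) (inv_pos.2 hT) measurable_const measurable_const (by simp)
    fun i => Or.inr ⟨fun _ _ => rfl, fun _ _ => rfl⟩
  simp only [one_mul, lintegral_const, measure_univ, mul_one, ENNReal.ofReal_inv_of_pos hT,
    inv_inv] at h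
  rw [ENNReal.ofReal_mul (Real.exp_pos 1).le]
  refine le_trans ?_ (mul_le_mul_right h (ENNReal.ofReal (Real.exp 1)))
  rw [← ENNReal.tsum_mul_left]
  refine ENNReal.tsum_le_tsum fun i => ?_
  rw [← lintegral_const_mul' _ _ ENNReal.ofReal_ne_top,
    ← lintegral_indicator_one (measurableSet_ringTime_lt T v i)]
  refine lintegral_mono_ae ?_
  filter_upwards [ae_wait_pos X] with ω hω
  by_cases hlt : ringTime (coinsAt ω v) i < T
  · rw [Set.indicator_of_mem (show ω ∈ {ω | ringTime (coinsAt ω v) i < T} from hlt)]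
    refine one_le_mul_discount (ringTime_pos_of hω v i) ?_
    rw [sub_zero, inv_mul_le_iff₀ hT, mul_one]
    exact hlt.le
  · rw [Set.indicator_of_notMem (show ω ∉ {ω | ringTime (coinsAt ω v) i < T} from hlt)]
    exact zero_le

theorem ae_ringTime_ne (T : ℝ) (v : V) (i : ℕ) :
    ∀ᵐ ω ∂law X, ringTime (coinsAt ω v) i ≠ T := by
  have hm : MeasurableSet {ω : V × ℕ → Coins q | ringTime (coinsAt ω v) i = T} :=
    measurable_ringTime v i (measurableSet_singleton T)
  rw [ae_iff]
  simp only [ne_eq, not_not]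
  rw [← lintegral_indicator_one hm, lintegral_law_wait_eq X (v, i) (measurable_one.indicator hm)]
  refine (lintegral_eq_zero_of_ae_eq_zero (Filter.Eventually.of_forall fun ω => ?_))
  have h0 : expMeasure 1 {T - priorTime (coinsAt ω v) i} = 0 :=
    withDensity_absolutelyContinuous _ _ (measure_singleton _)
  rw [← lintegral_indicator_one (measurableSet_singleton _)] at h0
  refine Eq.trans (lintegral_congr fun w => ?_) h0
  simp only [Set.indicator_apply, Set.mem_ofPred_eq, ringTime_update_self, Set.mem_singleton_iff,
    eq_sub_iff_add_eq']
  rfl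

/-- The probabilities that the `i`-th ring comes before `T + 1` are summable in `i` and hence tend
to zero. -/
theorem ae_unbounded [Countable V] {T : ℝ} (hT : 0 ≤ T) :
    ∀ᵐ ω ∂law X, ∀ v, ∃ i, T < ringTime (coinsAt ω v) i := by
  refine ae_all_iff.2 fun v => ?_
  rw [ae_iff]
  have h := ENNReal.tendsto_atTop_zero_of_tsum_ne_top (ne_top_of_le_ne_top ENNReal.ofReal_ne_top
    (tsum_law_ringTime_lt_le X (T := T + 1) (by linarith) v))
  refine nonpos_iff_eq_zero.1 (ge_of_tendsto' h fun i => measure_mono fun ω hω => ?_)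
  have hω : ¬ ∃ i, T < ringTime (coinsAt ω v) i := hω
  push Not at hω
  exact (hω i).trans_lt (lt_add_one T)

end GeneralPosition

/-! ### Coincidences of truncated times. -/

section Network

variable {V : Type*} [Fintype V] {G : SimpleGraph V} {q : ℕ}
  (X : MetropolisChain G q) {T : ℝ} (y₀ : V → Fin q)

/-- If truncations to precision `1/N` coincide, the rings differ by less than `1/N`. For each ring
of `u` before `T`, the independent clock of `v` rings in a window of length `2/N` with small
probability; discounting at rate `N` from the start of the window bounds it by `e^2/N`, and there
are at most `eT` rings of `u` on average. -/
theorem law_coincide_le (hT : 0 ≤ T) {u v : V} (huv : u ≠ v) (ℓ : ℕ) :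
    law X {ω | Coincide X T y₀ ω u v ℓ} ≤ ENNReal.ofReal (Real.exp 3 * T *
      (2 ^ (Nat.clog 2 (Fintype.card V ^ 4 * (⌈T⌉₊ + 1)) * (ℓ + 1)))⁻¹) := by
  set N : ℝ := 2 ^ (Nat.clog 2 (Fintype.card V ^ 4 * (⌈T⌉₊ + 1)) * (ℓ + 1)) with hN
  have hN0 : 0 < N := by positivity
  set A : ℕ → Set (V × ℕ → Coins q) := fun i => {ω | ringTime (coinsAt ω u) i < T} with hA
  have mA : ∀ i, MeasurableSet (A i) := measurableSet_ringTime_lt T u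
  set f : ℕ → ℕ → (V × ℕ → Coins q) → ENNReal := fun i k ω => (A i).indicator 1 ω *
    discount N (max 0 (ringTime (coinsAt ω u) i - N⁻¹)) (ringTime (coinsAt ω v) k) with hf
  have ms : ∀ i, Measurable fun ω : V × ℕ → Coins q => max 0 (ringTime (coinsAt ω u) i - N⁻¹) :=
    fun i => measurable_const.max ((measurable_ringTime u i).sub_const _)
  have mf : ∀ i k, Measurable (f i k) := fun i k => (measurable_one.indicator (mA i)).mul
    (measurable_discount (ms i) (measurable_ringTime v k))
  have h1 : ∀ᵐ ω ∂law X, Coincide X T y₀ ω u v ℓ →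
      1 ≤ ENNReal.ofReal (Real.exp 2) * ∑' i, ∑' k, f i k ω := by
    filter_upwards [ae_wait_pos X, ae_unbounded X hT] with ω hpos hub
    rintro ⟨i, hi, k, hk, he⟩
    have hlt : ringTime (coinsAt ω u) i < T := (lt_ncard_iff
      (P := fun i => ringTime (coinsAt ω u) i < T)
      (fun a b hab hb => ((strictMono_ringTime fun k => hpos (u, k)).monotone hab).trans_lt hb)
      ⟨_, (hub u).choose_spec.not_gt⟩).1 hi
    have hx := ringTime_pos_of hpos u i
    have hy := ringTime_pos_of hpos v k
    change ⌊ringTime (coinsAt ω u) i * N⌋₊ = ⌊ringTime (coinsAt ω v) k * N⌋₊ at he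
    set x := ringTime (coinsAt ω u) i
    set y := ringTime (coinsAt ω v) k
    have h2 : x * N < y * N + 1 := (Nat.lt_floor_add_one _).trans_le (by
      rw [he]; linarith [Nat.floor_le (show 0 ≤ y * N by positivity)])
    have h3 : y * N < x * N + 1 := (Nat.lt_floor_add_one _).trans_le (by
      rw [← he]; linarith [Nat.floor_le (show 0 ≤ x * N by positivity)])
    have hNN : N⁻¹ * N = 1 := inv_mul_cancel₀ hN0.ne'
    -- The window is cut off at `0` because the restarted count of rings requires a nonnegative
    -- starting moment.
    have h4 : max 0 (x - N⁻¹) < y := max_lt hy (by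
      refine lt_of_mul_lt_mul_right (a := N) ?_ hN0.le
      rw [sub_mul, hNN]; linarith)
    have h5 : N * (y - max 0 (x - N⁻¹)) ≤ 2 := by
      have : x - N⁻¹ ≤ max 0 (x - N⁻¹) := le_max_right _ _
      have h6 := mul_le_mul_of_nonneg_right this hN0.le
      rw [sub_mul, hNN] at h6
      nlinarith
    calc (1 : ENNReal) ≤ ENNReal.ofReal (Real.exp 2) * f i k ω := by
          simp only [hf]
          rw [Set.indicator_of_mem (show ω ∈ A i from hlt), Pi.one_apply, one_mul]
          exact one_le_mul_discount h4 h5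
      _ ≤ _ := by
          gcongr
          exact (ENNReal.le_tsum k).trans (ENNReal.le_tsum (f := fun i => ∑' k, f i k ω) i)
  have h2 : ∀ i, ∑' k, ∫⁻ ω, f i k ω ∂law X ≤ (ENNReal.ofReal N)⁻¹ * law X (A i) := by
    intro i
    have h := tsum_lintegral_discount_le (X := X) (v := v) (c := N) (g := (A i).indicator 1)
      (s := fun ω => max 0 (ringTime (coinsAt ω u) i - N⁻¹)) hN0 (measurable_one.indicator (mA i))
      (ms i) (Filter.Eventually.of_forall fun ω => le_max_left _ _) fun k => Or.inr ⟨?_, ?_⟩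
    · rwa [lintegral_indicator_one (mA i)] at h
    · intro ω w
      simp only [Set.indicator_apply, hA, Set.mem_ofPred_eq,
        ringTime_update ω (fun h => absurd h huv)]
      rfl
    · intro ω w
      simp only [ringTime_update ω (fun h => absurd h huv)]
  have mC : MeasurableSet {ω | Coincide X T y₀ ω u v ℓ} :=
    measurableSet_setOfPred.2 (measurable_coincide X T y₀ u v ℓ)
  calc law X {ω | Coincide X T y₀ ω u v ℓ}
      = ∫⁻ ω, {ω | Coincide X T y₀ ω u v ℓ}.indicator 1 ω ∂law X :=
        (lintegral_indicator_one mC).symm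
    _ ≤ ∫⁻ ω, ENNReal.ofReal (Real.exp 2) * ∑' i, ∑' k, f i k ω ∂law X := by
        refine lintegral_mono_ae ?_
        filter_upwards [h1] with ω hω
        by_cases hc : Coincide X T y₀ ω u v ℓ
        · rw [Set.indicator_of_mem (show ω ∈ {ω | Coincide X T y₀ ω u v ℓ} from hc)]
          exact hω hc
        · rw [Set.indicator_of_notMem (show ω ∉ {ω | Coincide X T y₀ ω u v ℓ} from hc)]
          exact zero_le
    _ = ENNReal.ofReal (Real.exp 2) * ∑' i, ∑' k, ∫⁻ ω, f i k ω ∂law X := by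
        rw [lintegral_const_mul' _ _ ENNReal.ofReal_ne_top, lintegral_tsum fun i =>
          (Measurable.tsum fun k => mf i k).aemeasurable]
        congr 2
        ext i
        exact lintegral_tsum fun k => (mf i k).aemeasurable
    _ ≤ ENNReal.ofReal (Real.exp 2) * ((ENNReal.ofReal N)⁻¹ * ENNReal.ofReal (Real.exp 1 * T)) := by
        gcongr
        refine (ENNReal.tsum_le_tsum h2).trans ?_
        rw [ENNReal.tsum_mul_left]
        gcongr
        exact tsum_law_ringTime_lt_le X hT u
    _ = _ := by
        rw [← ENNReal.ofReal_inv_of_pos hN0, ← ENNReal.ofReal_mul (by positivity),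
          ← ENNReal.ofReal_mul (by positivity)]
        congr 1
        rw [show (3 : ℝ) = 2 + 1 by norm_num, Real.exp_add]
        ring

theorem two_le_clog {n m : ℕ} (hn : 2 ≤ n) : 1 ≤ Nat.clog 2 (n ^ 4 * (m + 1)) := by
  refine Nat.clog_pos one_lt_two ?_
  calc 2 ≤ n := hn
    _ ≤ n ^ 4 := Nat.le_self_pow (by norm_num) n
    _ ≤ n ^ 4 * (m + 1) := Nat.le_mul_of_pos_right _ (by omega)

theorem ae_separated (hT : 0 ≤ T) {u v : V} (huv : u ≠ v) :
    ∀ᵐ ω ∂law X, ∃ ℓ, ¬ Coincide X T y₀ ω u v ℓ := by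
  rw [ae_iff]
  push Not
  set b := Nat.clog 2 (Fintype.card V ^ 4 * (⌈T⌉₊ + 1)) with hb
  have hb1 : 1 ≤ b := two_le_clog (Fintype.one_lt_card_iff.2 ⟨u, v, huv⟩)
  have hlim : Filter.Tendsto (fun ℓ : ℕ => ENNReal.ofReal (Real.exp 3 * T * (2 ^ (b * (ℓ + 1)))⁻¹))
      Filter.atTop (nhds 0) := by
    rw [← ENNReal.ofReal_zero]
    refine ENNReal.tendsto_ofReal ?_
    rw [← mul_zero (Real.exp 3 * T)]
    refine Filter.Tendsto.const_mul _ ?_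
    have h1 : Filter.Tendsto (fun ℓ : ℕ => (((1 : ℝ) / 2) ^ ℓ)) Filter.atTop (nhds 0) :=
      tendsto_pow_atTop_nhds_zero_of_lt_one (by norm_num) (by norm_num)
    refine squeeze_zero (fun ℓ => by positivity) (fun ℓ => ?_) h1
    rw [one_div, inv_pow]
    refine inv_anti₀ (by positivity) (pow_le_pow_right₀ one_le_two ?_)
    nlinarith
  exact nonpos_iff_eq_zero.1 (ge_of_tendsto' hlim fun ℓ =>
    (measure_mono fun ω (hω : ∀ ℓ, Coincide X T y₀ ω u v ℓ) => hω ℓ).trans (law_coincide_le X y₀ hT huv ℓ))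

theorem ae_regularClocks (hT : 0 ≤ T) : ∀ᵐ ω ∂law X, RegularClocks X T y₀ ω := by
  have h : ∀ᵐ ω ∂law X, ∀ u v, u ≠ v → ∃ ℓ, ¬ Coincide X T y₀ ω u v ℓ :=
    ae_all_iff.2 fun u => ae_all_iff.2 fun v => ae_all_iff.2 fun huv =>
      ae_separated X y₀ hT huv
  filter_upwards [ae_wait_pos X, ae_unbounded X hT, h] with ω h1 h2 h3
  exact ⟨h1, h2, h3⟩

end Network

/-! ### The probability that a decision settles an update -/

namespace Timetable

variable {V : Type*} [Fintype V] {q : ℕ} {G : SimpleGraph V} {D : Scheduler V} {y₀ : V → Fin q}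
  {S S' : Timetable V q} {g g' : Outcome V} {rank : V → ℕ → ℕ} {v : V} {i : ℕ}

theorem AgreesBelow.knownUntil_eq (hr : S.IsRanked rank) (hi : i < S.count v)
    (h : AgreesBelow rank (rank v i) S S' g g') (s : ℝ) :
    S'.knownUntil D g' v i s = S.knownUntil D g v i s := by
  ext u
  simp only [knownUntil, h.before]
  congr 1
  refine Finset.filter_congr fun k hk => ?_
  rw [h.arrival_eq hr hi (Finset.mem_range.1 hk)]

theorem AgreesBelow.knownDuring_eq (hr : S.IsRanked rank) (hi : i < S.count v)
    (h : AgreesBelow rank (rank v i) S S' g g') {u : V} {k : ℕ} (hk : k < S.before u v i) :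
    S'.knownDuring D g' v i u k = S.knownDuring D g v i u k := by
  ext w
  simp only [knownDuring, h.arrival_eq hr hi hk, h.known_eq hr hi, h.knownUntil_eq hr hi]

/-- Whether an update is settled at a given moment depends on its own proposal and coin only through
the acceptance rule. -/
theorem AgreesBelow.trigger_iff (hr : S.IsRanked rank) (hi : i < S.count v)
    (h : AgreesBelow rank (rank v i) S S' (S.run G D y₀) (S'.run G D y₀)) {u : V} {k : ℕ} :
    let J := S.knownDuring D (S.run G D y₀) v i u k
    let accepts := S'.accepts v i (S.value y₀ (S.run G D y₀) v i)
    S'.Trigger G D y₀ u k v i ↔ G.Adj v u ∧ k < S.before u v i ∧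
      ¬ (∀ τ ∈ S.candidates G y₀ (S.run G D y₀) v i J,
        ∀ τ' ∈ S.candidates G y₀ (S.run G D y₀) v i J, accepts τ = accepts τ') ∧
      ∀ τ ∈ S.candidates G y₀ (S.run G D y₀) v i (Function.update J u (k + 1)),
        ∀ τ' ∈ S.candidates G y₀ (S.run G D y₀) v i (Function.update J u (k + 1)),
          accepts τ = accepts τ' := by
  simp only [Trigger, h.before]
  refine and_congr_right fun _ => and_congr_right fun hk => ?_
  simp only [Settled, h.knownDuring_eq hr hi hk, h.candidates_eq hr hi, h.value_eq hr hi]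

theorem Delays.rank_lt (hr : S.IsRanked rank) {p p' : V × ℕ} (hp : p.2 < S.count p.1)
    (h : S.Delays G D y₀ p p') : rank p'.1 p'.2 < rank p.1 p.2 := by
  rcases h with ⟨h1, h2⟩ | ⟨-, h2, -⟩
  · rw [← h1]; exact hr.mono _ _ _ h2 hp
  · exact hr.before_rank _ _ _ _ hp h2

/-- Ranks decrease along a chain of delays. Changing proposals and coins at ranks from `n` on
therefore leaves a chain below `n` intact. -/
theorem isChain_delays_congr (hr : S.IsRanked rank) {n : ℕ} (hc : S'.count = S.count)
    (hd : S'.depth = S.depth) (hb : S'.before = S.before)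
    (h : ∀ v i, i < S.count v → rank v i < n →
      S'.proposal v i = S.proposal v i ∧ S'.accepts v i = S.accepts v i) (l : List (V × ℕ)) :
    ∀ p : V × ℕ, rank p.1 p.2 < n → (∀ r ∈ p :: l, r.2 < S.count r.1) →
      List.IsChain (S'.Delays G D y₀) (p :: l) → List.IsChain (S.Delays G D y₀) (p :: l) := by
  induction l with
  | nil => intros; simp
  | cons p' l ih =>
    intro p hp hl hch
    rw [List.isChain_cons_cons] at hch ⊢
    have hpc : p.2 < S.count p.1 := hl p (by simp)
    have hdel : S.Delays G D y₀ p p' := by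
      refine hch.1.imp_right fun ht => ?_
      have hag := fun n' (hn : n' ≤ n) => agreesBelow_run (G := G) (D := D) (y₀ := y₀) hr n' hc hd hb
        fun v i hi hlt => h v i hi (hlt.trans_le hn)
      have h1 := ((hag _ hp.le).trigger_iff hr hpc).1 ht
      have h2 : AgreesBelow rank (rank p.1 p.2) S S (S.run G D y₀) (S.run G D y₀) :=
        ⟨rfl, rfl, rfl, fun _ _ _ _ => rfl, fun _ _ _ _ => rfl⟩
      rw [(h _ _ hpc hp).2] at h1
      exact (h2.trigger_iff hr hpc).2 h1
    exact ⟨hdel, ih p' ((hdel.rank_lt hr hpc).trans hp) (fun r hr' => hl r (by simp [hr'])) hch.2⟩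

/-- One more decision excludes at most one of the possible values. -/
theorem exists_excluded {u : V} {b k : ℕ} (hk : k < b) :
    ∃ x, ∃ y ∈ S.possible y₀ g u b (k + 1), ∀ z ∈ S.possible y₀ g u b k,
      z ∈ S.possible y₀ g u b (k + 1) ∨ z = x := by
  have hval : S.value y₀ g u (k + 1) ∈ S.possible y₀ g u b (k + 1) :=
    Or.inl (by rw [min_eq_left hk])
  have hz : ∀ z ∈ S.possible y₀ g u b k, z ∈ S.possible y₀ g u b (k + 1) ∨
      z = S.value y₀ g u k ∨ z = S.proposal u k := by
    rintro z (hz | ⟨j, h1, h2, rfl⟩)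
    · rw [min_eq_left hk.le] at hz
      exact Or.inr (Or.inl hz)
    · rcases h1.eq_or_lt with rfl | h1
      · exact Or.inr (Or.inr rfl)
      · exact Or.inl (Or.inr ⟨j, h1, h2, rfl⟩)
  -- After an acceptance only the old value can drop out; after a rejection only the proposal can.
  -- The value after the decision remains possible and serves as `y`.
  by_cases hg : (g u k).1
  · have : S.value y₀ g u (k + 1) = S.proposal u k := by simp [value, hg]
    refine ⟨S.value y₀ g u k, _, hval, fun z h => ?_⟩
    rcases hz z h with h | h | h
    exacts [Or.inl h, Or.inr h, Or.inl (by rw [h, ← this]; exact hval)]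
  · have : S.value y₀ g u (k + 1) = S.value y₀ g u k := by simp [value, hg]
    refine ⟨S.proposal u k, _, hval, fun z h => ?_⟩
    rcases hz z h with h | h | h
    exacts [Or.inl h, Or.inl (by rw [h, ← this]; exact hval), Or.inr h]

end Timetable

section Coin

/-- The coins for which the comparison with `f` is constant on `s'`, but not on `s`, if each element
of `s` is close to an element of `s'`. -/
theorem uniformCoin_le {α : Type*} [Finite α] {s s' : Set α} (hs' : s'.Nonempty) {f : α → ℝ} {δ : ℝ}
    (h : ∀ τ ∈ s, ∃ σ ∈ s', |f τ - f σ| ≤ δ) {P : ℝ → Prop} [DecidablePred P]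
    (hP : ∀ β, P β → ¬ (∀ τ ∈ s, ∀ τ' ∈ s, decide (β < f τ) = decide (β < f τ')) ∧
      ∀ τ ∈ s', ∀ τ' ∈ s', decide (β < f τ) = decide (β < f τ')) :
    ∫⁻ β, (if P β then 1 else 0) ∂uniformCoin ≤ ENNReal.ofReal (2 * δ) := by
  obtain ⟨m, hm, hmin⟩ := s'.toFinite.exists_minimalFor f s' hs'
  obtain ⟨M, hM, hmax⟩ := s'.toFinite.exists_maximalFor f s' hs'
  have hmin : ∀ σ ∈ s', f m ≤ f σ := fun σ hσ => by
    by_contra! hc; exact absurd (hmin hσ hc.le) hc.not_ge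
  have hmax : ∀ σ ∈ s', f σ ≤ f M := fun σ hσ => by
    by_contra! hc; exact absurd (hmax hσ hc.le) hc.not_ge
  -- The comparison is constant on `s'` only if the coin lies below the minimum `f m` or not below
  -- the maximum `f M`. If it lies farther than `δ` outside, then it is on the same side of all
  -- values on `s` too.
  set U := Set.Ico (f m - δ) (f m) ∪ Set.Ico (f M) (f M + δ) with hU
  have hUm : MeasurableSet U := measurableSet_Ico.union measurableSet_Ico
  calc _ ≤ ∫⁻ β, U.indicator 1 β ∂uniformCoin := by
        refine lintegral_mono fun β => ?_
        split_ifs with hβ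
        · obtain ⟨h1, h2⟩ := hP β hβ
          have : β ∈ U := by
            by_cases hb : β < f m
            · left
              refine ⟨?_, hb⟩
              have h3 : ∃ τ ∈ s, f τ ≤ β := by
                by_contra! hc
                exact h1 fun τ hτ τ' hτ' => by simp [hc τ hτ, hc τ' hτ']
              obtain ⟨τ, hτ, h3⟩ := h3
              obtain ⟨σ, hσ, h4⟩ := h τ hτ
              have := abs_le.1 h4
              linarith [hmin σ hσ, this.1]
            · right
              have h5 : ∀ σ ∈ s', f σ ≤ β := fun σ hσ => by
                have := h2 σ hσ m hm
                simpa [hb] using this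
              have h3 : ∃ τ ∈ s, β < f τ := by
                by_contra! hc
                exact h1 fun τ hτ τ' hτ' => by simp [(hc τ hτ).not_gt, (hc τ' hτ').not_gt]
              obtain ⟨τ, hτ, h3⟩ := h3
              obtain ⟨σ, hσ, h4⟩ := h τ hτ
              have := abs_le.1 h4
              exact ⟨h5 M hM, by linarith [hmax σ hσ, this.2]⟩
          rw [Set.indicator_of_mem this]
          exact le_rfl
        · exact zero_le
    _ = uniformCoin U := lintegral_indicator_one hUm
    _ ≤ volume U := Measure.restrict_apply_le _ _
    _ ≤ volume (Set.Ico (f m - δ) (f m)) + volume (Set.Ico (f M) (f M + δ)) := measure_union_le _ _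
    _ = ENNReal.ofReal δ + ENNReal.ofReal δ := by simp
    _ = ENNReal.ofReal (2 * δ) := by
        rw [ENNReal.ofReal_mul zero_le_two, ENNReal.ofReal_ofNat, two_mul]

end Coin

/-! ### Resampling the proposal and the coin of a single update. -/

section Network

variable {V : Type*} [Fintype V] {G : SimpleGraph V} {q : ℕ}
  {X : MetropolisChain G q} {T : ℝ} {y₀ : V → Fin q} {ω ω' : V × ℕ → Coins q} {D : Scheduler V}

/-- The clocks ring at the same moments. -/
def SameClocks (ω ω' : V × ℕ → Coins q) : Prop := ∀ p, (ω' p).1 = (ω p).1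

theorem sameClocks_update (ω : V × ℕ → Coins q) (p : V × ℕ) (y : Fin q × ℝ) :
    SameClocks ω (Function.update ω p ((ω p).1, y)) := by
  intro p'
  rcases eq_or_ne p' p with rfl | hp
  · rw [Function.update_self]
  · rw [Function.update_of_ne hp]

namespace SameClocks

variable (h : SameClocks ω ω')
include h

theorem ringTime_eq (v : V) : ringTime (coinsAt ω' v) = ringTime (coinsAt ω v) := by
  ext i
  exact Finset.sum_congr rfl fun k _ => h (v, k)

theorem numUpdates_eq (v : V) :
    (node X T y₀ ω' v).numUpdates = (node X T y₀ ω v).numUpdates := by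
  change {i | ringTime (coinsAt ω' v) i < T}.ncard = {i | ringTime (coinsAt ω v) i < T}.ncard
  rw [h.ringTime_eq]

theorem count_eq : (timetable X T y₀ ω').count = (timetable X T y₀ ω).count :=
  funext h.numUpdates_eq

theorem coincide_iff (u v : V) (ℓ : ℕ) :
    Coincide X T y₀ ω' u v ℓ ↔ Coincide X T y₀ ω u v ℓ := by
  have ht : ∀ w i, (node X T y₀ ω' w).truncTime ℓ i = (node X T y₀ ω w).truncTime ℓ i := by
    intro w i
    exact congrArg (fun r : ℕ → ℝ => ⌊r i * 2 ^
      ((node X T y₀ ω w).blockLength * (ℓ + 1))⌋₊) (h.ringTime_eq w)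
  simp only [Coincide, h.numUpdates_eq, ht]

theorem depth_eq : (timetable X T y₀ ω').depth = (timetable X T y₀ ω).depth := by
  ext u v
  simp only [timetable, h.coincide_iff]

theorem before_eq : (timetable X T y₀ ω').before = (timetable X T y₀ ω).before := by
  ext u v i
  simp only [timetable, h.numUpdates_eq, h.ringTime_eq]

theorem regularClocks (hr : RegularClocks X T y₀ ω) : RegularClocks X T y₀ ω' :=
  ⟨fun p => (h p).symm ▸ hr.pos p, fun v => by rw [h.ringTime_eq]; exact hr.unbounded v,
    fun u v huv => by simp only [h.coincide_iff]; exact hr.separated u v huv⟩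

theorem symm : SameClocks ω' ω := fun p => (h p).symm

end SameClocks

theorem timetable_update_of_ne {p : V × ℕ} {y : Fin q × ℝ} {w : V} {j : ℕ} (hne : (w, j) ≠ p) :
    let S' := timetable X T y₀ (Function.update ω p ((ω p).1, y))
    S'.proposal w j = (timetable X T y₀ ω).proposal w j ∧
      S'.accepts w j = (timetable X T y₀ ω).accepts w j := by
  simp only [timetable, (sameClocks_update ω p y).numUpdates_eq, Function.update_of_ne hne,
    and_self]

theorem influence_nonneg {N : Type*} (f : (N → Fin q) → unitInterval) (u : N) (a b : Fin q) :
    0 ≤ influence f u a b := Real.iSup_nonneg fun _ => abs_nonneg _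

theorem le_influence {N : Type*} [Finite N] (f : (N → Fin q) → unitInterval) {u : N} {a b : Fin q}
    {σ τ : N → Fin q} (h1 : σ u = a) (h2 : τ u = b) (h3 : ∀ w, w ≠ u → σ w = τ w) :
    |(f σ : ℝ) - f τ| ≤ influence f u a b :=
  le_ciSup (f := fun p : {p : (N → Fin q) × (N → Fin q) //
      p.1 u = a ∧ p.2 u = b ∧ ∀ w, w ≠ u → p.1 w = p.2 w} => |(f p.1.1 : ℝ) - (f p.1.2 : ℝ)|)
    (Set.finite_range _).bddAbove ⟨(σ, τ), h1, h2, h3⟩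

/-- Given all other random choices, the proposal and the coin of an update make it unlikely that it
is settled by a given decision. -/
theorem lintegral_trigger_le (h : RegularClocks X T y₀ ω) {C : ℝ} (hC : LipschitzCondition X C)
    {v : V} {i : ℕ} (hi : i < (timetable X T y₀ ω).count v) (u : V) (k : ℕ) :
    ∫⁻ y, (if (timetable X T y₀ (Function.update ω (v, i) ((ω (v, i)).1, y))).Trigger G D y₀ u k v i
      then 1 else 0) ∂(X.proposal v).toMeasure.prod uniformCoin ≤
      if G.Adj v u then ENNReal.ofReal (2 * (C / maxDeg G)) else 0 := by
  set S := timetable X T y₀ ω with hS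
  -- A new proposal and coin at `(v, i)` change nothing of smaller rank. So the arrivals and both
  -- candidate sets are the same for all `y`, and only the acceptance rule varies.
  have hag : ∀ y, _ := fun y => Timetable.agreesBelow_run (G := G) (D := D) (y₀ := y₀) h.isRanked
    (S' := timetable X T y₀ (Function.update ω (v, i) ((ω (v, i)).1, y)))
    _ (sameClocks_update ω (v, i) y).count_eq (sameClocks_update ω (v, i) y).depth_eq
    (sameClocks_update ω (v, i) y).before_eq fun w j hj hlt =>
      timetable_update_of_ne fun he => by
        obtain ⟨rfl, rfl⟩ := Prod.mk.inj he
        exact lt_irrefl _ hlt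
  have htr := fun y => (hag y).trigger_iff h.isRanked hi (u := u) (k := k)
  simp only [htr]
  by_cases hadj : G.Adj v u
  swap
  · simp [hadj]
  by_cases hk : k < S.before u v i
  swap
  · simp [← hS, hk]
  simp only [hadj, hk, true_and, if_true, ← hS]
  set J := S.knownDuring D (S.run G D y₀) v i u k with hJ
  have hJu : J u = k := by simp [hJ, Timetable.knownDuring]
  obtain ⟨a, b, hb, hab⟩ := Timetable.exists_excluded (S := S) (y₀ := y₀) (g := S.run G D y₀)
    (u := u) hk
  set c := S.value y₀ (S.run G D y₀) v i with hc
  have hacc : ∀ (y : Fin q × ℝ) (τ : V → Fin q),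
      (timetable X T y₀ (Function.update ω (v, i) ((ω (v, i)).1, y))).accepts v i c τ =
        decide (y.2 < (X.filter v c y.1 (fun w => τ w) : ℝ)) := by
    intro y τ
    simp only [timetable, (sameClocks_update ω (v, i) y).numUpdates_eq, Function.update_self]
    exact if_pos hi
  simp only [hacc]
  refine (lintegral_prod_le' _ _ _).trans ?_
  calc _ ≤ ∫⁻ c', ENNReal.ofReal (2 * influence (X.filter v c c') ⟨u, hadj⟩ a b)
        ∂(X.proposal v).toMeasure := by
        refine lintegral_mono fun c' => ?_
        refine uniformCoin_le (f := fun τ : V → Fin q => (X.filter v c c' (fun w => τ w) : ℝ)) ?_ ?_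
          fun β hβ => hβ
        · exact ⟨_, Timetable.truth_mem_candidates⟩
        · intro τ hτ
          by_cases hin : τ u ∈ S.possible y₀ (S.run G D y₀) u (S.before u v i) (k + 1)
          · refine ⟨τ, fun w hw => ?_, by simpa using influence_nonneg _ _ _ _⟩
            rcases eq_or_ne w u with rfl | hwu
            · rwa [Function.update_self]
            · rw [Function.update_of_ne hwu]; exact hτ w hw
          -- The only value of `u` that the decision excludes is `a`; replacing it by the surviving
          -- value `b` moves the acceptance probability by at most the influence of `u`.
          · have hτu : τ u = a := (hab _ (hJu ▸ hτ u hadj)).resolve_left hin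
            refine ⟨Function.update τ u b, fun w hw => ?_, ?_⟩
            · rcases eq_or_ne w u with rfl | hwu
              · simpa only [Function.update_self] using hb
              · simp only [Function.update_of_ne hwu]; exact hτ w hw
            · refine le_influence (X.filter v c c') (u := (⟨u, hadj⟩ : G.neighborSet v)) hτu (Function.update_self ..) fun w hw => ?_
              rw [Function.update_of_ne]
              exact fun he => hw (Subtype.ext he)
    _ = ENNReal.ofReal (2 * ∑ c', (X.proposal v c').toReal *
          influence (X.filter v c c') ⟨u, hadj⟩ a b) := by
        rw [lintegral_fintype, Finset.mul_sum, ENNReal.ofReal_sum_of_nonneg fun c' _ => by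
          have := influence_nonneg (X.filter v c c') ⟨u, hadj⟩ a b
          positivity]
        refine Finset.sum_congr rfl fun c' _ => ?_
        rw [PMF.toMeasure_apply_singleton _ _ (measurableSet_singleton _), mul_left_comm,
          ENNReal.ofReal_mul ENNReal.toReal_nonneg, ENNReal.ofReal_toReal (PMF.apply_ne_top _ _),
          mul_comm]
    _ ≤ _ := by
        gcongr
        exact hC v ⟨u, hadj⟩ a b c

end Network

/-! ### Long chains of updates are unlikely -/

section ListSum

variable {α : Type*}

/-- The sum of `f` over all lists of length `n`. -/
def listSum : ℕ → (List α → ENNReal) → ENNReal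
  | 0, f => f []
  | n + 1, f => listSum n fun l => ∑' p, f (p :: l)

theorem listSum_mono : ∀ {n : ℕ} {f g : List α → ENNReal}, (∀ l, l.length = n → f l ≤ g l) →
    listSum n f ≤ listSum n g
  | 0, _, _, h => h [] rfl
  | n + 1, f, g, h => listSum_mono (n := n) (f := fun l => ∑' p, f (p :: l))
      (g := fun l => ∑' p, g (p :: l)) fun l hl =>
        ENNReal.tsum_le_tsum fun p => h (p :: l) (by simp [hl])

theorem listSum_const_mul (c : ENNReal) : ∀ (n : ℕ) (f : List α → ENNReal),
    listSum n (fun l => c * f l) = c * listSum n f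
  | 0, _ => rfl
  | n + 1, f => by simp only [listSum, ENNReal.tsum_mul_left, listSum_const_mul c n]

theorem measure_exists_list_le [Countable α] {Ω : Type*} [MeasurableSpace Ω] (μ : Measure Ω) :
    ∀ (n : ℕ) (E : List α → Set Ω),
      μ {ω | ∃ l, l.length = n ∧ ω ∈ E l} ≤ listSum n fun l => μ (E l)
  | 0, E => measure_mono fun ω ⟨l, hl, h⟩ => by rwa [List.length_eq_zero_iff.1 hl] at h
  | n + 1, E => by
    refine le_trans (measure_mono ?_) ((measure_exists_list_le μ n fun l => ⋃ p, E (p :: l)).trans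
      (listSum_mono fun l _ => measure_iUnion_le _))
    rintro ω ⟨_ | ⟨p, l⟩, hl, h⟩
    · cases hl
    · exact ⟨l, by simpa using hl, Set.mem_iUnion.2 ⟨p, h⟩⟩

end ListSum

section Chains

variable {V : Type*} {q : ℕ}

/-- `p` rings later than `p'`. -/
def Later (ω : V × ℕ → Coins q) (p p' : V × ℕ) : Prop :=
  ringTime (coinsAt ω p'.1) p'.2 < ringTime (coinsAt ω p.1) p.2

theorem isChain_later_congr {ω ω' : V × ℕ → Coins q} : ∀ {l : List (V × ℕ)},
    (∀ p ∈ l, ringTime (coinsAt ω' p.1) p.2 = ringTime (coinsAt ω p.1) p.2) →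
    (l.IsChain (Later ω') ↔ l.IsChain (Later ω))
  | [], _ => by simp
  | [_], _ => by simp
  | p :: p' :: l, h => by
    rw [List.isChain_cons_cons, List.isChain_cons_cons,
      isChain_later_congr fun r hr => h r (List.mem_cons_of_mem _ hr), Later, Later,
      h p (by simp), h p' (by simp)]

theorem le_of_isChain_later {ω : V × ℕ → Coins q} : ∀ {l : List (V × ℕ)} {p : V × ℕ},
    (p :: l).IsChain (Later ω) →
    ∀ r ∈ p :: l, ringTime (coinsAt ω r.1) r.2 ≤ ringTime (coinsAt ω p.1) p.2
  | [], p, _, r, hr => by rw [List.mem_singleton.1 hr]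
  | p' :: l, p, h, r, hr => by
    rw [List.isChain_cons_cons] at h
    rcases List.mem_cons.1 hr with rfl | hr
    · exact le_rfl
    · exact (le_of_isChain_later h.2 r hr).trans h.1.le

theorem measurableSet_isChain_later : ∀ l : List (V × ℕ),
    MeasurableSet {ω : V × ℕ → Coins q | l.IsChain (Later ω)}
  | [] => by simp
  | [_] => by simp
  | p :: p' :: l => by
    simp only [List.isChain_cons_cons]
    exact (measurableSet_lt (measurable_ringTime p'.1 p'.2) (measurable_ringTime p.1 p.2)).inter
      (measurableSet_isChain_later (p' :: l))

/-- A bound for the probability that `p'` delays `p`, given the clocks. -/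
def stepWeight (G : SimpleGraph V) (K : ENNReal) (v u : V) : ENNReal :=
  if v = u then 1 else if G.Adj v u then K else 0

/-- A bound for the probability that the updates on a list delay each other, given the clocks. -/
def chainWeight (G : SimpleGraph V) (K : ENNReal) : List (V × ℕ) → ENNReal
  | [] => 1
  | [_] => 1
  | p :: p' :: l => stepWeight G K p.1 p'.1 * chainWeight G K (p' :: l)

theorem stepWeight_ne_top {G : SimpleGraph V} {K : ENNReal} (hK : K ≠ ⊤) (v u : V) :
    stepWeight G K v u ≠ ⊤ := by
  rw [stepWeight]; split_ifs <;> simp [hK]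

/-- The sum is over the delayed node: either `u` itself with weight `1`, or one of at most `Δ`
neighbours with weight `K`. -/
theorem sum_stepWeight_le [Fintype V] (G : SimpleGraph V) (K : ENNReal) (u : V) :
    ∑ v, stepWeight G K v u ≤ 1 + maxDeg G * K := by
  calc ∑ v, stepWeight G K v u ≤ ∑ v, ((if v = u then 1 else 0) + if G.Adj u v then K else 0) := by
        refine Finset.sum_le_sum fun v _ => ?_
        rw [stepWeight, G.adj_comm v u]
        by_cases h1 : v = u <;> by_cases h2 : G.Adj u v <;> simp [h1, h2]
    _ = 1 + G.degree u * K := by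
        have : (Finset.univ.filter fun v => G.Adj u v).card = G.degree u := by
          rw [← G.card_neighborFinset_eq_degree]
          congr 1
          ext v; simp
        rw [Finset.sum_add_distrib, Finset.sum_ite_eq' Finset.univ u, if_pos (Finset.mem_univ u),
          ← Finset.sum_filter, Finset.sum_const, nsmul_eq_mul, this]
    _ ≤ _ := by
        gcongr
        exact G.degree_le_maxDegree u

/-! ### Summation over chains of rings with exponential discount. -/

section Mass

variable {G : SimpleGraph V} (X : MetropolisChain G q)

/-- The discounted probability of a chain of rings. -/
def chainMass (c : ℝ) (K : ENNReal) : List (V × ℕ) → ENNReal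
  | [] => 0
  | p :: l => chainWeight G K (p :: l) *
      ∫⁻ ω, {ω | (p :: l).IsChain (Later ω)}.indicator 1 ω *
        ENNReal.ofReal (Real.exp (-(c * ringTime (coinsAt ω p.1) p.2))) ∂law X

/-- The discount at the new ring factors into the discount at the former head and that of the time
between them. The sum over the later rings of one node then gives `1/c`, and the weights are summed
over the nodes. -/
theorem tsum_chainMass_cons_le [Fintype V] {c : ℝ} (hc : 0 < c) {K : ENNReal}
    (p' : V × ℕ) (l : List (V × ℕ)) :
    ∑' p, chainMass X c K (p :: p' :: l) ≤
      (1 + maxDeg G * K) * (ENNReal.ofReal c)⁻¹ * chainMass X c K (p' :: l) := by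
  set g : (V × ℕ → Coins q) → ENNReal := fun ω =>
    {ω | (p' :: l).IsChain (Later ω)}.indicator 1 ω *
      ENNReal.ofReal (Real.exp (-(c * ringTime (coinsAt ω p'.1) p'.2))) with hg
  have mt := measurable_ringTime (q := q) p'.1 p'.2
  have mg : Measurable g := (measurable_one.indicator (measurableSet_isChain_later _)).mul
    (by fun_prop)
  have key : ∀ v, ∑' i, ∫⁻ ω, g ω * discount c (ringTime (coinsAt ω p'.1) p'.2)
      (ringTime (coinsAt ω v) i) ∂law X ≤ (ENNReal.ofReal c)⁻¹ * ∫⁻ ω, g ω ∂law X := by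
    intro v
    refine tsum_lintegral_discount_le hc mg mt ?_ fun i => ?_
    · filter_upwards [ae_wait_pos X] with ω hω
      exact (ringTime_pos_of hω _ _).le
    -- If the chain already contains the ring `(v, i)` or a later ring of `v`, then `(v, i)` cannot
    -- come after the head. Otherwise the waiting time at `(v, i)` affects no ring of the chain.
    by_cases hex : ∃ r ∈ p' :: l, r.1 = v ∧ i ≤ r.2
    · left
      obtain ⟨r, hr, rfl, hi⟩ := hex
      filter_upwards [ae_wait_pos X] with ω hω hlt
      have : ω ∉ {ω | (p' :: l).IsChain (Later ω)} := fun hch => by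
        have h1 := le_of_isChain_later hch r hr
        have h2 := (strictMono_ringTime fun k => hω (r.1, k)).monotone hi
        exact absurd (hlt.trans_le (h2.trans h1)) (lt_irrefl _)
      simp only [hg, Set.indicator_of_notMem this, zero_mul]
    · right
      push Not at hex
      have ht : ∀ (ω : V × ℕ → Coins q) (w : ℝ), ∀ r ∈ p' :: l,
          ringTime (coinsAt (Function.update ω (v, i) (w, (ω (v, i)).2)) r.1) r.2 =
            ringTime (coinsAt ω r.1) r.2 := fun ω w r hr => ringTime_update ω (hex r hr) _
      refine ⟨fun ω w => ?_, fun ω w => ht ω w p' (by simp)⟩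
      simp only [hg, ht ω w p' List.mem_cons_self, Set.indicator_apply, Set.mem_ofPred_eq,
        isChain_later_congr (ht ω w), Pi.one_apply]
  have hsplit : ∀ p : V × ℕ, chainMass X c K (p :: p' :: l) =
      chainWeight G K (p' :: l) * (stepWeight G K p.1 p'.1 *
        ∫⁻ ω, g ω * discount c (ringTime (coinsAt ω p'.1) p'.2)
          (ringTime (coinsAt ω p.1) p.2) ∂law X) := by
    intro p
    rw [chainMass, chainWeight, mul_comm (stepWeight G K p.1 p'.1), mul_assoc]
    congr 2
    refine lintegral_congr fun ω => ?_
    simp only [hg, Set.indicator_apply, Set.mem_ofPred_eq, List.isChain_cons_cons, Pi.one_apply]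
    by_cases h1 : Later ω p p'
    · have h1' : ringTime (coinsAt ω p'.1) p'.2 < ringTime (coinsAt ω p.1) p.2 := h1
      rw [discount, if_pos h1', mul_assoc, ← ENNReal.ofReal_mul (Real.exp_pos _).le, ← Real.exp_add]
      simp only [h1, true_and]
      congr 3
      ring
    · have h1' : ¬ ringTime (coinsAt ω p'.1) p'.2 < ringTime (coinsAt ω p.1) p.2 := h1
      simp [discount, h1, h1']
  simp only [hsplit]
  rw [ENNReal.tsum_mul_left, ENNReal.tsum_prod', tsum_fintype]
  simp only [ENNReal.tsum_mul_left]
  calc _ ≤ chainWeight G K (p' :: l) * ∑ v, stepWeight G K v p'.1 *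
          ((ENNReal.ofReal c)⁻¹ * ∫⁻ ω, g ω ∂law X) := by
        gcongr with v
        exact key v
    _ ≤ chainWeight G K (p' :: l) * ((1 + maxDeg G * K) *
          ((ENNReal.ofReal c)⁻¹ * ∫⁻ ω, g ω ∂law X)) := by
        rw [← Finset.sum_mul]
        gcongr
        exact sum_stepWeight_le G K p'.1
    _ = _ := by
        rw [chainMass]
        ring

theorem tsum_chainMass_singleton_le [Fintype V] {c : ℝ} (hc : 0 < c) {K : ENNReal} :
    ∑' p, chainMass X c K [p] ≤ Fintype.card V * (ENNReal.ofReal c)⁻¹ := by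
  rw [ENNReal.tsum_prod', tsum_fintype]
  calc _ ≤ ∑ _v : V, (ENNReal.ofReal c)⁻¹ := by
        refine Finset.sum_le_sum fun v _ => ?_
        have h := tsum_lintegral_discount_le (X := X) (v := v) (c := c) (g := fun _ => 1)
          (s := fun _ => 0) hc measurable_const measurable_const (by simp)
          fun i => Or.inr ⟨fun _ _ => rfl, fun _ _ => rfl⟩
        simp only [one_mul, lintegral_const, measure_univ, mul_one] at h
        refine le_trans (ENNReal.tsum_le_tsum fun i => ?_) h
        rw [chainMass, chainWeight, one_mul]
        refine lintegral_mono_ae ?_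
        filter_upwards [ae_wait_pos X] with ω hω
        simp [discount, ringTime_pos_of hω]
    _ = _ := by simp

theorem listSum_chainMass_le [Fintype V] {c : ℝ} (hc : 0 < c) {K : ENNReal} (n : ℕ) :
    listSum (n + 1) (chainMass X c K) ≤
      ((1 + maxDeg G * K) * (ENNReal.ofReal c)⁻¹) ^ n * (Fintype.card V * (ENNReal.ofReal c)⁻¹) := by
  induction n with
  | zero => simpa [listSum] using tsum_chainMass_singleton_le X hc
  | succ n ih =>
    calc listSum (n + 1 + 1) (chainMass X c K)
        = listSum n fun l => ∑' p', ∑' p, chainMass X c K (p :: p' :: l) := rfl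
      _ ≤ listSum n fun l => ((1 + maxDeg G * K) * (ENNReal.ofReal c)⁻¹) *
            ∑' p', chainMass X c K (p' :: l) := by
          refine listSum_mono fun l _ => ?_
          rw [← ENNReal.tsum_mul_left]
          exact ENNReal.tsum_le_tsum fun p' => tsum_chainMass_cons_le X hc p' l
      _ = ((1 + maxDeg G * K) * (ENNReal.ofReal c)⁻¹) * listSum (n + 1) (chainMass X c K) := by
          rw [listSum_const_mul]; rfl
      _ ≤ _ := by
          rw [pow_succ', mul_assoc (_ * _) (_ ^ n)]
          exact mul_le_mul_right ih _

end Mass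
end Chains

/-! ### The probability of a long chain of delays -/

section Network

variable {V : Type*} [Fintype V] {G : SimpleGraph V} {q : ℕ}
  (X : MetropolisChain G q) (T : ℝ) (y₀ : V → Fin q) (D : Scheduler V)

/-- Each update on the list is delayed by the next one. -/
def DelayChain (l : List (V × ℕ)) (ω : V × ℕ → Coins q) : Prop :=
  l.IsChain ((timetable X T y₀ ω).Delays G D y₀) ∧ ∀ p ∈ l, p.2 < (timetable X T y₀ ω).count p.1

variable {X T y₀ D}

theorem RegularClocks.later_of_delays {ω : V × ℕ → Coins q} (h : RegularClocks X T y₀ ω)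
    {p p' : V × ℕ} (hp : p.2 < (timetable X T y₀ ω).count p.1)
    (hd : (timetable X T y₀ ω).Delays G D y₀ p p') : Later ω p p' := by
  rcases hd with ⟨h1, h2⟩ | ⟨-, h2, -⟩
  · rw [Later, ← h1]; exact h.strictMono _ h2
  · exact (h.lt_before_iff hp).1 h2

theorem lintegral_delays_le {ω : V × ℕ → Coins q} (h : RegularClocks X T y₀ ω) {C : ℝ}
    (hC : LipschitzCondition X C) {p p' : V × ℕ} (hp : p.2 < (timetable X T y₀ ω).count p.1) :
    ∫⁻ y, (if (timetable X T y₀ (Function.update ω p ((ω p).1, y))).Delays G D y₀ p p'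
      then 1 else 0) ∂(X.proposal p.1).toMeasure.prod uniformCoin ≤
      stepWeight G (ENNReal.ofReal (2 * (C / maxDeg G))) p.1 p'.1 := by
  rw [stepWeight]
  by_cases hpp : p.1 = p'.1
  · rw [if_pos hpp]
    calc _ ≤ ∫⁻ _y, 1 ∂(X.proposal p.1).toMeasure.prod uniformCoin :=
          lintegral_mono fun y => by split_ifs <;> simp
      _ = 1 := by simp
  · rw [if_neg hpp]
    simp only [Timetable.Delays, hpp, false_and, false_or]
    exact lintegral_trigger_le h hC hp _ _

/-- Resampling at the head does not alter the rest of the chain, whose updates all have smaller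
rank. What remains random is only whether the head is delayed by its successor. -/
theorem DelayChain.of_update {ω : V × ℕ → Coins q} (h : RegularClocks X T y₀ ω) {p p' : V × ℕ}
    {l : List (V × ℕ)} {y : Fin q × ℝ}
    (hch : DelayChain X T y₀ D (p :: p' :: l) (Function.update ω p ((ω p).1, y))) :
    (timetable X T y₀ (Function.update ω p ((ω p).1, y))).Delays G D y₀ p p' ∧
      p.2 < (timetable X T y₀ ω).count p.1 ∧ Later ω p p' ∧ DelayChain X T y₀ D (p' :: l) ω := by
  obtain ⟨h1, h2⟩ := hch
  rw [List.isChain_cons_cons] at h1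
  have hs := sameClocks_update ω p y
  rw [hs.count_eq] at h2
  have hp := h2 p (by simp)
  have hlater : Later ω p p' := by
    have := (hs.regularClocks h).later_of_delays (by rw [hs.count_eq]; exact hp) h1.1
    rwa [Later, hs.ringTime_eq, hs.ringTime_eq] at this
  obtain ⟨rank, hr⟩ : ∃ rank, (timetable X T y₀ ω).IsRanked rank := ⟨_, h.isRanked⟩
  have hr' : (timetable X T y₀ (Function.update ω p ((ω p).1, y))).IsRanked rank := by
    obtain ⟨h3, h4, h5, h6⟩ := hr
    constructor <;> simpa only [hs.count_eq, hs.before_eq]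
  refine ⟨h1.1, hp, hlater, ?_, fun r hr => h2 r (List.mem_cons_of_mem _ hr)⟩
  refine Timetable.isChain_delays_congr hr (S' := timetable X T y₀ (Function.update ω p ((ω p).1, y)))
    (n := rank p.1 p.2) hs.count_eq hs.depth_eq hs.before_eq
    (fun v i hi hlt => timetable_update_of_ne ?_) l p'
    (h1.1.rank_lt hr' (by rw [hs.count_eq]; exact hp))
    (fun r hr => h2 r (List.mem_cons_of_mem _ hr)) h1.2
  rintro rfl
  exact lt_irrefl _ hlt

/-- Given the clocks, the updates on a list delay each other with a probability that is at most the
weight of the list. -/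
theorem lintegral_delayChain_le {C : ℝ} (hC : LipschitzCondition X C) (l : List (V × ℕ)) :
    ∀ (p : V × ℕ) (f : (V × ℕ → Coins q) → ENNReal),
      (∀ ω ω', SameClocks ω ω' → f ω' = f ω) → (∀ ω, f ω ≠ ⊤) →
      ∫⁻ ω, f ω * (if RegularClocks X T y₀ ω ∧ DelayChain X T y₀ D (p :: l) ω then 1 else 0)
          ∂law X ≤
        chainWeight G (ENNReal.ofReal (2 * (C / maxDeg G))) (p :: l) *
          ∫⁻ ω, f ω * (if (p :: l).IsChain (Later ω) ∧ ringTime (coinsAt ω p.1) p.2 < T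
            then 1 else 0) ∂law X := by
  induction l with
  | nil =>
    intro p f _ _
    rw [chainWeight, one_mul]
    refine lintegral_mono fun ω => ?_
    gcongr
    by_cases h : RegularClocks X T y₀ ω ∧ DelayChain X T y₀ D [p] ω
    · have : ringTime (coinsAt ω p.1) p.2 < T := h.1.lt_count_iff.1 (h.2.2 p (by simp))
      simp only [List.isChain_singleton, this, and_self, if_true]
      split_ifs <;> simp
    · simp [h]
  | cons p' l ih =>
    intro p f hf hfin
    set K := ENNReal.ofReal (2 * (C / maxDeg G)) with hK
    -- The induction carries a factor `f` that depends on the clocks only. The comparison of the two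
    -- ring times is moved into it, so the coins can be integrated out link by link before the
    -- clocks are touched.
    set f' : (V × ℕ → Coins q) → ENNReal := fun ω =>
      f ω * if Later ω p p' ∧ ringTime (coinsAt ω p.1) p.2 < T then 1 else 0 with hf'
    have hf'c : ∀ ω ω', SameClocks ω ω' → f' ω' = f' ω := fun ω ω' h => by
      simp only [hf', hf ω ω' h, Later, h.ringTime_eq]
      congr
    refine (lintegral_law_coin_le X p _).trans ?_
    calc _ ≤ ∫⁻ ω, stepWeight G K p.1 p'.1 * (f' ω *
          (if RegularClocks X T y₀ ω ∧ DelayChain X T y₀ D (p' :: l) ω then 1 else 0)) ∂law X := by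
          refine lintegral_mono fun ω => ?_
          by_cases hω : RegularClocks X T y₀ ω ∧ p.2 < (timetable X T y₀ ω).count p.1 ∧
              Later ω p p' ∧ DelayChain X T y₀ D (p' :: l) ω
          · obtain ⟨h1, h2, h3, h4⟩ := hω
            have h5 : ringTime (coinsAt ω p.1) p.2 < T := h1.lt_count_iff.1 h2
            simp only [hf', h1, h3, h4, h5, and_self, if_true, mul_one]
            calc _ ≤ ∫⁻ y, (if (timetable X T y₀ (Function.update ω p ((ω p).1, y))).Delays G D y₀ p p'
                  then 1 else 0) * f ω ∂(X.proposal p.1).toMeasure.prod uniformCoin := by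
                  refine lintegral_mono fun y => ?_
                  rw [hf _ _ (sameClocks_update ω p y), mul_comm]
                  gcongr
                  split_ifs with h6 h7
                  · exact le_rfl
                  · exact absurd (h6.2.of_update h1).1 h7
                  · exact zero_le
                  · exact le_rfl
              _ ≤ _ := by
                  rw [lintegral_mul_const' _ _ (hfin ω)]
                  exact mul_le_mul_left (lintegral_delays_le h1 hC h2) _
          · refine le_of_eq_of_le (lintegral_eq_zero_of_ae_eq_zero
              (Filter.Eventually.of_forall fun y => ?_)) zero_le
            have : ¬ (RegularClocks X T y₀ (Function.update ω p ((ω p).1, y)) ∧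
                DelayChain X T y₀ D (p :: p' :: l) (Function.update ω p ((ω p).1, y))) := by
              rintro ⟨h1, h2⟩
              have h3 := (sameClocks_update ω p y).symm.regularClocks h1
              exact hω ⟨h3, (h2.of_update h3).2⟩
            simp [this]
      _ = stepWeight G K p.1 p'.1 * ∫⁻ ω, f' ω *
          (if RegularClocks X T y₀ ω ∧ DelayChain X T y₀ D (p' :: l) ω then 1 else 0) ∂law X :=
          lintegral_const_mul' _ _ (stepWeight_ne_top ENNReal.ofReal_ne_top _ _)
      _ ≤ stepWeight G K p.1 p'.1 * (chainWeight G K (p' :: l) *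
          ∫⁻ ω, f ω * (if (p :: p' :: l).IsChain (Later ω) ∧ ringTime (coinsAt ω p.1) p.2 < T
            then 1 else 0) ∂law X) := by
          gcongr
          refine (ih p' f' hf'c fun ω => ENNReal.mul_ne_top (hfin ω) (by split_ifs <;> simp)).trans ?_
          refine mul_le_mul_right (lintegral_mono fun ω => ?_) _
          simp only [hf', mul_assoc]
          refine mul_le_mul_right ?_ _
          by_cases h1 : Later ω p p' ∧ ringTime (coinsAt ω p.1) p.2 < T
          · by_cases h2 : (p' :: l).IsChain (Later ω)
            · rw [if_pos h1, one_mul, if_pos (And.intro (List.isChain_cons_cons.2 ⟨h1.1, h2⟩) h1.2)]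
              split_ifs <;> simp
            · simp [h2]
          · simp [h1]
      _ = _ := by rw [chainWeight, mul_assoc]

/-- The head rings before `T`, so `exp (cT)` outweighs its discount. -/
theorem law_delayChain_le (hT : 0 ≤ T) {C : ℝ} (hC : LipschitzCondition X C) {c : ℝ} (hc : 0 < c)
    (p : V × ℕ) (l : List (V × ℕ)) :
    law X {ω | DelayChain X T y₀ D (p :: l) ω} ≤ ENNReal.ofReal (Real.exp (c * T)) *
      chainMass X c (ENNReal.ofReal (2 * (C / maxDeg G))) (p :: l) := by
  have hm : MeasurableSet {ω | DelayChain X T y₀ D (p :: l) ω} := by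
    simpa only [DelayChain, Set.mem_ofPred_eq] using measurableSet_timetable X T y₀
      {S | (p :: l).IsChain (S.Delays G D y₀) ∧ ∀ r ∈ p :: l, r.2 < S.count r.1}
  rw [← lintegral_indicator_one hm]
  calc _ ≤ ∫⁻ ω, 1 * (if RegularClocks X T y₀ ω ∧ DelayChain X T y₀ D (p :: l) ω then 1 else 0)
        ∂law X := by
        refine lintegral_mono_ae ?_
        filter_upwards [ae_regularClocks X y₀ hT] with ω hω
        simp [Set.indicator_apply, hω]
    _ ≤ _ := lintegral_delayChain_le hC l p (fun _ => 1) (fun _ _ _ => rfl)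
        fun _ => ENNReal.one_ne_top
    _ ≤ _ := by
        rw [chainMass, mul_left_comm]
        gcongr
        rw [← lintegral_const_mul' _ _ ENNReal.ofReal_ne_top]
        refine lintegral_mono fun ω => ?_
        rw [one_mul]
        split_ifs with h
        · rw [Set.indicator_of_mem (show ω ∈ {ω | (p :: l).IsChain (Later ω)} from h.1),
            Pi.one_apply, one_mul, ← ENNReal.ofReal_mul (Real.exp_pos _).le, ← Real.exp_add,
            ENNReal.one_le_ofReal, Real.one_le_exp_iff, ← sub_eq_add_neg, ← mul_sub]
          exact mul_nonneg hc.le (sub_pos.2 h.2).le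
        · exact zero_le

/-- A union bound over all chains with `n + 1` members: `exp (cT)` from the discount, `|V|` from the
earliest member, and `1/e` for each of the `n` links. -/
theorem law_exists_delayChain_le (hT : 0 ≤ T) {C : ℝ} (hC0 : 0 < C) (hC : LipschitzCondition X C)
    (n : ℕ) :
    law X {ω | ∃ l, l.length = n + 1 ∧ DelayChain X T y₀ D l ω} ≤
      ENNReal.ofReal (Fintype.card V * Real.exp (Real.exp 1 * (1 + 2 * C) * T - n)) := by
  -- The rate is chosen `e` times as large as the bound `1 + 2C` for the total weight of a link.
  set c := Real.exp 1 * (1 + 2 * C) with hc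
  have hc0 : 0 < c := by positivity
  have hc1 : 1 ≤ c := by
    have : 1 ≤ Real.exp 1 := Real.one_le_exp zero_le_one
    nlinarith
  set K := ENNReal.ofReal (2 * (C / maxDeg G)) with hK
  have hdeg : 1 + maxDeg G * K ≤ ENNReal.ofReal (1 + 2 * C) := by
    rw [ENNReal.ofReal_add one_pos.le (by positivity), ENNReal.ofReal_one, hK,
      ← ENNReal.ofReal_natCast, ← ENNReal.ofReal_mul (Nat.cast_nonneg _)]
    refine add_le_add_right (ENNReal.ofReal_le_ofReal ?_) _
    -- For `Δ = 0` the quotient `C / Δ` is `0` by convention, and the bound is trivial.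
    rcases Nat.eq_zero_or_pos (maxDeg G) with h | h
    · rw [h]; simp [hC0.le]
    · have : (0 : ℝ) < maxDeg G := by exact_mod_cast h
      apply le_of_eq
      field_simp
  have hratio : (1 + maxDeg G * K) * (ENNReal.ofReal c)⁻¹ ≤ ENNReal.ofReal (Real.exp (-1)) := by
    refine (mul_le_mul_left hdeg _).trans ?_
    rw [← ENNReal.ofReal_inv_of_pos hc0, ← ENNReal.ofReal_mul (by positivity)]
    apply le_of_eq
    congr 1
    rw [hc, Real.exp_neg]
    field_simp
  refine (measure_exists_list_le (law X) (n + 1) fun l => {ω | DelayChain X T y₀ D l ω}).trans ?_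
  calc _ ≤ listSum (n + 1) fun l => ENNReal.ofReal (Real.exp (c * T)) * chainMass X c K l := by
        refine listSum_mono fun l hl => ?_
        obtain _ | ⟨p, l⟩ := l
        · cases hl
        · exact law_delayChain_le hT hC hc0 p l
    _ = ENNReal.ofReal (Real.exp (c * T)) * listSum (n + 1) (chainMass X c K) :=
        listSum_const_mul _ _ _
    _ ≤ ENNReal.ofReal (Real.exp (c * T)) *
          (ENNReal.ofReal (Real.exp (-1)) ^ n * (Fintype.card V * 1)) := by
        refine mul_le_mul_right ((listSum_chainMass_le X hc0 n).trans ?_) _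
        gcongr
        rw [ENNReal.inv_le_one, ENNReal.one_le_ofReal]
        exact hc1
    _ = _ := by
        rw [mul_one, ← ENNReal.ofReal_pow (Real.exp_pos _).le, ← ENNReal.ofReal_natCast,
          ← ENNReal.ofReal_mul (by positivity), ← ENNReal.ofReal_mul (by positivity),
          ← Real.exp_nat_mul]
        congr 1
        rw [sub_eq_add_neg, Real.exp_add]
        ring_nf

end Network

/-! ### The time until termination -/

theorem TerminatesWithin.mono {V S M O : Type*} {G : SimpleGraph V} {D : Scheduler V}
    {A : V → Program V S M O} {L L' : ℝ} (hL : L ≤ L') (h : TerminatesWithin G D A L) :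
    TerminatesWithin G D A L' := fun e he =>
  let ⟨k, y, h1, h2⟩ := h e he
  ⟨k, y, h1.trans hL, h2⟩

section Network

variable {V : Type*} [Fintype V] {G : SimpleGraph V} {q : ℕ}
  {X : MetropolisChain G q} {T : ℝ} {y₀ : V → Fin q} {D : Scheduler V} {ω : V × ℕ → Coins q}

theorem enterTime_le_of_not_coincide {ℓ : ℕ} (h : ∀ u v, u ≠ v → ¬ Coincide X T y₀ ω u v ℓ)
    (v : V) : (timetable X T y₀ ω).enterTime G D v ≤ ℓ + 1 :=
  Timetable.enterTime_le (by positivity) fun u huv =>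
    (Timetable.levelDone_mono u v (Nat.sInf_le (h u v huv.ne))).trans (Timetable.levelDone_le ℓ u v)

/-- The bound has two parts: `ℓ + 1` units for Phase I if all coincidences are resolved by level
`ℓ`, and `n` units for Phase II in the absence of long chains of delays. -/
theorem terminatesWithin_of_not_exists (h : RegularClocks X T y₀ ω) {ℓ n : ℕ}
    (hℓ : ∀ u v, u ≠ v → ¬ Coincide X T y₀ ω u v ℓ)
    (hn : ¬ ∃ l, l.length = n + 1 ∧ DelayChain X T y₀ D l ω) :
    TerminatesWithin G D (mainAlgorithm X T y₀ ω) (ℓ + 1 + n) := by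
  have henter := enterTime_le_of_not_coincide (D := D) hℓ
  refine terminatesWithin h (by positivity)
    (fun v => (henter v).trans (le_add_of_nonneg_right (Nat.cast_nonneg n))) fun v i hi => ?_
  by_contra! hlt
  obtain ⟨l, h1, h2, h3⟩ := Timetable.exists_chain timetable_isLocal h.isRanked
    timetable_depth_comm henter n v i hi hlt
  exact hn ⟨(v, i) :: l, by simp [h1], h2, h3⟩

/-- Without edges no decision can delay an update. This covers the case `Δ = 0` of the general
bound, where the Lipschitz estimate would leave a term of order `T` that `ΔT` does not dominate. -/
theorem terminatesWithin_zero (h : RegularClocks X T y₀ ω) (hG : ∀ u v, ¬ G.Adj u v) :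
    TerminatesWithin G D (mainAlgorithm X T y₀ ω) 0 := by
  have henter : ∀ v, (timetable X T y₀ ω).enterTime G D v ≤ 0 := fun v =>
    Timetable.enterTime_le le_rfl fun u huv => absurd huv (hG u v)
  refine terminatesWithin h le_rfl henter fun v i => ?_
  have ready : ∀ i, i < (timetable X T y₀ ω).count v →
      (timetable X T y₀ ω).readyTime G D ((timetable X T y₀ ω).run G D y₀) v i ≤ 0 →
      resolveTime X T y₀ ω D v i ≤ 0 := fun i hi hle => by
    rcases (Timetable.readyTime_le_resolvedAt (G := G) (D := D) (y₀ := y₀)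
      timetable_isLocal h.isRanked hi).eq_or_lt with h1 | h1
    · exact h1.symm.trans_le hle
    · obtain ⟨u, k, hu, -⟩ := Timetable.exists_trigger timetable_isLocal h.isRanked hi h1
      exact absurd hu.1 (hG v u)
  induction i with
  | zero => exact fun hi => ready 0 hi (henter v)
  | succ i ih => exact fun hi => ready (i + 1) hi (max_le (henter v) (ih (by omega)))

theorem law_exists_coincide_le (hT : 0 ≤ T) (ℓ : ℕ) :
    law X {ω | ∃ u v, u ≠ v ∧ Coincide X T y₀ ω u v ℓ} ≤
      ENNReal.ofReal (Fintype.card V ^ 2 * (Real.exp 3 * T *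
        (2 ^ (Nat.clog 2 (Fintype.card V ^ 4 * (⌈T⌉₊ + 1)) * (ℓ + 1)))⁻¹)) := by
  set r := Real.exp 3 * T * (2 ^ (Nat.clog 2 (Fintype.card V ^ 4 * (⌈T⌉₊ + 1)) * (ℓ + 1)))⁻¹
  calc _ ≤ law X (⋃ u, ⋃ v, {ω | u ≠ v ∧ Coincide X T y₀ ω u v ℓ}) := by
        refine measure_mono fun ω ⟨u, v, h⟩ => ?_
        exact Set.mem_iUnion.2 ⟨u, Set.mem_iUnion.2 ⟨v, h⟩⟩
    _ ≤ ∑ _u : V, ∑ _v : V, ENNReal.ofReal r := by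
        refine (measure_iUnion_fintype_le _ _).trans (Finset.sum_le_sum fun u _ =>
          (measure_iUnion_fintype_le _ _).trans (Finset.sum_le_sum fun v _ => ?_))
        by_cases huv : u = v
        · simp [huv]
        · simpa [huv] using law_coincide_le X y₀ hT huv ℓ
    _ = _ := by
        rw [Finset.sum_const, Finset.sum_const, Finset.card_univ, nsmul_eq_mul, nsmul_eq_mul,
          ENNReal.ofReal_mul (p := (Fintype.card V : ℝ) ^ 2) (by positivity),
          ENNReal.ofReal_pow (by positivity), ENNReal.ofReal_natCast, sq, mul_assoc]

theorem law_not_terminatesWithin_le (hT : 0 ≤ T) {C : ℝ} (hC0 : 0 < C)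
    (hC : LipschitzCondition X C) (ℓ n : ℕ) :
    law X {ω | ¬ TerminatesWithin G D (mainAlgorithm X T y₀ ω) (ℓ + 1 + n)} ≤
      ENNReal.ofReal (Fintype.card V ^ 2 * (Real.exp 3 * T *
        (2 ^ (Nat.clog 2 (Fintype.card V ^ 4 * (⌈T⌉₊ + 1)) * (ℓ + 1)))⁻¹)) +
      ENNReal.ofReal (Fintype.card V * Real.exp (Real.exp 1 * (1 + 2 * C) * T - n)) := by
  refine le_trans (measure_mono_ae ?_) ((measure_union_le _ _).trans
    (add_le_add (law_exists_coincide_le (X := X) (y₀ := y₀) hT ℓ)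
      (law_exists_delayChain_le (y₀ := y₀) (D := D) hT hC0 hC n)))
  filter_upwards [ae_regularClocks X y₀ hT] with ω hω hnot
  by_contra hc
  exact hnot (terminatesWithin_of_not_exists hω
    (fun u v huv hco => hc (Or.inl ⟨u, v, huv, hco⟩)) fun hl => hc (Or.inr hl))

theorem law_not_terminatesWithin_anti {L L' : ℝ} (hL : L ≤ L') :
    law X {ω | ¬ TerminatesWithin G D (mainAlgorithm X T y₀ ω) L'} ≤
      law X {ω | ¬ TerminatesWithin G D (mainAlgorithm X T y₀ ω) L} := by
  refine measure_mono fun ω hω => ?_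
  simp only [Set.mem_ofPred_eq] at hω ⊢
  exact fun h => hω (h.mono hL)

theorem coincidence_bound {n a : ℕ} (hn : 2 ≤ n) (T : ℝ) (hT : 0 ≤ T) :
    (n : ℝ) ^ 2 * (Real.exp 3 * T *
      (2 ^ (Nat.clog 2 (n ^ 4 * (⌈T⌉₊ + 1)) * (a + 1 + 1)))⁻¹) ≤ 2⁻¹ * ((n : ℝ) ^ a)⁻¹ := by
  have hn' : (2 : ℝ) ≤ n := by exact_mod_cast hn
  have he : Real.exp 3 < 32 := by
    have h1 : Real.exp 3 = Real.exp 1 ^ 3 := by rw [← Real.exp_nat_mul]; norm_num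
    rw [h1]
    calc Real.exp 1 ^ 3 ≤ 3 ^ 3 := by
          gcongr; linarith [Real.exp_one_lt_d9]
      _ < 32 := by norm_num
  set m : ℝ := ⌈T⌉₊ + 1 with hm
  have hm1 : 1 ≤ m := by rw [hm]; linarith [(Nat.cast_nonneg ⌈T⌉₊ : (0 : ℝ) ≤ _)]
  have hTm : T ≤ m := (Nat.le_ceil T).trans (by rw [hm]; linarith)
  have hb : (n : ℝ) ^ 4 * m ≤ 2 ^ Nat.clog 2 (n ^ 4 * (⌈T⌉₊ + 1)) := by
    rw [hm]
    exact_mod_cast Nat.le_pow_clog one_lt_two (n ^ 4 * (⌈T⌉₊ + 1))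
  -- Here `2^6` is twice the bound `32` for `e^3` and is absorbed by `n^6`, as `n ≥ 2`. The exponent
  -- `a + 2`, from level `a + 1`, supplies `n^(4a + 8) = n^(4a) n^2 n^6`.
  have hpow : (n : ℝ) ^ a * n ^ 2 * 2 ^ 6 * m ≤
      2 ^ (Nat.clog 2 (n ^ 4 * (⌈T⌉₊ + 1)) * (a + 1 + 1)) := by
    calc (n : ℝ) ^ a * n ^ 2 * 2 ^ 6 * m ≤ (n : ℝ) ^ (4 * a) * n ^ 2 * n ^ 6 * m ^ (a + 2) := by
          gcongr
          · linarith
          · omega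
          · exact le_self_pow₀ hm1 (by omega)
      _ = ((n : ℝ) ^ 4 * m) ^ (a + 1 + 1) := by ring_nf
      _ ≤ _ := by rw [pow_mul]; gcongr
  have hpos : 0 < (n : ℝ) ^ a * n ^ 2 * 2 ^ 6 * m := by positivity
  calc _ ≤ (n : ℝ) ^ 2 * (32 * m * ((n : ℝ) ^ a * n ^ 2 * 2 ^ 6 * m)⁻¹) := by gcongr
    _ = _ := by field_simp; norm_num

/-- One power of `n` in `n^(a+2)` cancels the factor `|V|` of the union bound, and another provides
the factor `1/2`. -/
theorem delay_bound {n a : ℕ} (hn : 2 ≤ n) {x : ℝ} {m : ℕ} (hm : x + (a + 2) * Real.log n ≤ m) :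
    (n : ℝ) * Real.exp (x - m) ≤ 2⁻¹ * ((n : ℝ) ^ a)⁻¹ := by
  have hn' : (2 : ℝ) ≤ n := by exact_mod_cast hn
  have hn0 : (0 : ℝ) < n := by linarith
  have h1 : Real.exp (-((a + 2 : ℕ) * Real.log n)) = ((n : ℝ) ^ (a + 2))⁻¹ := by
    rw [Real.exp_neg, Real.exp_nat_mul, Real.exp_log hn0]
  calc (n : ℝ) * Real.exp (x - m) ≤ n * Real.exp (-((a + 2 : ℕ) * Real.log n)) := by
        gcongr
        push_cast
        linarith
    _ = (n : ℝ)⁻¹ * ((n : ℝ) ^ a)⁻¹ := by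
        rw [h1, pow_add, sq]
        field_simp
    _ ≤ _ := by gcongr

/-- With at most one node the claimed failure probability is at least `1`. -/
theorem law_le_of_card_lt_two (a : ℕ) (hn : Fintype.card V < 2) (s : Set (V × ℕ → Coins q)) :
    law X s ≤ ((Fintype.card V : ENNReal) ^ a)⁻¹ := by
  refine prob_le_one.trans (ENNReal.one_le_inv.2 (pow_le_one₀ zero_le ?_))
  exact_mod_cast Nat.lt_succ_iff.1 hn

/-- Phase I is run to level `a + 1` and the chain length is chosen so that each kind of failure has
probability at most `n^(-a)/2`. -/
theorem law_not_terminatesWithin_le_inv (a : ℕ) (hT : 0 ≤ T) {C : ℝ} (hC0 : 0 < C)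
    (hC : LipschitzCondition X C) :
    law X {ω | ¬ TerminatesWithin G D (mainAlgorithm X T y₀ ω)
      ((3 * a + 8) * ((1 + C) * T + Real.log (Fintype.card V)))} ≤
        ((Fintype.card V : ENNReal) ^ a)⁻¹ := by
  rcases lt_or_ge (Fintype.card V) 2 with hn | hn
  · exact law_le_of_card_lt_two a hn _
  set n := Fintype.card V
  have hn0 : (0 : ℝ) < n := by exact_mod_cast (by omega : 0 < n)
  have hlog : 1 / 2 ≤ Real.log n := by
    have : Real.log 2 ≤ Real.log n := Real.log_le_log two_pos (by exact_mod_cast hn)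
    linarith [Real.log_two_gt_d9]
  set x := Real.exp 1 * (1 + 2 * C) * T with hx
  have hx0 : 0 ≤ x := by positivity
  set m := ⌈x + (a + 2) * Real.log n⌉₊ with hm
  -- The `T` part is at most `6(1 + C)T`, since `e ≤ 3`. The additive constant is at most `a + 3 ≤
  -- 2(a + 3) log n`, since `log n ≥ 1/2`; together with `(a + 2) log n` this makes `(3a + 8) log
  -- n`.
  have hL : ((a + 1 : ℕ) : ℝ) + 1 + m ≤ (3 * a + 8) * ((1 + C) * T + Real.log n) := by
    have h1 : (m : ℝ) < x + (a + 2) * Real.log n + 1 := Nat.ceil_lt_add_one (by positivity)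
    have h2 : x ≤ 6 * ((1 + C) * T) := by
      have h3 : Real.exp 1 ≤ 3 := by linarith [Real.exp_one_lt_d9]
      calc x ≤ 3 * (1 + 2 * C) * T := by rw [hx]; gcongr
        _ = 3 * ((1 + 2 * C) * T) := by ring
        _ ≤ _ := by nlinarith [mul_nonneg hC0.le hT]
    have ha : (0 : ℝ) ≤ a := Nat.cast_nonneg a
    have h4 : 0 ≤ (3 * (a : ℝ) + 2) * ((1 + C) * T) := by positivity
    have h5 : (a + 3 : ℝ) * (1 / 2) ≤ (a + 3) * Real.log n := by gcongr
    push_cast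
    linarith
  calc _ ≤ law X {ω | ¬ TerminatesWithin G D (mainAlgorithm X T y₀ ω) ((a + 1 : ℕ) + 1 + m)} :=
        law_not_terminatesWithin_anti hL
    _ ≤ ENNReal.ofReal (2⁻¹ * ((n : ℝ) ^ a)⁻¹) + ENNReal.ofReal (2⁻¹ * ((n : ℝ) ^ a)⁻¹) :=
        (law_not_terminatesWithin_le hT hC0 hC (a + 1) m).trans (add_le_add
          (ENNReal.ofReal_le_ofReal (coincidence_bound hn T hT))
          (ENNReal.ofReal_le_ofReal (delay_bound hn (Nat.le_ceil _))))
    _ = _ := by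
        rw [← ENNReal.ofReal_add (by positivity) (by positivity), ← add_mul,
          show (2⁻¹ + 2⁻¹ : ℝ) = 1 by norm_num, one_mul,
          ENNReal.ofReal_inv_of_pos (by positivity), ENNReal.ofReal_pow (by positivity),
          ENNReal.ofReal_natCast]

theorem influence_le_one {N : Type*} (f : (N → Fin q) → unitInterval) (u : N) (a b : Fin q) :
    influence f u a b ≤ 1 :=
  Real.iSup_le (fun p => abs_sub_le_iff.2 ⟨by linarith [(f p.1.1).2.2, (f p.1.2).2.1],
    by linarith [(f p.1.2).2.2, (f p.1.1).2.1]⟩) zero_le_one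

theorem lipschitzCondition_maxDeg (h : 0 < maxDeg G) : LipschitzCondition X (maxDeg G) := by
  intro v u a b c
  have h1 : ∑ c', (X.proposal v c').toReal = 1 := by
    rw [← ENNReal.toReal_sum fun c' _ => PMF.apply_ne_top _ _, ← tsum_fintype (L := .unconditional _),
      PMF.tsum_coe, ENNReal.toReal_one]
  rw [div_self (by exact_mod_cast h.ne'), ← h1]
  exact Finset.sum_le_sum fun c' _ =>
    mul_le_of_le_one_right ENNReal.toReal_nonneg (influence_le_one _ _ _ _)

/-- Influences never exceed `1`, so the Lipschitz condition always holds with `C = Δ`. For `Δ ≥ 1`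
the bound `1 + Δ ≤ 2Δ` accounts for the factor `2`. -/
theorem law_not_terminatesWithin_maxDeg_le_inv (a : ℕ) (hT : 0 ≤ T) :
    law X {ω | ¬ TerminatesWithin G D (mainAlgorithm X T y₀ ω)
      (2 * (3 * a + 8) * (maxDeg G * T + Real.log (Fintype.card V)))} ≤
        ((Fintype.card V : ENNReal) ^ a)⁻¹ := by
  have hlog := Real.log_natCast_nonneg (Fintype.card V)
  rcases Nat.eq_zero_or_pos (maxDeg G) with h | h
  · have hG : ∀ u v, ¬ G.Adj u v := fun u v huv => by
      have h1 := G.degree_le_maxDegree u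
      have h2 := (G.degree_pos_iff_exists_adj u).2 ⟨v, huv⟩
      exact absurd (h2.trans_le h1) (by rw [show G.maxDegree = 0 from h]; exact lt_irrefl 0)
    refine le_of_eq_of_le (measure_eq_zero_iff_ae_notMem.2 ?_) zero_le
    filter_upwards [ae_regularClocks X y₀ hT] with ω hω hnot
    exact hnot ((terminatesWithin_zero hω hG).mono (by positivity))
  · have h1 : (1 : ℝ) ≤ maxDeg G := by exact_mod_cast h
    refine (law_not_terminatesWithin_anti ?_).trans
      (law_not_terminatesWithin_le_inv (y₀ := y₀) (D := D) a hT (by positivity)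
        (lipschitzCondition_maxDeg (X := X) h))
    rw [mul_comm 2, mul_assoc]
    gcongr
    nlinarith

end Network

/-! ### The distribution of the output -/

section Network

variable {V : Type*} [Fintype V] {G : SimpleGraph V} {q : ℕ}
  (X : MetropolisChain G q) {T : ℝ} (y₀ : V → Fin q)

theorem ae_chain_eq (D : Scheduler V) (hT : 0 ≤ T) : ∀ᵐ ω ∂law X, ∀ v,
    chain X y₀ T ω v = valueAt X T y₀ ω D v ((timetable X T y₀ ω).count v) := by
  filter_upwards [ae_regularClocks X y₀ hT, ae_all_iff.2 fun p : V × ℕ => ae_ringTime_ne X T p.1 p.2]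
    with ω h1 h2 v
  exact chain_eq h1 h2 v

/-- Almost surely the chain equals a function of the timetable, and every such function is
measurable. -/
theorem aemeasurable_chain (D : Scheduler V) (hT : 0 ≤ T) :
    AEMeasurable (chain X y₀ T) (law X) := by
  refine ⟨fun ω v => valueAt X T y₀ ω D v ((timetable X T y₀ ω).count v), ?_, ?_⟩
  · refine measurable_pi_iff.2 fun v => measurable_to_countable' fun c => ?_
    exact measurableSet_timetable X T y₀ {S | S.value y₀ (S.run G D y₀) v (S.count v) = c}
  · filter_upwards [ae_chain_eq X y₀ D hT] with ω h
    exact funext h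

/-- The output and the chain agree almost surely as functions of the same random choices, which is
stronger than equality in law. -/
theorem identDistrib_chain (D : Scheduler V) (hT : 0 ≤ T)
    {out : (V × ℕ → Coins q) → V → Fin q}
    (hout : ∀ᵐ ω ∂law X, HasOutput G D (mainAlgorithm X T y₀ ω) (out ω)) :
    IdentDistrib out (chain X y₀ T) (law X) (law X) := by
  refine (IdentDistrib.of_ae_eq (aemeasurable_chain X y₀ D hT) ?_).symm
  filter_upwards [ae_chain_eq X y₀ D hT, ae_regularClocks X y₀ hT, hout] with ω h1 h2 h3
  funext v
  rw [h1, eq_of_hasOutput h2 h3]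

end Network

end

end AsyncMetropolis

theorem mainTheorem2 :
    -- correctness
    (∀ (V : Type u) [Fintype V] (G : SimpleGraph V) (q : ℕ) (X : MetropolisChain G q) (T : ℝ)
        (y₀ : V → Fin q) (D : Scheduler V), 0 ≤ T →
      (∀ᵐ ω ∂(law X), AlwaysTerminates G D (mainAlgorithm X T y₀ ω)) ∧
      ∀ out : (V × ℕ → Coins q) → V → Fin q,
        (∀ᵐ ω ∂(law X), HasOutput G D (mainAlgorithm X T y₀ ω) (out ω)) →
        IdentDistrib out (chain X y₀ T) (law X) (law X)) ∧
    -- time complexity, in general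
    (∀ a : ℕ, ∃ K : ℝ, 0 < K ∧
      ∀ (V : Type u) [Fintype V] (G : SimpleGraph V) (q : ℕ) (X : MetropolisChain G q) (T : ℝ)
        (y₀ : V → Fin q) (D : Scheduler V), 0 ≤ T →
      law X {ω | ¬ TerminatesWithin G D (mainAlgorithm X T y₀ ω)
          (K * (maxDeg G * T + Real.log (Fintype.card V)))} ≤
        ((Fintype.card V : ENNReal) ^ a)⁻¹) ∧
    -- time complexity under the Lipschitz condition
    (∀ a : ℕ, ∃ K : ℝ, 0 < K ∧
      ∀ (V : Type u) [Fintype V] (G : SimpleGraph V) (q : ℕ) (X : MetropolisChain G q) (T : ℝ)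
        (y₀ : V → Fin q) (D : Scheduler V) (C : ℝ), 0 ≤ T → 0 < C → LipschitzCondition X C →
      law X {ω | ¬ TerminatesWithin G D (mainAlgorithm X T y₀ ω)
          (K * ((1 + C) * T + Real.log (Fintype.card V)))} ≤
        ((Fintype.card V : ENNReal) ^ a)⁻¹) ∧
    -- message complexity
    (∃ K : ℝ, 0 < K ∧
      ∀ (V : Type u) [Fintype V] (G : SimpleGraph V) (q : ℕ) (X : MetropolisChain G q) (T : ℝ)
        (y₀ : V → Fin q) (D : Scheduler V), 0 ≤ T →
      ∀ᵐ ω ∂(law X), ∀ m : Msg q, IsSent G D (mainAlgorithm X T y₀ ω) m →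
        (m.bitLength : ℝ) ≤
          K * (Real.log (Fintype.card V) + Real.log ⌈T⌉₊ + Real.log q)) := by
  refine ⟨fun V _ G q X T y₀ D hT => ⟨?_, fun out => identDistrib_chain X y₀ D hT⟩,
    fun a => ⟨2 * (3 * a + 8), by positivity, fun V _ G q X T y₀ D hT =>
      law_not_terminatesWithin_maxDeg_le_inv a hT⟩,
    fun a => ⟨3 * a + 8, by positivity, fun V _ G q X T y₀ D C hT hC0 hC =>
      law_not_terminatesWithin_le_inv a hT hC0 hC⟩,
    42, by norm_num, fun V _ G q X T y₀ D hT => ?_⟩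
  · filter_upwards [ae_regularClocks X y₀ hT] with ω h using alwaysTerminates h
  · filter_upwards [ae_regularClocks X y₀ hT] with ω h m hm
    obtain ⟨u, v, k, huv, rfl⟩ := exists_message_of_isSent h hm
    exact bitLength_message_le h huv k
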